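/- Let $\mathcal H=\{x\in\mathbb R^4:-(x^0)^2+(x^1)^2+(x^2)^2+(x^3)^2=1\}$ be the 3-dimensional unit hyperboloid with the induced Lorentzian metric $h_{ab}$, Levi-Civita connection $D_a$, $\square=D^aD_a$ and volume form $\epsilon_{abc}$. In the coordinates $(\tau,\theta,\phi)$ given by $x=(\sinh\tau,\cosh\tau\sin\theta\cos\phi,\cosh\tau\sin\theta\sin\phi,\cosh\tau\cos\theta)$ the metric is $-d\tau^2+\cosh^2\tau\,(d\theta^2+\sin^2\theta\,d\phi^2)$, and $\epsilon_{\tau\theta\phi}>0$. For $\hat k\in\mathbb R$ and $\mu=0,\dots,3$ let $k_{(\mu)ab}=k^{(\mu)}_{ab}$ be the symmetric tensors on $0<\theta<\pi$ whose only nonzero components are, up to symmetry, $$k_{(0)\tau\phi}=2\,\frac{\hat k-\cos\theta}{\cosh\tau},\qquad k_{(0)\theta\phi}=\sinh\tau\,\frac{\cos2\theta-4\hat k\cos\theta+3}{2\sin\theta};$$ $$k_{(1)\tau\phi}=-3\,\frac{\tanh\tau}{\cosh\tau}\sin^2\theta,\qquad k_{(1)\theta\phi}=\frac{-8\hat k+9\cos\theta-\cos3\theta}{4\sin\theta}\cosh\tau;$$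 $$k_{(2)\tau\theta}=3\,\frac{\tanh\tau}{\cosh\tau}\sin\phi,\qquad k_{(2)\tau\phi}=3\,\frac{\tanh\tau}{\cosh\tau}\cos\theta\sin\theta\cos\phi,$$ $$k_{(2)\theta\theta}=\frac{8\hat k-9\cos\theta+\cos3\theta}{2\sin^3\theta}\cosh\tau\sin\phi,\qquad k_{(2)\theta\phi}=\frac{\cos^4\theta-4\hat k\cos\theta+3}{\sin^2\theta}\cosh\tau\cos\phi,$$ $$k_{(2)\phi\phi}=\frac{-8\hat k+9\cos\theta-\cos3\theta}{2\sin\theta}\cosh\tau\sin\phi;$$ and $k_{(3)ab}$ is obtained from $k_{(2)ab}$ by replacing $\sin\phi$ by $-\cos\phi$ and $\cos\phi$ by $\sin\phi$. The north patch is $\mathcal H$ without the string $\theta=\pi$, where one takes $\hat k=+1$; the south patch is $\mathcal H$ without the string $\theta=0$, where one takes $\hat k=-1$. Put $\delta k_{(\mu)ab}=k_{(\mu)ab}|_{\hat k=-1}-k_{(\mu)ab}|_{\hat k=+1}$. Let $$\zeta_{(0)}=-\sinh\tau,\quad \zeta_{(1)}=\cosh\tau\cos\theta,\quad \zeta_{(2)}=\cosh\tau\sin\theta\cos\phi,\quad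 \zeta_{(3)}=\cosh\tau\sin\theta\sin\phi,$$ and, with $r(\tau)=2\sinh\tau+\tanh\tau/\cosh\tau$, $$\hat\zeta_{(0)}=\frac{\cosh2\tau}{\cosh\tau},\quad \hat\zeta_{(1)}=r(\tau)\cos\theta,\quad \hat\zeta_{(2)}=r(\tau)\sin\theta\cos\phi,\quad \hat\zeta_{(3)}=r(\tau)\sin\theta\sin\phi.$$ (a) For every smooth scalar $\Phi$ on $\mathcal H$ with $\square\Phi+3\Phi=0$, the tensor $T_{ab}=D_aD_b\Phi+h_{ab}\Phi$ is symmetric, traceless, curl-free ($\epsilon_a{}^{cd}D_cT_{db}=0$) and divergence-free. (b) The tensors $k_{(\mu)ab}$ extend to smooth tensor fields on the north patch for $\hat k=+1$ and on the south patch for $\hat k=-1$. For every $\Phi$ as in (a) there are real numbers $N_{(\mu)}$ and a tensor field $P^{reg}_{ab}$, smooth on all of $\mathcal H$, such that $$P_{ab}=\sum_{\mu=0}^3N_{(\mu)}k^{(\mu)}_{ab}+P^{reg}_{ab}$$ is symmetric and traceless and satisfies $T_{ab}=\epsilon_a{}^{cd}D_cP_{db}$, on the north patch with $\hat k=+1$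 and on the south patch with $\hat k=-1$ (same $N_{(\mu)}$ and $P^{reg}_{ab}$ in both). (c) On $0<\theta<\pi$, for every $\hat k$, the tensors $k_{(\mu)ab}$ are symmetric and traceless, $\square\hat\zeta_{(\mu)}+3\hat\zeta_{(\mu)}=0$, and $D_aD_b\hat\zeta_{(\mu)}+h_{ab}\hat\zeta_{(\mu)}=\epsilon_a{}^{cd}D_ck_{(\mu)db}$. (d) On $0<\theta<\pi$, $D_aD_b\zeta_{(\nu)}+h_{ab}\zeta_{(\nu)}=0$, and for all $\mu,\nu=0,\dots,3$, all $\tau\in\mathbb R$ and all $0<\theta<\pi$, $$\int_0^{2\pi}d\phi\;\delta k_{(\mu)\phi a}D^a\zeta_{(\nu)}=-8\pi\,\delta_{(\mu)(\nu)}.$$ -/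

import Mathlib

open scoped ContDiff

namespace UnitHyperboloid

noncomputable section

/-! ### Tensor calculus in a coordinate system `u = (u⁰, u¹, u²)`

The metric components `g` and the components of a covariant 2-tensor `T` are matrix-valued
functions of the coordinates. -/

/-- The partial derivative `∂ᵢ f`. -/
def pd {F : Type*} [NormedAddCommGroup F] [NormedSpace ℝ F] (i : Fin 3)
    (f : (Fin 3 → ℝ) → F) (u : Fin 3 → ℝ) : F :=
  fderiv ℝ f u (Pi.single i 1)

/-- Christoffel symbols `Γᶜ_ab` of the Levi-Civita connection of `g`. -/
def christoffel (g : (Fin 3 → ℝ) → Matrix (Fin 3) (Fin 3) ℝ) (c a b : Fin 3)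
    (u : Fin 3 → ℝ) : ℝ :=
  (1 / 2) * ∑ d, (g u)⁻¹ c d *
    (pd a (fun v => g v d b) u + pd b (fun v => g v d a) u - pd d (fun v => g v a b) u)

/-- The Hessian `D_a D_b f` of a scalar. -/
def hess (g : (Fin 3 → ℝ) → Matrix (Fin 3) (Fin 3) ℝ) (f : (Fin 3 → ℝ) → ℝ) (a b : Fin 3)
    (u : Fin 3 → ℝ) : ℝ :=
  pd a (pd b f) u - ∑ c, christoffel g c a b u * pd c f u

/-- The wave operator `□ f = g^{ab} D_a D_b f` on scalars. -/
def box (g : (Fin 3 → ℝ) → Matrix (Fin 3) (Fin 3) ℝ) (f : (Fin 3 → ℝ) → ℝ)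
    (u : Fin 3 → ℝ) : ℝ :=
  ∑ a, ∑ b, (g u)⁻¹ a b * hess g f a b u

/-- The gradient `D^a f = g^{ab} ∂_b f`. -/
def grad (g : (Fin 3 → ℝ) → Matrix (Fin 3) (Fin 3) ℝ) (f : (Fin 3 → ℝ) → ℝ) (a : Fin 3)
    (u : Fin 3 → ℝ) : ℝ :=
  ∑ b, (g u)⁻¹ a b * pd b f u

/-- The covariant derivative `D_c T_ab`. -/
def covD (g T : (Fin 3 → ℝ) → Matrix (Fin 3) (Fin 3) ℝ) (c a b : Fin 3) (u : Fin 3 → ℝ) : ℝ :=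
  pd c (fun v => T v a b) u - ∑ e, christoffel g e c a u * T u e b
    - ∑ e, christoffel g e c b u * T u a e

/-- The trace `g^{ab} T_ab`. -/
def tr (g T : (Fin 3 → ℝ) → Matrix (Fin 3) (Fin 3) ℝ) (u : Fin 3 → ℝ) : ℝ :=
  ∑ a, ∑ b, (g u)⁻¹ a b * T u a b

/-- The divergence `D^a T_ab`. -/
def divg (g T : (Fin 3 → ℝ) → Matrix (Fin 3) (Fin 3) ℝ) (b : Fin 3) (u : Fin 3 → ℝ) : ℝ :=
  ∑ a, ∑ c, (g u)⁻¹ a c * covD g T c a b u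

/-- The volume form `ε_abc` of `g` in positively oriented coordinates: `√|det g|` times the
sign of `(a, b, c)` as a permutation of `(0, 1, 2)` (zero if an index repeats). -/
def eps (g : (Fin 3 → ℝ) → Matrix (Fin 3) (Fin 3) ℝ) (a b c : Fin 3) (u : Fin 3 → ℝ) : ℝ :=
  √|(g u).det| * ((1 : Matrix (Fin 3) (Fin 3) ℝ).submatrix ![a, b, c] id).det

/-- The curl `(curl T)_ab = ε_a^{cd} D_c T_db`. -/
def curl (g T : (Fin 3 → ℝ) → Matrix (Fin 3) (Fin 3) ℝ) (a b : Fin 3) (u : Fin 3 → ℝ) : ℝ :=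
  ∑ c, ∑ d, (∑ e, ∑ f, (g u)⁻¹ c e * (g u)⁻¹ d f * eps g a e f u) * covD g T c d b u

/-- The tensor `T_ab = D_a D_b f + g_ab f`. -/
def hessPlus (g : (Fin 3 → ℝ) → Matrix (Fin 3) (Fin 3) ℝ) (f : (Fin 3 → ℝ) → ℝ) :
    (Fin 3 → ℝ) → Matrix (Fin 3) (Fin 3) ℝ :=
  fun u => Matrix.of fun a b => hess g f a b u + g u a b * f u

/-! ### The hyperboloid and its fields

Points of Minkowski space are `x = (x⁰, x¹, x², x³)`, with `x⁰` the time coordinate. -/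

/-- The Minkowski product of signature `(-, +, +, +)`. -/
def mink (v w : Fin 4 → ℝ) : ℝ :=
  -(v 0 * w 0) + v 1 * w 1 + v 2 * w 2 + v 3 * w 3

/-- The 3-dimensional unit hyperboloid. -/
def hyp : Set (Fin 4 → ℝ) := {x | mink x x = 1}

/-- The hyperboloid without the string `θ = π`. -/
def northPatch : Set (Fin 4 → ℝ) := {x | x ∈ hyp ∧ ¬ (x 1 = 0 ∧ x 2 = 0 ∧ x 3 < 0)}

/-- The hyperboloid without the string `θ = 0`. -/
def southPatch : Set (Fin 4 → ℝ) := {x | x ∈ hyp ∧ ¬ (x 1 = 0 ∧ x 2 = 0 ∧ 0 < x 3)}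

/-- `X : U → S` is a smooth, positively oriented local parametrization of a subset `S` of the
hyperboloid. The coordinate vectors followed by the outward normal `X` form a positive basis of
`ℝ⁴`, which makes `X` an immersion and the coordinates `(τ, θ, φ)` positively oriented. -/
structure IsChart (S : Set (Fin 4 → ℝ)) (U : Set (Fin 3 → ℝ))
    (X : (Fin 3 → ℝ) → Fin 4 → ℝ) : Prop where
  isOpen : IsOpen U
  smooth : ContDiffOn ℝ ∞ X U
  mapsTo : ∀ u ∈ U, X u ∈ S
  oriented : ∀ u ∈ U, 0 < (Matrix.of ![pd 0 X u, pd 1 X u, pd 2 X u, X u]).det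

/-- The components `h_ab` of the induced metric in the parametrization `X`. -/
def metric (X : (Fin 3 → ℝ) → Fin 4 → ℝ) : (Fin 3 → ℝ) → Matrix (Fin 3) (Fin 3) ℝ :=
  fun u => Matrix.of fun a b => mink (pd a X u) (pd b X u)

/-- The components in the parametrization `X` of the 2-tensor field on the hyperboloid that is
the restriction to tangent vectors of the field `A` of bilinear forms of `ℝ⁴`. Every (smooth)
2-tensor field on (an open part of) the hyperboloid is such a restriction of a (smooth) `A`. -/
def comps (X : (Fin 3 → ℝ) → Fin 4 → ℝ) (A : (Fin 4 → ℝ) → Fin 4 → Fin 4 → ℝ) :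
    (Fin 3 → ℝ) → Matrix (Fin 3) (Fin 3) ℝ :=
  fun u => Matrix.of fun a b => ∑ i, ∑ j, A (X u) i j * pd a X u i * pd b X u j

/-- `Φ` is a smooth solution of `□Φ + 3Φ = 0` on the hyperboloid. -/
def IsSolution (Φ : (Fin 4 → ℝ) → ℝ) : Prop :=
  ContDiffOn ℝ ∞ Φ hyp ∧ ∀ U X, IsChart hyp U X → ∀ u ∈ U,
    box (metric X) (fun v => Φ (X v)) u + 3 * Φ (X u) = 0

/-- `P_ab` is symmetric and traceless on `S`, and `D_a D_b Φ + h_ab Φ = ε_a^{cd} D_c P_db`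
there. -/
def IsPotentialOn (S : Set (Fin 4 → ℝ)) (Φ : (Fin 4 → ℝ) → ℝ)
    (P : (Fin 4 → ℝ) → Fin 4 → Fin 4 → ℝ) : Prop :=
  ∀ U X, IsChart S U X → ∀ u ∈ U,
    (∀ a b, comps X P u a b = comps X P u b a) ∧
    tr (metric X) (comps X P) u = 0 ∧
    ∀ a b, hessPlus (metric X) (fun v => Φ (X v)) u a b = curl (metric X) (comps X P) a b u

/-! ### Explicit fields in the coordinates `(τ, θ, φ)` -/

/-- The parametrization of the hyperboloid by `u = (τ, θ, φ)`. -/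
def sph (u : Fin 3 → ℝ) : Fin 4 → ℝ :=
  ![Real.sinh (u 0), Real.cosh (u 0) * Real.sin (u 1) * Real.cos (u 2),
    Real.cosh (u 0) * Real.sin (u 1) * Real.sin (u 2), Real.cosh (u 0) * Real.cos (u 1)]

/-- The range `0 < θ < π` of the coordinates `(τ, θ, φ)`. -/
def sphDom : Set (Fin 3 → ℝ) := {u | 0 < u 1 ∧ u 1 < Real.pi}

open Real in
/-- The translation scalars `ζ_(μ)`. -/
def zeta (μ : Fin 4) (u : Fin 3 → ℝ) : ℝ :=
  ![-sinh (u 0),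
    cosh (u 0) * cos (u 1),
    cosh (u 0) * sin (u 1) * cos (u 2),
    cosh (u 0) * sin (u 1) * sin (u 2)] μ

open Real in
/-- The parity-time even scalars `ζ̂_(μ)`. -/
def zetaHat (μ : Fin 4) (u : Fin 3 → ℝ) : ℝ :=
  ![cosh (2 * u 0) / cosh (u 0),
    (2 * sinh (u 0) + tanh (u 0) / cosh (u 0)) * cos (u 1),
    (2 * sinh (u 0) + tanh (u 0) / cosh (u 0)) * (sin (u 1) * cos (u 2)),
    (2 * sinh (u 0) + tanh (u 0) / cosh (u 0)) * (sin (u 1) * sin (u 2))] μ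

open Real in
/-- `k_(0)ab` with the parameter `k̂ = κ`. -/
def k0 (κ τ θ : ℝ) : Matrix (Fin 3) (Fin 3) ℝ :=
  !![0, 0, 2 * ((κ - cos θ) / cosh τ);
     0, 0, sinh τ * ((cos (2 * θ) - 4 * κ * cos θ + 3) / (2 * sin θ));
     2 * ((κ - cos θ) / cosh τ),
       sinh τ * ((cos (2 * θ) - 4 * κ * cos θ + 3) / (2 * sin θ)), 0]

open Real in
/-- `k_(1)ab`. -/
def k1 (κ τ θ : ℝ) : Matrix (Fin 3) (Fin 3) ℝ :=
  !![0, 0, -3 * (tanh τ / cosh τ) * sin θ ^ 2;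
     0, 0, (-8 * κ + 9 * cos θ - cos (3 * θ)) / (4 * sin θ) * cosh τ;
     -3 * (tanh τ / cosh τ) * sin θ ^ 2,
       (-8 * κ + 9 * cos θ - cos (3 * θ)) / (4 * sin θ) * cosh τ, 0]

open Real in
/-- `k_(2)ab`. -/
def k2 (κ τ θ φ : ℝ) : Matrix (Fin 3) (Fin 3) ℝ :=
  !![0, 3 * (tanh τ / cosh τ) * sin φ, 3 * (tanh τ / cosh τ) * cos θ * sin θ * cos φ;
     3 * (tanh τ / cosh τ) * sin φ,
       (8 * κ - 9 * cos θ + cos (3 * θ)) / (2 * sin θ ^ 3) * cosh τ * sin φ,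
       (cos θ ^ 4 - 4 * κ * cos θ + 3) / sin θ ^ 2 * cosh τ * cos φ;
     3 * (tanh τ / cosh τ) * cos θ * sin θ * cos φ,
       (cos θ ^ 4 - 4 * κ * cos θ + 3) / sin θ ^ 2 * cosh τ * cos φ,
       (-8 * κ + 9 * cos θ - cos (3 * θ)) / (2 * sin θ) * cosh τ * sin φ]

open Real in
/-- `k_(3)ab`. -/
def k3 (κ τ θ φ : ℝ) : Matrix (Fin 3) (Fin 3) ℝ :=
  !![0, -3 * (tanh τ / cosh τ) * cos φ, 3 * (tanh τ / cosh τ) * cos θ * sin θ * sin φ;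
     -3 * (tanh τ / cosh τ) * cos φ,
       (-8 * κ + 9 * cos θ - cos (3 * θ)) / (2 * sin θ ^ 3) * cosh τ * cos φ,
       (cos θ ^ 4 - 4 * κ * cos θ + 3) / sin θ ^ 2 * cosh τ * sin φ;
     3 * (tanh τ / cosh τ) * cos θ * sin θ * sin φ,
       (cos θ ^ 4 - 4 * κ * cos θ + 3) / sin θ ^ 2 * cosh τ * sin φ,
       (8 * κ - 9 * cos θ + cos (3 * θ)) / (2 * sin θ) * cosh τ * cos φ]

/-- The components `k_(μ)ab` of the four singular tensors, with `κ = +1` in the north patch and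
`κ = -1` in the south patch. -/
def kSing (κ : ℝ) (μ : Fin 4) (u : Fin 3 → ℝ) : Matrix (Fin 3) (Fin 3) ℝ :=
  ![k0 κ (u 0) (u 1), k1 κ (u 0) (u 1), k2 κ (u 0) (u 1) (u 2), k3 κ (u 0) (u 1) (u 2)] μ

/-- The transition functions `δk_(μ) = k_(μ)|_South - k_(μ)|_North`. -/
def deltaK (μ : Fin 4) (u : Fin 3 → ℝ) : Matrix (Fin 3) (Fin 3) ℝ :=
  kSing (-1) μ u - kSing 1 μ u

end

end UnitHyperboloid

open UnitHyperboloid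

open UnitHyperboloid

/-! The tensor T. Extend Φ to the cone of spacelike vectors as a function F homogeneous of degree
one. The second fundamental form of the hyperboloid is the metric up to sign, and Euler's relation
reads ∂_x F = F, so D_a D_b Φ + h_ab Φ is the restriction to tangent vectors of the ambient Hessian
of F (`IsChart.hessPlus_eq`), which moreover annihilates the normal x. Symmetry of third derivatives
makes T curl-free, the trace of T is □Φ + 3Φ, and the divergence of a curl-free symmetric tensor is
the gradient of its trace (`hessPlus_props`).

The potential. The curl exchanges parity on the sphere, so P is sought as an odd tensor built from
two scalars V and χ on ℝ × S². The curl equation then reduces to two elliptic equations on each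
sphere, ΔV = cosh²τ Φ − cosh τ sinh τ ∂_τΦ and (Δ + 2)χ = 4 cosh τ sinh τ V + 2 cosh²τ ∂_τΦ,
together with evolution equations in τ (`hessPlus_eq_curl_oddTensor`). Only harmonics of degree 0
can obstruct the first and only those of degree 1 the second. If Φ = Δ(Δ + 2)w with w again a
solution of the wave equation, V and χ are explicit differential expressions in w and P is smooth on
the whole hyperboloid (`exists_regular_potential`).

Reaching this form requires inverting Δ(Δ + 2) away from degrees 0 and 1. As a function of z, the
cosine of the angle, (1 − z) log (1 − z) is a fundamental solution up to those degrees
(`zonal_greenKer_one`): replacing 1 by a > 1 makes it smooth, and Δ(Δ + 2) turns it into an explicit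
approximate identity minus 6z + 2a. Integral operators with zonal kernels commute with ∂_τ and Δ,
hence preserve the wave equation. What is left over are the projections to degrees 0 and 1, whose
amplitudes solve second order linear equations in τ with explicit solutions; these are the ζ_(μ) and
ζ̂_(μ) (`exists_decomposition`).

The ζ_(μ) are, up to sign, linear functions on Minkowski space and give T = 0. The ζ̂_(μ) are
integrated by the k_(μ) (`hessPlus_zetaHat`), which are smooth on their patches because their
components in dτ, dy₁, dy₂, dy₃ have the single denominator 1 + κ cos θ (`comps_singField`).
Superposition gives the potential in the chart (τ, θ, φ); density of this chart and the
chart-independent ambient form of the curl give it everywhere (`isPotentialOn_of_sph`). The flux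
integrals are a direct calculation (`integral_deltaK_flux`). -/

namespace UnitHyperboloid

/-! ### Rules of calculus for coordinate derivatives. -/

section PartialDerivatives

variable {F : Type*} [NormedAddCommGroup F] [NormedSpace ℝ F]

lemma pd_congr {i : Fin 3} {f g : (Fin 3 → ℝ) → F} {u : Fin 3 → ℝ}
    (h : f =ᶠ[nhds u] g) : pd i f u = pd i g u := by
  simp only [pd, h.fderiv_eq]

lemma pd_congr_on {i : Fin 3} {f g : (Fin 3 → ℝ) → F} {u : Fin 3 → ℝ} {s : Set (Fin 3 → ℝ)}
    (hs : IsOpen s) (h : Set.EqOn f g s) (hu : u ∈ s) : pd i f u = pd i g u :=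
  pd_congr (h.eventuallyEq_of_mem (hs.mem_nhds hu))

@[simp] lemma pd_const (i : Fin 3) (c : F) (u : Fin 3 → ℝ) : pd i (fun _ => c) u = 0 := by
  simp [pd]

lemma pd_coord (i j : Fin 3) (u : Fin 3 → ℝ) :
    pd i (fun v : Fin 3 → ℝ => v j) u = if j = i then 1 else 0 := by
  have : HasFDerivAt (fun v : Fin 3 → ℝ => v j)
      (ContinuousLinearMap.proj (R := ℝ) (φ := fun _ : Fin 3 => ℝ) j) u :=
    (ContinuousLinearMap.proj (R := ℝ) (φ := fun _ : Fin 3 => ℝ) j).hasFDerivAt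
  simp [pd, this.fderiv, Pi.single_apply]

lemma pd_add {i : Fin 3} {f g : (Fin 3 → ℝ) → F} {u : Fin 3 → ℝ}
    (hf : DifferentiableAt ℝ f u) (hg : DifferentiableAt ℝ g u) :
    pd i (fun v => f v + g v) u = pd i f u + pd i g u := by
  simp [pd, fderiv_fun_add hf hg]

lemma pd_sub {i : Fin 3} {f g : (Fin 3 → ℝ) → F} {u : Fin 3 → ℝ}
    (hf : DifferentiableAt ℝ f u) (hg : DifferentiableAt ℝ g u) :
    pd i (fun v => f v - g v) u = pd i f u - pd i g u := by
  simp [pd, fderiv_fun_sub hf hg]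

lemma pd_neg {i : Fin 3} {f : (Fin 3 → ℝ) → F} {u : Fin 3 → ℝ} :
    pd i (fun v => -f v) u = -pd i f u := by
  simp [pd, fderiv_fun_neg]

lemma pd_mul {i : Fin 3} {f g : (Fin 3 → ℝ) → ℝ} {u : Fin 3 → ℝ}
    (hf : DifferentiableAt ℝ f u) (hg : DifferentiableAt ℝ g u) :
    pd i (fun v => f v * g v) u = pd i f u * g u + f u * pd i g u := by
  simp [pd, fderiv_fun_mul hf hg]; ring

lemma pd_const_mul {i : Fin 3} {f : (Fin 3 → ℝ) → ℝ} {u : Fin 3 → ℝ} (c : ℝ) :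
    pd i (fun v => c * f v) u = c * pd i f u := by
  simp only [pd, ← smul_eq_mul]
  rw [show (fun v => c • f v) = c • f from rfl, fderiv_const_smul_field]; simp

lemma pd_sum {ι : Type*} {s : Finset ι} {i : Fin 3} {f : ι → (Fin 3 → ℝ) → F} {u : Fin 3 → ℝ}
    (hf : ∀ k ∈ s, DifferentiableAt ℝ (f k) u) :
    pd i (fun v => ∑ k ∈ s, f k v) u = ∑ k ∈ s, pd i (f k) u := by
  simp [pd, fderiv_fun_sum hf]

lemma pd_apply {n : ℕ} {i : Fin 3} {f : (Fin 3 → ℝ) → Fin n → ℝ} {u : Fin 3 → ℝ}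
    (hf : DifferentiableAt ℝ f u) (j : Fin n) :
    pd i f u j = pd i (fun v => f v j) u := by
  simp only [pd]
  rw [fderiv_apply hf]
  simp

lemma pd_comp {i : Fin 3} {g : ℝ → ℝ} {f : (Fin 3 → ℝ) → ℝ} {u : Fin 3 → ℝ} {d : ℝ}
    (hg : HasDerivAt g d (f u)) (hf : DifferentiableAt ℝ f u) :
    pd i (fun v => g (f v)) u = d * pd i f u := by
  have := (hg.comp_hasFDerivAt u hf.hasFDerivAt).fderiv
  simp only [pd]
  rw [show (fun v => g (f v)) = g ∘ f from rfl, this]; simp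

lemma pd_sin {i j : Fin 3} {u : Fin 3 → ℝ} :
    pd i (fun v => Real.sin (v j)) u = Real.cos (u j) * if j = i then 1 else 0 := by
  rw [pd_comp (Real.hasDerivAt_sin _) (by fun_prop), pd_coord]

lemma pd_cos {i j : Fin 3} {u : Fin 3 → ℝ} :
    pd i (fun v => Real.cos (v j)) u = -Real.sin (u j) * if j = i then 1 else 0 := by
  rw [pd_comp (Real.hasDerivAt_cos _) (by fun_prop), pd_coord]

lemma pd_sinh {i j : Fin 3} {u : Fin 3 → ℝ} :
    pd i (fun v => Real.sinh (v j)) u = Real.cosh (u j) * if j = i then 1 else 0 := by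
  rw [pd_comp (Real.hasDerivAt_sinh _) (by fun_prop), pd_coord]

lemma pd_cosh {i j : Fin 3} {u : Fin 3 → ℝ} :
    pd i (fun v => Real.cosh (v j)) u = Real.sinh (u j) * if j = i then 1 else 0 := by
  rw [pd_comp (Real.hasDerivAt_cosh _) (by fun_prop), pd_coord]

lemma pd_pow {i : Fin 3} {f : (Fin 3 → ℝ) → ℝ} {u : Fin 3 → ℝ} (n : ℕ)
    (hf : DifferentiableAt ℝ f u) :
    pd i (fun v => f v ^ n) u = n * f u ^ (n - 1) * pd i f u :=
  pd_comp (hasDerivAt_pow n _) hf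

lemma pd_inv {i : Fin 3} {f : (Fin 3 → ℝ) → ℝ} {u : Fin 3 → ℝ}
    (hf : DifferentiableAt ℝ f u) (h0 : f u ≠ 0) :
    pd i (fun v => (f v)⁻¹) u = -((f u) ^ 2)⁻¹ * pd i f u :=
  pd_comp (hasDerivAt_inv h0) hf

lemma pd_div {i : Fin 3} {f g : (Fin 3 → ℝ) → ℝ} {u : Fin 3 → ℝ}
    (hf : DifferentiableAt ℝ f u) (hg : DifferentiableAt ℝ g u) (h0 : g u ≠ 0) :
    pd i (fun v => f v / g v) u = (pd i f u * g u - f u * pd i g u) / g u ^ 2 := by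
  simp only [div_eq_mul_inv]
  rw [pd_mul hf (by fun_prop (disch := assumption)), pd_inv hg h0]
  field_simp
  ring

lemma contDiffOn_pd {i : Fin 3} {f : (Fin 3 → ℝ) → F} {s : Set (Fin 3 → ℝ)} (hs : IsOpen s)
    (hf : ContDiffOn ℝ ∞ f s) : ContDiffOn ℝ ∞ (pd i f) s :=
  (hf.fderiv_of_isOpen hs (m := ∞) (by simp)).clm_apply contDiffOn_const

lemma pd_comm {f : (Fin 3 → ℝ) → F} {s : Set (Fin 3 → ℝ)} (hs : IsOpen s)
    (hf : ContDiffOn ℝ ∞ f s) {u : Fin 3 → ℝ} (hu : u ∈ s) (i j : Fin 3) :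
    pd i (pd j f) u = pd j (pd i f) u := by
  have hd : DifferentiableAt ℝ (fderiv ℝ f) u :=
    ((hf.fderiv_of_isOpen hs (m := ∞) (by simp)).contDiffAt (hs.mem_nhds hu)).differentiableAt
      (by simp)
  have h2 : ∀ k l : Fin 3, pd k (pd l f) u
      = fderiv ℝ (fderiv ℝ f) u (Pi.single k 1) (Pi.single l 1) := by
    intro k l
    change fderiv ℝ (fun v => fderiv ℝ f v (Pi.single l 1)) u (Pi.single k 1) = _
    rw [fderiv_clm_apply hd (differentiableAt_const _)]
    simp
  rw [h2, h2]
  exact ((hf.contDiffAt (hs.mem_nhds hu)).isSymmSndFDerivAt (by simpa using WithTop.coe_le_coe.2 (le_top (a := (2 : ℕ∞))))) _ _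

end PartialDerivatives

/-! ### The metric, connection and operators in the coordinates (τ, θ, φ). -/

section SphericalCoordinates

lemma isOpen_sphDom : IsOpen sphDom :=
  (isOpen_lt continuous_const (continuous_apply 1)).inter
    (isOpen_lt (continuous_apply 1) continuous_const)

lemma sin_pos_of_mem {u : Fin 3 → ℝ} (hu : u ∈ sphDom) : 0 < Real.sin (u 1) :=
  Real.sin_pos_of_pos_of_lt_pi hu.1 hu.2

lemma contDiff_sph : ContDiff ℝ ∞ sph := by
  rw [contDiff_pi]
  intro i
  fin_cases i <;> simp [sph] <;> fun_prop

/-- The coordinate vectors of the parametrization `sph`. -/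
lemma pd_sph (i : Fin 3) (u : Fin 3 → ℝ) : pd i sph u = ![
    ![Real.cosh (u 0), Real.sinh (u 0) * Real.sin (u 1) * Real.cos (u 2),
      Real.sinh (u 0) * Real.sin (u 1) * Real.sin (u 2), Real.sinh (u 0) * Real.cos (u 1)],
    ![0, Real.cosh (u 0) * Real.cos (u 1) * Real.cos (u 2),
      Real.cosh (u 0) * Real.cos (u 1) * Real.sin (u 2), -(Real.cosh (u 0) * Real.sin (u 1))],
    ![0, -(Real.cosh (u 0) * Real.sin (u 1) * Real.sin (u 2)),
      Real.cosh (u 0) * Real.sin (u 1) * Real.cos (u 2), 0]] i := by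
  funext j
  rw [pd_apply (contDiff_sph.differentiable (by simp) u)]
  fin_cases j <;> simp only [sph] <;> fin_cases i <;>
    simp (disch := fun_prop) [pd_mul, pd_sin, pd_cos, pd_sinh, pd_cosh]

lemma metric_sph (u : Fin 3 → ℝ) : metric sph u = Matrix.diagonal
    ![-1, Real.cosh (u 0) ^ 2, Real.cosh (u 0) ^ 2 * Real.sin (u 1) ^ 2] := by
  have h0 := Real.cosh_sq (u 0)
  have h1 := Real.sin_sq_add_cos_sq (u 1)
  have h2 := Real.sin_sq_add_cos_sq (u 2)
  ext a b
  simp only [metric, mink, pd_sph, Matrix.of_apply]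
  fin_cases a <;> fin_cases b <;> simp [Matrix.diagonal]
  all_goals grind

lemma metric_sph_inv {u : Fin 3 → ℝ} (hu : u ∈ sphDom) : (metric sph u)⁻¹ = Matrix.diagonal
    ![-1, 1 / Real.cosh (u 0) ^ 2, 1 / (Real.cosh (u 0) ^ 2 * Real.sin (u 1) ^ 2)] := by
  have hs := (sin_pos_of_mem hu).ne'
  have hc := (Real.cosh_pos (u 0)).ne'
  apply Matrix.inv_eq_right_inv
  rw [metric_sph, Matrix.diagonal_mul_diagonal, ← Matrix.diagonal_one]
  congr 1
  funext i
  fin_cases i <;> simp <;> field_simp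

/-- The Christoffel symbols `Γᶜ_ab` in the coordinates `(τ, θ, φ)`. -/
noncomputable def sphGamma (u : Fin 3 → ℝ) (c a b : Fin 3) : ℝ :=
  ![!![0, 0, 0;
       0, Real.cosh (u 0) * Real.sinh (u 0), 0;
       0, 0, Real.cosh (u 0) * Real.sinh (u 0) * Real.sin (u 1) ^ 2],
    !![0, Real.sinh (u 0) / Real.cosh (u 0), 0;
       Real.sinh (u 0) / Real.cosh (u 0), 0, 0;
       0, 0, -(Real.sin (u 1) * Real.cos (u 1))],
    !![0, 0, Real.sinh (u 0) / Real.cosh (u 0);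
       0, 0, Real.cos (u 1) / Real.sin (u 1);
       Real.sinh (u 0) / Real.cosh (u 0), Real.cos (u 1) / Real.sin (u 1), 0]] c a b

lemma christoffel_sph {u : Fin 3 → ℝ} (hu : u ∈ sphDom) (c a b : Fin 3) :
    christoffel (metric sph) c a b u = sphGamma u c a b := by
  have hs := (sin_pos_of_mem hu).ne'
  have hc := (Real.cosh_pos (u 0)).ne'
  have hd : ∀ i a b : Fin 3, pd i (fun v => metric sph v a b) u =
      if a = b then ![0, 2 * Real.cosh (u 0) * Real.sinh (u 0) * (if i = 0 then 1 else 0),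
        2 * Real.cosh (u 0) * Real.sinh (u 0) * Real.sin (u 1) ^ 2 * (if i = 0 then 1 else 0)
        + 2 * Real.cosh (u 0) ^ 2 * Real.sin (u 1) * Real.cos (u 1) * (if i = 1 then 1 else 0)] a
      else 0 := by
    intro i a b
    simp only [metric_sph]
    fin_cases a <;> fin_cases b <;> simp [Matrix.diagonal] <;> fin_cases i <;>
      simp (disch := fun_prop) [pd_mul, pd_sin, pd_cosh, pd_pow] <;> ring
  simp only [christoffel, metric_sph_inv hu, hd, Fin.sum_univ_three, sphGamma]
  fin_cases c <;> fin_cases a <;> fin_cases b <;> simp [Matrix.diagonal] <;> field_simp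

lemma eps_sph {u : Fin 3 → ℝ} (hu : u ∈ sphDom) (a b c : Fin 3) :
    eps (metric sph) a b c u = Real.cosh (u 0) ^ 2 * Real.sin (u 1) *
      ![!![0, 0, 0; 0, 0, 1; 0, -1, 0], !![0, 0, -1; 0, 0, 0; 1, 0, 0],
        !![0, 1, 0; -1, 0, 0; 0, 0, 0]] a b c := by
  have hs := sin_pos_of_mem hu
  have hc := Real.cosh_pos (u 0)
  -- The Lorentzian signature makes the determinant negative; sin θ > 0 on the chart selects the
  -- root of its absolute value.
  have hdet : √|(metric sph u).det| = Real.cosh (u 0) ^ 2 * Real.sin (u 1) := by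
    rw [metric_sph, Matrix.det_diagonal, Fin.prod_univ_three]
    rw [show |(![-1, Real.cosh (u 0) ^ 2, Real.cosh (u 0) ^ 2 * Real.sin (u 1) ^ 2] :
      Fin 3 → ℝ) 0 * (![-1, Real.cosh (u 0) ^ 2, Real.cosh (u 0) ^ 2 * Real.sin (u 1) ^ 2] :
      Fin 3 → ℝ) 1 * (![-1, Real.cosh (u 0) ^ 2, Real.cosh (u 0) ^ 2 * Real.sin (u 1) ^ 2] :
      Fin 3 → ℝ) 2| = (Real.cosh (u 0) ^ 2 * Real.sin (u 1)) ^ 2 by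
        simp [abs_mul]; ring]
    exact Real.sqrt_sq (by positivity)
  rw [eps, hdet]
  congr 1
  rw [Matrix.det_fin_three]
  simp only [Matrix.submatrix_apply, id, Matrix.one_apply]
  fin_cases a <;> fin_cases b <;> fin_cases c <;> simp

lemma tr_sph {u : Fin 3 → ℝ} (hu : u ∈ sphDom) (T : (Fin 3 → ℝ) → Matrix (Fin 3) (Fin 3) ℝ) :
    tr (metric sph) T u = -T u 0 0 + T u 1 1 / Real.cosh (u 0) ^ 2
      + T u 2 2 / (Real.cosh (u 0) ^ 2 * Real.sin (u 1) ^ 2) := by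
  simp only [tr, metric_sph_inv hu, Fin.sum_univ_three]
  simp [Matrix.diagonal]
  ring

lemma box_sph {u : Fin 3 → ℝ} (hu : u ∈ sphDom) (f : (Fin 3 → ℝ) → ℝ) :
    box (metric sph) f u = -pd 0 (pd 0 f) u
      - 2 * (Real.sinh (u 0) / Real.cosh (u 0)) * pd 0 f u
      + (pd 1 (pd 1 f) u + Real.cos (u 1) / Real.sin (u 1) * pd 1 f u
        + pd 2 (pd 2 f) u / Real.sin (u 1) ^ 2) / Real.cosh (u 0) ^ 2 := by
  have hs := (sin_pos_of_mem hu).ne'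
  have hc := (Real.cosh_pos (u 0)).ne'
  simp only [box, hess, metric_sph_inv hu, Fin.sum_univ_three, christoffel_sph hu, sphGamma]
  simp [Matrix.diagonal]
  field_simp
  ring

/-- As the metric is diagonal, a single antisymmetrized pair of covariant derivatives survives for
each value of the first index. -/
lemma curl_sph {u : Fin 3 → ℝ} (hu : u ∈ sphDom)
    (T : (Fin 3 → ℝ) → Matrix (Fin 3) (Fin 3) ℝ) (a b : Fin 3) :
    curl (metric sph) T a b u =
      ![(covD (metric sph) T 1 2 b u - covD (metric sph) T 2 1 b u) /
          (Real.cosh (u 0) ^ 2 * Real.sin (u 1)),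
        (covD (metric sph) T 0 2 b u - covD (metric sph) T 2 0 b u) / Real.sin (u 1),
        (covD (metric sph) T 1 0 b u - covD (metric sph) T 0 1 b u) * Real.sin (u 1)] a := by
  have hs := (sin_pos_of_mem hu).ne'
  have hc := (Real.cosh_pos (u 0)).ne'
  simp only [curl, metric_sph_inv hu, Fin.sum_univ_three, eps_sph hu]
  fin_cases a <;> simp [Matrix.diagonal] <;> field_simp <;> ring

end SphericalCoordinates

end UnitHyperboloid

namespace UnitHyperboloid

/-! ### First and second derivatives of ζ̂_(μ). -/

section ExplicitFields

open Real

/-- Eliminating cosh 2τ and tanh τ leaves expressions rational in sinh τ and cosh τ, a form that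
differentiation preserves. -/
lemma zetaHat_eq (μ : Fin 4) : zetaHat μ = fun u =>
    ![2 * cosh (u 0) - 1 / cosh (u 0),
      (2 * sinh (u 0) + sinh (u 0) / cosh (u 0) ^ 2) * cos (u 1),
      (2 * sinh (u 0) + sinh (u 0) / cosh (u 0) ^ 2) * (sin (u 1) * cos (u 2)),
      (2 * sinh (u 0) + sinh (u 0) / cosh (u 0) ^ 2) * (sin (u 1) * sin (u 2))] μ := by
  funext u
  have hc := (cosh_pos (u 0)).ne'
  simp only [zetaHat, tanh_eq_sinh_div_cosh]
  fin_cases μ <;> simp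
  · rw [cosh_two_mul, sinh_sq]; field_simp; ring
  all_goals left; field_simp

/-- An equality of functions, not of values, so that it can be rewritten under a second derivative.
-/
lemma pd_zetaHat (μ : Fin 4) (i : Fin 3) : pd i (zetaHat μ) = fun u =>
    ![![2 * sinh (u 0) + sinh (u 0) / cosh (u 0) ^ 2, 0, 0],
      ![(2 * cosh (u 0) - 1 / cosh (u 0) + 2 / cosh (u 0) ^ 3) * cos (u 1),
        -(2 * sinh (u 0) + sinh (u 0) / cosh (u 0) ^ 2) * sin (u 1), 0],
      ![(2 * cosh (u 0) - 1 / cosh (u 0) + 2 / cosh (u 0) ^ 3) * (sin (u 1) * cos (u 2)),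
        (2 * sinh (u 0) + sinh (u 0) / cosh (u 0) ^ 2) * (cos (u 1) * cos (u 2)),
        -(2 * sinh (u 0) + sinh (u 0) / cosh (u 0) ^ 2) * (sin (u 1) * sin (u 2))],
      ![(2 * cosh (u 0) - 1 / cosh (u 0) + 2 / cosh (u 0) ^ 3) * (sin (u 1) * sin (u 2)),
        (2 * sinh (u 0) + sinh (u 0) / cosh (u 0) ^ 2) * (cos (u 1) * sin (u 2)),
        (2 * sinh (u 0) + sinh (u 0) / cosh (u 0) ^ 2) * (sin (u 1) * cos (u 2))]] μ i := by
  funext u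
  have hc := (cosh_pos (u 0)).ne'
  have hc2 : cosh (u 0) ^ 2 ≠ 0 := pow_ne_zero _ hc
  have hsq := sinh_sq (u 0)
  rw [zetaHat_eq]
  fin_cases μ <;> fin_cases i <;>
    simp (disch := first | assumption | fun_prop (disch := assumption))
      [pd_mul, pd_sin, pd_cos, pd_sinh, pd_cosh, pd_add, pd_sub, pd_div, pd_pow, pd_inv] <;>
    field_simp <;> (try rw [hsq]) <;> ring_nf <;> try simp

lemma hess_sph {u : Fin 3 → ℝ} (hu : u ∈ sphDom) (f : (Fin 3 → ℝ) → ℝ) (a b : Fin 3) :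
    hessPlus (metric sph) f u a b =
      pd a (pd b f) u - (sphGamma u 0 a b * pd 0 f u + sphGamma u 1 a b * pd 1 f u +
        sphGamma u 2 a b * pd 2 f u) + Matrix.diagonal
    ![-1, Real.cosh (u 0) ^ 2, Real.cosh (u 0) ^ 2 * Real.sin (u 1) ^ 2] a b * f u := by
  simp only [hessPlus, hess, Matrix.of_apply, christoffel_sph hu, metric_sph, Fin.sum_univ_three]

lemma pd_pd_zetaHat (μ : Fin 4) (i j : Fin 3) (u : Fin 3 → ℝ) : pd i (pd j (zetaHat μ)) u =
    ![!![2 * cosh (u 0) - 1 / cosh (u 0) + 2 / cosh (u 0) ^ 3, 0, 0; 0, 0, 0; 0, 0, 0],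
      !![(2 * sinh (u 0) + sinh (u 0) / cosh (u 0) ^ 2 - 6 * sinh (u 0) / cosh (u 0) ^ 4) * cos (u 1),
        -(2 * cosh (u 0) - 1 / cosh (u 0) + 2 / cosh (u 0) ^ 3) * sin (u 1), 0;
        -(2 * cosh (u 0) - 1 / cosh (u 0) + 2 / cosh (u 0) ^ 3) * sin (u 1),
        -(2 * sinh (u 0) + sinh (u 0) / cosh (u 0) ^ 2) * cos (u 1), 0; 0, 0, 0],
      !![(2 * sinh (u 0) + sinh (u 0) / cosh (u 0) ^ 2 - 6 * sinh (u 0) / cosh (u 0) ^ 4) *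
          (sin (u 1) * cos (u 2)),
        (2 * cosh (u 0) - 1 / cosh (u 0) + 2 / cosh (u 0) ^ 3) * (cos (u 1) * cos (u 2)),
        -(2 * cosh (u 0) - 1 / cosh (u 0) + 2 / cosh (u 0) ^ 3) * (sin (u 1) * sin (u 2));
        (2 * cosh (u 0) - 1 / cosh (u 0) + 2 / cosh (u 0) ^ 3) * (cos (u 1) * cos (u 2)),
        -(2 * sinh (u 0) + sinh (u 0) / cosh (u 0) ^ 2) * (sin (u 1) * cos (u 2)),
        -(2 * sinh (u 0) + sinh (u 0) / cosh (u 0) ^ 2) * (cos (u 1) * sin (u 2));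
        -(2 * cosh (u 0) - 1 / cosh (u 0) + 2 / cosh (u 0) ^ 3) * (sin (u 1) * sin (u 2)),
        -(2 * sinh (u 0) + sinh (u 0) / cosh (u 0) ^ 2) * (cos (u 1) * sin (u 2)),
        -(2 * sinh (u 0) + sinh (u 0) / cosh (u 0) ^ 2) * (sin (u 1) * cos (u 2))],
      !![(2 * sinh (u 0) + sinh (u 0) / cosh (u 0) ^ 2 - 6 * sinh (u 0) / cosh (u 0) ^ 4) *
          (sin (u 1) * sin (u 2)),
        (2 * cosh (u 0) - 1 / cosh (u 0) + 2 / cosh (u 0) ^ 3) * (cos (u 1) * sin (u 2)),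
        (2 * cosh (u 0) - 1 / cosh (u 0) + 2 / cosh (u 0) ^ 3) * (sin (u 1) * cos (u 2));
        (2 * cosh (u 0) - 1 / cosh (u 0) + 2 / cosh (u 0) ^ 3) * (cos (u 1) * sin (u 2)),
        -(2 * sinh (u 0) + sinh (u 0) / cosh (u 0) ^ 2) * (sin (u 1) * sin (u 2)),
        (2 * sinh (u 0) + sinh (u 0) / cosh (u 0) ^ 2) * (cos (u 1) * cos (u 2));
        (2 * cosh (u 0) - 1 / cosh (u 0) + 2 / cosh (u 0) ^ 3) * (sin (u 1) * cos (u 2)),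
        (2 * sinh (u 0) + sinh (u 0) / cosh (u 0) ^ 2) * (cos (u 1) * cos (u 2)),
        -(2 * sinh (u 0) + sinh (u 0) / cosh (u 0) ^ 2) * (sin (u 1) * sin (u 2))]] μ i j := by
  have hc := (cosh_pos (u 0)).ne'
  have hc2 : cosh (u 0) ^ 2 ≠ 0 := pow_ne_zero _ hc
  have hc3 : cosh (u 0) ^ 3 ≠ 0 := pow_ne_zero _ hc
  have hsq := sinh_sq (u 0)
  rw [pd_zetaHat]
  fin_cases μ <;> fin_cases i <;> fin_cases j <;>
    simp (disch := first | assumption | fun_prop (disch := assumption))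
      [pd_mul, pd_sin, pd_cos, pd_sinh, pd_cosh, pd_add, pd_sub, pd_div, pd_pow, pd_inv, pd_neg] <;>
    field_simp <;> (try rw [hsq]) <;> ring_nf <;> try simp

end ExplicitFields

end UnitHyperboloid

namespace UnitHyperboloid

/-! ### Algebraic properties of k_(μ), and the equations for ζ_(μ) and ζ̂_(μ). -/

section ExplicitFields

open Real

/-- Multiple angles become polynomials in cos θ, ready to be differentiated. The equality holds for
all u: at sin θ = 0 both sides follow the convention for division by zero. -/
lemma kSing_eq (κ : ℝ) (μ : Fin 4) : kSing κ μ = fun u =>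
    ![!![0, 0, 2 * (κ - cos (u 1)) / cosh (u 0);
        0, 0, sinh (u 0) * (cos (u 1) ^ 2 - 2 * κ * cos (u 1) + 1) / sin (u 1);
        2 * (κ - cos (u 1)) / cosh (u 0),
        sinh (u 0) * (cos (u 1) ^ 2 - 2 * κ * cos (u 1) + 1) / sin (u 1), 0],
      !![0, 0, -3 * sinh (u 0) * sin (u 1) ^ 2 / cosh (u 0) ^ 2;
        0, 0, cosh (u 0) * (-2 * κ + 3 * cos (u 1) - cos (u 1) ^ 3) / sin (u 1);
        -3 * sinh (u 0) * sin (u 1) ^ 2 / cosh (u 0) ^ 2,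
        cosh (u 0) * (-2 * κ + 3 * cos (u 1) - cos (u 1) ^ 3) / sin (u 1), 0],
      !![0, 3 * sinh (u 0) / cosh (u 0) ^ 2 * sin (u 2),
        3 * sinh (u 0) / cosh (u 0) ^ 2 * (cos (u 1) * sin (u 1)) * cos (u 2);
        3 * sinh (u 0) / cosh (u 0) ^ 2 * sin (u 2),
        cosh (u 0) * (4 * κ - 6 * cos (u 1) + 2 * cos (u 1) ^ 3) / sin (u 1) ^ 3 * sin (u 2),
        cosh (u 0) * (cos (u 1) ^ 4 - 4 * κ * cos (u 1) + 3) / sin (u 1) ^ 2 * cos (u 2);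
        3 * sinh (u 0) / cosh (u 0) ^ 2 * (cos (u 1) * sin (u 1)) * cos (u 2),
        cosh (u 0) * (cos (u 1) ^ 4 - 4 * κ * cos (u 1) + 3) / sin (u 1) ^ 2 * cos (u 2),
        cosh (u 0) * (-4 * κ + 6 * cos (u 1) - 2 * cos (u 1) ^ 3) / sin (u 1) * sin (u 2)],
      !![0, -3 * sinh (u 0) / cosh (u 0) ^ 2 * cos (u 2),
        3 * sinh (u 0) / cosh (u 0) ^ 2 * (cos (u 1) * sin (u 1)) * sin (u 2);
        -3 * sinh (u 0) / cosh (u 0) ^ 2 * cos (u 2),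
        cosh (u 0) * (-4 * κ + 6 * cos (u 1) - 2 * cos (u 1) ^ 3) / sin (u 1) ^ 3 * cos (u 2),
        cosh (u 0) * (cos (u 1) ^ 4 - 4 * κ * cos (u 1) + 3) / sin (u 1) ^ 2 * sin (u 2);
        3 * sinh (u 0) / cosh (u 0) ^ 2 * (cos (u 1) * sin (u 1)) * sin (u 2),
        cosh (u 0) * (cos (u 1) ^ 4 - 4 * κ * cos (u 1) + 3) / sin (u 1) ^ 2 * sin (u 2),
        cosh (u 0) * (4 * κ - 6 * cos (u 1) + 2 * cos (u 1) ^ 3) / sin (u 1) * cos (u 2)]] μ := by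
  funext u
  have hc := (cosh_pos (u 0)).ne'
  simp only [kSing, k0, k1, k2, k3, tanh_eq_sinh_div_cosh, cos_two_mul, cos_three_mul]
  ext a b
  -- Numerical factors leave the denominators without the assumption sin θ ≠ 0.
  have div_form : ∀ p s : ℝ, p / (4 * s) = p / 4 / s ∧ p / (2 * s) = p / 2 / s := fun p s => by
    constructor <;> rw [div_div]
  fin_cases μ <;> fin_cases a <;> fin_cases b <;> simp [div_form] <;> ring_nf <;> try simp

lemma kSing_isSymm (κ : ℝ) (μ : Fin 4) (u : Fin 3 → ℝ) : (kSing κ μ u).IsSymm := by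
  ext a b
  rw [kSing_eq]
  fin_cases μ <;> fin_cases a <;> fin_cases b <;> simp

lemma tr_kSing {u : Fin 3 → ℝ} (hu : u ∈ sphDom) (κ : ℝ) (μ : Fin 4) :
    tr (metric sph) (kSing κ μ) u = 0 := by
  have hs := (sin_pos_of_mem hu).ne'
  have hc := (cosh_pos (u 0)).ne'
  rw [tr_sph hu, kSing_eq]
  fin_cases μ <;> simp <;> field_simp <;> ring

lemma box_zetaHat {u : Fin 3 → ℝ} (hu : u ∈ sphDom) (μ : Fin 4) :
    box (metric sph) (zetaHat μ) u + 3 * zetaHat μ u = 0 := by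
  have hs := (sin_pos_of_mem hu).ne'
  have hc := (cosh_pos (u 0)).ne'
  have hsq := sinh_sq (u 0)
  have hsin := sin_sq (u 1)
  rw [box_sph hu, pd_pd_zetaHat, pd_pd_zetaHat, pd_pd_zetaHat, pd_zetaHat, pd_zetaHat, zetaHat_eq]
  fin_cases μ <;> simp <;> field_simp <;> ring_nf <;> (try simp only [hsq, hsin]) <;> ring_nf

lemma pd_zeta (μ : Fin 4) (i : Fin 3) : pd i (zeta μ) = fun u =>
      ![![-cosh (u 0), 0, 0],
        ![sinh (u 0) * cos (u 1), -(cosh (u 0) * sin (u 1)), 0],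
        ![sinh (u 0) * sin (u 1) * cos (u 2), cosh (u 0) * cos (u 1) * cos (u 2),
          -(cosh (u 0) * sin (u 1) * sin (u 2))],
        ![sinh (u 0) * sin (u 1) * sin (u 2), cosh (u 0) * cos (u 1) * sin (u 2),
          cosh (u 0) * sin (u 1) * cos (u 2)]] μ i := by
  funext u
  unfold zeta
  fin_cases μ <;> fin_cases i <;>
    simp (disch := fun_prop) [pd_mul, pd_sin, pd_cos, pd_sinh, pd_cosh, pd_neg]

/-- The conceptual reason is that ζ_(μ) is, up to sign, a linear coordinate of Minkowski space, with
vanishing ambient Hessian; here the components are checked directly. -/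
lemma hessPlus_zeta {u : Fin 3 → ℝ} (hu : u ∈ sphDom) (μ : Fin 4) :
    hessPlus (metric sph) (zeta μ) u = 0 := by
  have hs := (sin_pos_of_mem hu).ne'
  have hc := (cosh_pos (u 0)).ne'
  have hsq := sinh_sq (u 0)
  have hsin := sin_sq (u 1)
  have hsin3 : sin (u 1) ^ 3 = sin (u 1) * (1 - cos (u 1) ^ 2) := by rw [← hsin]; ring
  ext a b
  rw [hess_sph hu, pd_zeta, pd_zeta, pd_zeta, pd_zeta]
  unfold zeta sphGamma
  fin_cases μ <;> fin_cases a <;> fin_cases b <;>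
    simp (disch := fun_prop) [pd_mul, pd_sin, pd_cos, pd_sinh, pd_cosh, pd_neg, Matrix.diagonal] <;>
    field_simp <;> ring_nf <;> (try simp only [hsq, hsin, hsin3]) <;> ring_nf

end ExplicitFields

end UnitHyperboloid

namespace UnitHyperboloid

/-! ### The curl of k_(μ) and the flux integrals. -/

section ExplicitFields

open Real

lemma covD_sph {u : Fin 3 → ℝ} (hu : u ∈ sphDom) (T : (Fin 3 → ℝ) → Matrix (Fin 3) (Fin 3) ℝ)
    (c a b : Fin 3) :
    covD (metric sph) T c a b u = pd c (fun v => T v a b) u -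
      (sphGamma u 0 c a * T u 0 b + sphGamma u 1 c a * T u 1 b + sphGamma u 2 c a * T u 2 b) -
      (sphGamma u 0 c b * T u a 0 + sphGamma u 1 c b * T u a 1 + sphGamma u 2 c b * T u a 2) := by
  simp only [covD, christoffel_sph hu, Fin.sum_univ_three]

-- The part of k_(μ) proportional to κ is curl-free, which is why one scalar serves every κ and in
-- particular both patches. All components are verified by reducing powers of sinh τ and sin θ.
set_option maxHeartbeats 2000000 in
lemma hessPlus_zetaHat {u : Fin 3 → ℝ} (hu : u ∈ sphDom) (κ : ℝ) (μ : Fin 4) (a b : Fin 3) :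
    hessPlus (metric sph) (zetaHat μ) u a b = curl (metric sph) (kSing κ μ) a b u := by
  have hs := (sin_pos_of_mem hu).ne'
  have hs2 : sin (u 1) ^ 2 ≠ 0 := pow_ne_zero _ hs
  have hs3 : sin (u 1) ^ 3 ≠ 0 := pow_ne_zero _ hs
  have hc := (cosh_pos (u 0)).ne'
  have hc2 : cosh (u 0) ^ 2 ≠ 0 := pow_ne_zero _ hc
  have h2 := sinh_sq (u 0)
  have p2 := sin_sq (u 1)
  have p4 : sin (u 1) ^ 4 = (1 - cos (u 1) ^ 2) ^ 2 := by rw [← p2]; ring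
  rw [curl_sph hu, hess_sph hu, pd_pd_zetaHat, pd_zetaHat, pd_zetaHat, pd_zetaHat, zetaHat_eq]
  simp only [covD_sph hu]
  rw [kSing_eq]
  unfold sphGamma
  fin_cases μ <;>
    simp only [Fin.zero_eta, Fin.isValue, Fin.mk_one, Fin.reduceFinMk, Matrix.cons_val] <;>
    fin_cases a <;> fin_cases b <;>
    simp only [Fin.zero_eta, Fin.isValue, Fin.mk_one, Fin.reduceFinMk, Matrix.cons_val,
      Matrix.of_apply, Matrix.diagonal, mul_zero, zero_mul, add_zero, zero_add, sub_zero, zero_sub,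
      pd_const, Matrix.cons_val'] <;>
    simp (disch := first | assumption | fun_prop (disch := assumption))
      [pd_mul, pd_sin, pd_cos, pd_sinh, pd_cosh, pd_add, pd_sub, pd_div, pd_pow, pd_neg] <;>
    field_simp <;> ring_nf <;> (try simp only [h2, p2, p4]) <;> try ring_nf

/-- Only the κ-linear part of k_(μ) survives in the difference. Separating the dependence on φ
prepares the integration. -/
lemma deltaK_flux {τ θ : ℝ} (h0 : 0 < θ) (h1 : θ < π) (μ ν : Fin 4) (φ : ℝ) :
    ∑ a, deltaK μ ![τ, θ, φ] 2 a * grad (metric sph) (zeta ν) a ![τ, θ, φ] =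
      !![-4, 0, 4 * sinh τ / (cosh τ * sin θ) * cos φ, 4 * sinh τ / (cosh τ * sin θ) * sin φ;
        0, -4, 4 * cos θ / sin θ * cos φ, 4 * cos θ / sin θ * sin φ;
        0, -8 * cos θ / sin θ * cos φ,
          8 * cos θ ^ 2 / sin θ ^ 2 * cos φ ^ 2 - 8 / sin θ ^ 2 * sin φ ^ 2,
          (8 * cos θ ^ 2 / sin θ ^ 2 + 8 / sin θ ^ 2) * (sin φ * cos φ);
        0, -8 * cos θ / sin θ * sin φ,
          (8 * cos θ ^ 2 / sin θ ^ 2 + 8 / sin θ ^ 2) * (sin φ * cos φ),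
          8 * cos θ ^ 2 / sin θ ^ 2 * sin φ ^ 2 - 8 / sin θ ^ 2 * cos φ ^ 2] μ ν := by
  have hu : (![τ, θ, φ] : Fin 3 → ℝ) ∈ sphDom := by simp [sphDom, h0, h1]
  have hs := (sin_pos_of_pos_of_lt_pi h0 h1).ne'
  have hc := (cosh_pos τ).ne'
  have p2 := sin_sq θ
  simp only [grad, deltaK, metric_sph_inv hu, Fin.sum_univ_three, pd_zeta, Matrix.sub_apply]
  rw [kSing_eq, kSing_eq]
  fin_cases μ <;> fin_cases ν <;> simp [Matrix.diagonal] <;>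
    field_simp <;> ring_nf <;> (try simp only [p2]) <;> ring_nf

/-- The off-diagonal entries have mean zero in φ. In the last two diagonal entries sin²φ and cos²φ
both have mean 1/2, and cos²θ − 1 = −sin²θ cancels the denominator. -/
lemma integral_deltaK_flux {τ θ : ℝ} (h0 : 0 < θ) (h1 : θ < π) (μ ν : Fin 4) :
    ∫ φ in (0 : ℝ)..(2 * π),
        ∑ a, deltaK μ ![τ, θ, φ] 2 a * grad (metric sph) (zeta ν) a ![τ, θ, φ] =
      -8 * π * (if μ = ν then 1 else 0) := by
  have hs := (sin_pos_of_pos_of_lt_pi h0 h1).ne'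
  have p2 := sin_sq θ
  have hc2 : ∀ k : ℝ, IntervalIntegrable (fun φ => k * cos φ ^ 2) MeasureTheory.volume 0 (2 * π) :=
    fun k => (by fun_prop : Continuous fun φ => k * cos φ ^ 2).intervalIntegrable _ _
  have hs2 : ∀ k : ℝ, IntervalIntegrable (fun φ => k * sin φ ^ 2) MeasureTheory.volume 0 (2 * π) :=
    fun k => (by fun_prop : Continuous fun φ => k * sin φ ^ 2).intervalIntegrable _ _
  simp only [deltaK_flux h0 h1]
  fin_cases μ <;> fin_cases ν <;>
    simp [intervalIntegral.integral_sub, hc2, hs2, integral_sin_mul_cos₁] <;>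
    field_simp <;> (try rw [p2]) <;> ring_nf

end ExplicitFields

end UnitHyperboloid

namespace UnitHyperboloid

/-! ### Ambient bilinear forms, volume form, covariant derivative, curl and trace. -/

section Ambient

lemma mink_comm (v w : Fin 4 → ℝ) : mink v w = mink w v := by simp only [mink]; ring

lemma mink_add_left (v v' w : Fin 4 → ℝ) : mink (v + v') w = mink v w + mink v' w := by
  simp only [mink, Pi.add_apply]; ring

lemma mink_smul_left (c : ℝ) (v w : Fin 4 → ℝ) : mink (c • v) w = c * mink v w := by
  simp only [mink, Pi.smul_apply, smul_eq_mul]; ring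

lemma mink_add_right (v w w' : Fin 4 → ℝ) : mink v (w + w') = mink v w + mink v w' := by
  simp only [mink, Pi.add_apply]; ring

lemma mink_smul_right (c : ℝ) (v w : Fin 4 → ℝ) : mink v (c • w) = c * mink v w := by
  simp only [mink, Pi.smul_apply, smul_eq_mul]; ring

/-- The signs `(-1, 1, 1, 1)` of the Minkowski metric. -/
def sgn : Fin 4 → ℝ := ![-1, 1, 1, 1]

/-- The bilinear form with components `M i j`. -/
def bil (M : Fin 4 → Fin 4 → ℝ) : (Fin 4 → ℝ) →ₗ[ℝ] (Fin 4 → ℝ) →ₗ[ℝ] ℝ :=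
  LinearMap.mk₂ ℝ (fun v w => ∑ i, ∑ j, M i j * v i * w j)
    (fun v v' w => by
      simp only [Pi.add_apply, ← Finset.sum_add_distrib]
      exact Finset.sum_congr rfl fun i _ => Finset.sum_congr rfl fun j _ => by ring)
    (fun c v w => by
      simp only [Pi.smul_apply, smul_eq_mul, Finset.mul_sum]
      exact Finset.sum_congr rfl fun i _ => Finset.sum_congr rfl fun j _ => by ring)
    (fun v w w' => by
      simp only [Pi.add_apply, ← Finset.sum_add_distrib]
      exact Finset.sum_congr rfl fun i _ => Finset.sum_congr rfl fun j _ => by ring)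
    (fun c v w => by
      simp only [Pi.smul_apply, smul_eq_mul, Finset.mul_sum]
      exact Finset.sum_congr rfl fun i _ => Finset.sum_congr rfl fun j _ => by ring)

lemma bil_apply (M : Fin 4 → Fin 4 → ℝ) (v w : Fin 4 → ℝ) :
    bil M v w = ∑ i, ∑ j, M i j * v i * w j := rfl

lemma bil_single (M : Fin 4 → Fin 4 → ℝ) (i j : Fin 4) :
    bil M (Pi.single i 1) (Pi.single j 1) = M i j := by
  simp [bil_apply, Pi.single_apply]

/-- The volume form of the hyperboloid at `x`, contracted with three vectors of `ℝ⁴`. -/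
def vol (x v₁ v₂ v₃ : Fin 4 → ℝ) : ℝ := (Matrix.of ![v₁, v₂, v₃, x]).det

lemma vol_eq (x a b c : Fin 4 → ℝ) : vol x a b c =
    a 0 * (b 1 * (c 2 * x 3 - c 3 * x 2) - b 2 * (c 1 * x 3 - c 3 * x 1) +
      b 3 * (c 1 * x 2 - c 2 * x 1)) -
    a 1 * (b 0 * (c 2 * x 3 - c 3 * x 2) - b 2 * (c 0 * x 3 - c 3 * x 0) +
      b 3 * (c 0 * x 2 - c 2 * x 0)) +
    a 2 * (b 0 * (c 1 * x 3 - c 3 * x 1) - b 1 * (c 0 * x 3 - c 3 * x 0) +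
      b 3 * (c 0 * x 1 - c 1 * x 0)) -
    a 3 * (b 0 * (c 1 * x 2 - c 2 * x 1) - b 1 * (c 0 * x 2 - c 2 * x 0) +
      b 2 * (c 0 * x 1 - c 1 * x 0)) := by
  rw [vol, Matrix.det_succ_row_zero]
  simp [Fin.sum_univ_succ, Matrix.det_fin_three, Fin.succAbove]
  ring

/-- The covariant derivative of the 2-tensor field `A` along the hyperboloid, at `x`. -/
noncomputable def nablaAt (A : (Fin 4 → ℝ) → Fin 4 → Fin 4 → ℝ) (x c v w : Fin 4 → ℝ) : ℝ :=
  bil (fderiv ℝ A x c) v w - mink c v * bil (A x) x w - mink c w * bil (A x) v x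

/-- The curl of the 2-tensor field `A` along the hyperboloid, at `x`. -/
noncomputable def curlAt (A : (Fin 4 → ℝ) → Fin 4 → Fin 4 → ℝ) (x v w : Fin 4 → ℝ) : ℝ :=
  ∑ i, ∑ j, sgn i * sgn j * vol x v (Pi.single i 1) (Pi.single j 1) *
    nablaAt A x (Pi.single i 1) (Pi.single j 1) w

/-- The trace of the 2-tensor `M` on the tangent space of the hyperboloid at `x`. -/
noncomputable def traceAt (M : Fin 4 → Fin 4 → ℝ) (x : Fin 4 → ℝ) : ℝ :=
  ∑ i, sgn i * M i i - bil M x x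

lemma bil_add (M N : Fin 4 → Fin 4 → ℝ) (v w : Fin 4 → ℝ) :
    bil (M + N) v w = bil M v w + bil N v w := by
  simp only [bil_apply, Pi.add_apply, ← Finset.sum_add_distrib]
  exact Finset.sum_congr rfl fun i _ => Finset.sum_congr rfl fun j _ => by ring

lemma bil_smul (c : ℝ) (M : Fin 4 → Fin 4 → ℝ) (v w : Fin 4 → ℝ) :
    bil (c • M) v w = c * bil M v w := by
  simp only [bil_apply, Pi.smul_apply, smul_eq_mul, Finset.mul_sum]
  exact Finset.sum_congr rfl fun i _ => Finset.sum_congr rfl fun j _ => by ring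

lemma vol_add (x v v' b c : Fin 4 → ℝ) : vol x (v + v') b c = vol x v b c + vol x v' b c := by
  simp only [vol_eq, Pi.add_apply]; ring

lemma vol_smul (x v b c : Fin 4 → ℝ) (k : ℝ) : vol x (k • v) b c = k * vol x v b c := by
  simp only [vol_eq, Pi.smul_apply, smul_eq_mul]; ring

/-- `curlAt` as a bilinear form. -/
noncomputable def curlForm (A : (Fin 4 → ℝ) → Fin 4 → Fin 4 → ℝ) (x : Fin 4 → ℝ) :
    (Fin 4 → ℝ) →ₗ[ℝ] (Fin 4 → ℝ) →ₗ[ℝ] ℝ :=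
  LinearMap.mk₂ ℝ (curlAt A x)
    (fun v v' w => by
      simp only [curlAt, vol_add, ← Finset.sum_add_distrib]
      exact Finset.sum_congr rfl fun i _ => Finset.sum_congr rfl fun j _ => by ring)
    (fun c v w => by
      simp only [curlAt, vol_smul, smul_eq_mul, Finset.mul_sum]
      exact Finset.sum_congr rfl fun i _ => Finset.sum_congr rfl fun j _ => by ring)
    (fun v w w' => by
      simp only [curlAt, nablaAt, mink_add_right, map_add, ← Finset.sum_add_distrib]
      exact Finset.sum_congr rfl fun i _ => Finset.sum_congr rfl fun j _ => by ring)
    (fun c v w => by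
      simp only [curlAt, nablaAt, mink_smul_right, map_smul, smul_eq_mul, Finset.mul_sum]
      exact Finset.sum_congr rfl fun i _ => Finset.sum_congr rfl fun j _ => by ring)

@[simp] lemma curlForm_apply (A : (Fin 4 → ℝ) → Fin 4 → Fin 4 → ℝ) (x v w : Fin 4 → ℝ) :
    curlForm A x v w = curlAt A x v w := rfl

lemma mink_single (i : Fin 4) (v : Fin 4 → ℝ) : mink (Pi.single i 1) v = sgn i * v i := by
  fin_cases i <;> simp [mink, sgn]

lemma sgn_mul_self (i : Fin 4) : sgn i * sgn i = 1 := by fin_cases i <;> simp [sgn]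

/-- Completeness of the standard orthonormal basis: the sign in `mink_single` is squared away. -/
lemma sum_sgn_mink (L : (Fin 4 → ℝ) →ₗ[ℝ] ℝ) (v : Fin 4 → ℝ) :
    ∑ i, sgn i * (mink (Pi.single i 1) v * L (Pi.single i 1)) = L v := by
  conv_rhs => rw [pi_eq_sum_univ' v]
  simp only [map_sum, map_smul, smul_eq_mul]
  refine Finset.sum_congr rfl fun i _ => ?_
  rw [mink_single]
  have h := sgn_mul_self i
  have : (fun j => if i = j then (1 : ℝ) else 0) = Pi.single i 1 := by
    funext j; simp [Pi.single_apply, eq_comm]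
  linear_combination (v i * L (Pi.single i 1)) * h

end Ambient

end UnitHyperboloid

namespace UnitHyperboloid

/-! ### The frame of coordinate vectors and normal in an arbitrary chart. -/

section Charts

variable {S : Set (Fin 4 → ℝ)} {U : Set (Fin 3 → ℝ)} {X : (Fin 3 → ℝ) → Fin 4 → ℝ}
  {u : Fin 3 → ℝ}

lemma IsChart.mono {S' : Set (Fin 4 → ℝ)} (hX : IsChart S U X) (h : S ⊆ S') : IsChart S' U X :=
  ⟨hX.isOpen, hX.smooth, fun u hu => h (hX.mapsTo u hu), hX.oriented⟩

lemma IsChart.contDiffAt (hX : IsChart S U X) (hu : u ∈ U) : ContDiffAt ℝ ∞ X u :=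
  hX.smooth.contDiffAt (hX.isOpen.mem_nhds hu)

lemma IsChart.differentiableAt (hX : IsChart S U X) (hu : u ∈ U) : DifferentiableAt ℝ X u :=
  (hX.contDiffAt hu).differentiableAt (by simp)

lemma IsChart.differentiableAt_pd (hX : IsChart S U X) (hu : u ∈ U) (a : Fin 3) :
    DifferentiableAt ℝ (pd a X) u :=
  ((contDiffOn_pd hX.isOpen hX.smooth).contDiffAt (hX.isOpen.mem_nhds hu)).differentiableAt
    (by simp)

lemma pd_mink {i : Fin 3} {A B : (Fin 3 → ℝ) → Fin 4 → ℝ} (hA : DifferentiableAt ℝ A u)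
    (hB : DifferentiableAt ℝ B u) :
    pd i (fun v => mink (A v) (B v)) u = mink (pd i A u) (B u) + mink (A u) (pd i B u) := by
  have hA' := fun j => differentiableAt_pi.1 hA j
  have hB' := fun j => differentiableAt_pi.1 hB j
  simp only [mink]
  have h : ∀ j, pd i (fun v => A v j * B v j) u = pd i A u j * B u j + A u j * pd i B u j :=
    fun j => by rw [pd_mul (hA' j) (hB' j), pd_apply hA, pd_apply hB]
  have h' : ∀ j, DifferentiableAt ℝ (fun v => A v j * B v j) u := fun j => (hA' j).mul (hB' j)
  rw [pd_add (((h' 0).fun_neg.fun_add (h' 1)).fun_add (h' 2)) (h' 3),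
    pd_add ((h' 0).fun_neg.fun_add (h' 1)) (h' 2), pd_add (h' 0).fun_neg (h' 1), pd_neg, h, h, h, h]
  ring

lemma IsChart.mink_self (hX : IsChart hyp U X) (hu : u ∈ U) : mink (X u) (X u) = 1 :=
  hX.mapsTo u hu

lemma IsChart.mink_tangent (hX : IsChart hyp U X) (hu : u ∈ U) (a : Fin 3) :
    mink (pd a X u) (X u) = 0 := by
  have h : pd a (fun v => mink (X v) (X v)) u = 0 := by
    rw [pd_congr_on hX.isOpen (g := fun _ => 1) (fun v hv => hX.mink_self hv) hu, pd_const]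
  rw [pd_mink (hX.differentiableAt hu) (hX.differentiableAt hu), mink_comm (X u)] at h
  linarith

/-- Differentiating the orthogonality of ∂_b X and X shows that the second fundamental form is minus
the metric. This is the source of the term h_ab Φ in T. -/
lemma IsChart.mink_second (hX : IsChart hyp U X) (hu : u ∈ U) (a b : Fin 3) :
    mink (pd a (pd b X) u) (X u) = -metric X u a b := by
  have h : pd a (fun v => mink (pd b X v) (X v)) u = 0 := by
    rw [pd_congr_on hX.isOpen (g := fun _ => 0) (fun v hv => hX.mink_tangent hv b) hu, pd_const]
  rw [pd_mink (hX.differentiableAt_pd hu b) (hX.differentiableAt hu)] at h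
  simp only [metric, Matrix.of_apply, mink_comm (pd a X u)]
  linarith

/-- The matrix whose rows are the coordinate vectors and the normal. -/
noncomputable def frame (X : (Fin 3 → ℝ) → Fin 4 → ℝ) (u : Fin 3 → ℝ) : Matrix (Fin 4) (Fin 4) ℝ :=
  Matrix.of ![pd 0 X u, pd 1 X u, pd 2 X u, X u]

/-- Since X is a unit normal, the Gram matrix of the frame is block diagonal with blocks h and 1.
Its determinant is also that of the Minkowski form, −1, times the square of the frame determinant.
-/
lemma IsChart.det_metric (hX : IsChart hyp U X) (hu : u ∈ U) :
    (metric X u).det = -(frame X u).det ^ 2 := by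
  have hG : (frame X u * Matrix.diagonal sgn * (frame X u).transpose).det = (metric X u).det := by
    have hGe : ∀ i j, (frame X u * Matrix.diagonal sgn * (frame X u).transpose) i j =
        mink (frame X u i) (frame X u j) := by
      intro i j
      simp [Matrix.mul_apply, Fin.sum_univ_four, Matrix.diagonal, sgn, mink]
    rw [Matrix.det_succ_row _ 3, Fin.sum_univ_four]
    have h3 : frame X u 3 = X u := rfl
    have hlast : ∀ a : Fin 3,
        (frame X u * Matrix.diagonal sgn * (frame X u).transpose) 3 a.castSucc = 0 := by
      intro a
      rw [hGe, mink_comm, h3]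
      fin_cases a
      · exact hX.mink_tangent hu 0
      · exact hX.mink_tangent hu 1
      · exact hX.mink_tangent hu 2
    have h0 := hlast 0
    have h1 := hlast 1
    have h2 := hlast 2
    have h33 : (frame X u * Matrix.diagonal sgn * (frame X u).transpose) 3 3 = 1 := by
      rw [hGe, h3]; exact hX.mink_self hu
    have hsub : (frame X u * Matrix.diagonal sgn * (frame X u).transpose).submatrix
        (Fin.succAbove 3) (Fin.succAbove 3) = metric X u := by
      ext a b
      rw [Matrix.submatrix_apply, hGe]
      fin_cases a <;> fin_cases b <;> rfl
    simp only [Fin.castSucc_zero, Fin.isValue, Fin.castSucc_one] at h0 h1 h2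
    rw [h0, h1, show (2 : Fin 4) = (2 : Fin 3).castSucc from rfl, h2, h33, hsub]
    norm_num
  rw [← hG, Matrix.det_mul, Matrix.det_mul, Matrix.det_transpose, Matrix.det_diagonal]
  simp [Fin.prod_univ_four, sgn]
  ring

lemma IsChart.isUnit_det_metric (hX : IsChart hyp U X) (hu : u ∈ U) :
    IsUnit (metric X u).det := by
  rw [hX.det_metric hu, isUnit_iff_ne_zero]
  have := hX.oriented u hu
  exact neg_ne_zero.2 (pow_ne_zero _ this.ne')

/-- The frame is a basis by orientation; pairing with X isolates the normal coefficient, and pairing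
with the coordinate vectors determines the others after inverting h. -/
lemma IsChart.expand (hX : IsChart hyp U X) (hu : u ∈ U) (v : Fin 4 → ℝ) :
    v = ∑ a, (∑ b, (metric X u)⁻¹ a b * mink v (pd b X u)) • pd a X u + mink v (X u) • X u := by
  have hJ : IsUnit (frame X u).transpose.det := by
    rw [Matrix.det_transpose, isUnit_iff_ne_zero]; exact (hX.oriented u hu).ne'
  obtain ⟨c, d, hv⟩ : ∃ (c : Fin 3 → ℝ) (d : ℝ), v = ∑ a, c a • pd a X u + d • X u := by
    set k := (frame X u).transpose⁻¹.mulVec v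
    refine ⟨![k 0, k 1, k 2], k 3, ?_⟩
    have h : v = (frame X u).transpose.mulVec k := by
      rw [Matrix.mulVec_mulVec, Matrix.mul_nonsing_inv _ hJ, Matrix.one_mulVec]
    rw [h]
    funext j
    simp [Matrix.mulVec, dotProduct, frame, Fin.sum_univ_four, Fin.sum_univ_three]
    ring
  have hd : mink v (X u) = d := by
    rw [hv, mink_add_left, mink_smul_left, hX.mink_self hu, Fin.sum_univ_three]
    simp [mink_add_left, mink_smul_left, hX.mink_tangent hu]
  have hb : ∀ b, mink v (pd b X u) = ∑ a, c a * metric X u a b := by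
    intro b
    rw [hv, mink_add_left, mink_smul_left, mink_comm (X u), hX.mink_tangent hu, Fin.sum_univ_three]
    simp [mink_add_left, mink_smul_left, Fin.sum_univ_three, metric]
  have hc : ∀ a, ∑ b, (metric X u)⁻¹ a b * mink v (pd b X u) = c a := by
    intro a
    have hsymm : ∀ a b, metric X u a b = metric X u b a := fun a b => mink_comm _ _
    have h : (metric X u)⁻¹.mulVec ((metric X u).mulVec c) a = c a := by
      rw [Matrix.mulVec_mulVec, Matrix.nonsing_inv_mul _ (hX.isUnit_det_metric hu),
        Matrix.one_mulVec]
    rw [← h]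
    simp only [Matrix.mulVec, dotProduct, hb]
    refine Finset.sum_congr rfl fun b _ => ?_
    congr 1
    exact Finset.sum_congr rfl fun a _ => by rw [hsymm, mul_comm]
  simp only [hc, hd]
  exact hv

/-- The trace over the tangent space in terms of the ambient trace. -/
lemma IsChart.sum_inv_metric (hX : IsChart hyp U X) (hu : u ∈ U)
    (B : (Fin 4 → ℝ) →ₗ[ℝ] (Fin 4 → ℝ) →ₗ[ℝ] ℝ) :
    ∑ a, ∑ b, (metric X u)⁻¹ a b * B (pd a X u) (pd b X u) =
      ∑ i, sgn i * B (Pi.single i 1) (Pi.single i 1) - B (X u) (X u) := by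
  have key : ∀ i, sgn i * B (Pi.single i 1) (Pi.single i 1) =
      ∑ a, ∑ b, (metric X u)⁻¹ a b *
        (sgn i * (mink (Pi.single i 1) (pd b X u) * B.flip (Pi.single i 1) (pd a X u) )) +
      sgn i * (mink (Pi.single i 1) (X u) * B.flip (Pi.single i 1) (X u)) := by
    intro i
    change sgn i * B.flip (Pi.single i 1) (Pi.single i 1) = _
    conv_lhs => enter [2, 2]; rw [hX.expand hu (Pi.single i 1)]
    simp only [map_add, map_sum, map_smul, smul_eq_mul, mul_add, Finset.sum_mul, Finset.mul_sum]
    congr 1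
    exact Finset.sum_congr rfl fun a _ => Finset.sum_congr rfl fun b _ => by ring
  simp only [key, Finset.sum_add_distrib]
  have h2 : ∀ v w : Fin 4 → ℝ, ∑ i, sgn i * (mink (Pi.single i 1) v * B.flip (Pi.single i 1) w) =
      B w v := by
    intro v w
    exact sum_sgn_mink (B w) v
  rw [h2]
  have : ∀ a : Fin 3, ∑ i, ∑ b, (metric X u)⁻¹ a b *
      (sgn i * (mink (Pi.single i 1) (pd b X u) * B.flip (Pi.single i 1) (pd a X u))) =
      ∑ b, (metric X u)⁻¹ a b * B (pd a X u) (pd b X u) := by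
    intro a
    rw [Finset.sum_comm]
    exact Finset.sum_congr rfl fun b _ => by rw [← Finset.mul_sum, h2]
  rw [← Finset.sum_congr rfl fun a _ => this a, Finset.sum_comm (s := Finset.univ (α := Fin 3))]
  ring

/-- By `IsChart.det_metric` the density √|det h| is the absolute value of the frame determinant, and
the orientation of the chart makes the latter positive. -/
lemma IsChart.eps_eq (hX : IsChart hyp U X) (hu : u ∈ U) (a b c : Fin 3) :
    eps (metric X) a b c u = vol (X u) (pd a X u) (pd b X u) (pd c X u) := by
  have hs : √|(metric X u).det| = vol (X u) (pd 0 X u) (pd 1 X u) (pd 2 X u) := by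
    rw [hX.det_metric hu, abs_neg, abs_pow, sq_abs, Real.sqrt_sq (show 0 ≤ (frame X u).det from (hX.oriented u hu).le)]
    rfl
  rw [eps, hs, Matrix.det_fin_three]
  simp only [Matrix.submatrix_apply, id, Matrix.one_apply, vol_eq]
  fin_cases a <;> fin_cases b <;> fin_cases c <;> simp <;> ring

end Charts

end UnitHyperboloid

namespace UnitHyperboloid

/-! ### Coordinate expressions as evaluations of ambient, chart-independent ones. -/

section Naturality

variable {U : Set (Fin 3 → ℝ)} {X : (Fin 3 → ℝ) → Fin 4 → ℝ} {u : Fin 3 → ℝ}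

lemma pd_comp_left {G : Type*} [NormedAddCommGroup G] [NormedSpace ℝ G] {i : Fin 3}
    {F : (Fin 4 → ℝ) → G} (hF : DifferentiableAt ℝ F (X u)) (hX : DifferentiableAt ℝ X u) :
    pd i (fun v => F (X v)) u = fderiv ℝ F (X u) (pd i X u) := by
  simp only [pd]
  rw [show (fun v => F (X v)) = F ∘ X from rfl, fderiv_comp u hF hX]
  simp

lemma IsChart.pd_metric (hX : IsChart hyp U X) (hu : u ∈ U) (c a b : Fin 3) :
    pd c (fun v => metric X v a b) u =
      mink (pd c (pd a X) u) (pd b X u) + mink (pd a X u) (pd c (pd b X) u) :=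
  pd_mink (hX.differentiableAt_pd hu a) (hX.differentiableAt_pd hu b)

/-- Of the six products obtained by differentiating the metric, symmetry of second derivatives
cancels four and identifies the other two. -/
lemma IsChart.christoffel_eq (hX : IsChart hyp U X) (hu : u ∈ U) (c a b : Fin 3) :
    christoffel (metric X) c a b u =
      ∑ d, (metric X u)⁻¹ c d * mink (pd a (pd b X) u) (pd d X u) := by
  rw [christoffel, Finset.mul_sum]
  refine Finset.sum_congr rfl fun d _ => ?_
  simp only [hX.pd_metric hu]
  rw [pd_comm hX.isOpen hX.smooth hu b a, pd_comm hX.isOpen hX.smooth hu d a,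
    pd_comm hX.isOpen hX.smooth hu d b, mink_comm (pd d X u), mink_comm (pd a X u)]
  ring

/-- Gauss formula. -/
lemma IsChart.gauss (hX : IsChart hyp U X) (hu : u ∈ U) (a b : Fin 3) :
    pd a (pd b X) u =
      ∑ c, christoffel (metric X) c a b u • pd c X u - metric X u a b • X u := by
  conv_lhs => rw [hX.expand hu (pd a (pd b X) u)]
  simp only [hX.christoffel_eq hu, hX.mink_second hu, neg_smul, sub_eq_add_neg]

/-- In the second order chain rule, the tangential part of ∂_a ∂_b X given by the Gauss formula
cancels the Christoffel terms; its normal part leaves the radial derivative of F. -/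
lemma IsChart.hess_eq (hX : IsChart hyp U X) (hu : u ∈ U) {F : (Fin 4 → ℝ) → ℝ}
    (hF : ContDiffAt ℝ ∞ F (X u)) (a b : Fin 3) :
    hess (metric X) (fun v => F (X v)) a b u =
      fderiv ℝ (fderiv ℝ F) (X u) (pd a X u) (pd b X u) -
        metric X u a b * fderiv ℝ F (X u) (X u) := by
  have hFd : DifferentiableAt ℝ F (X u) := hF.differentiableAt (by simp)
  have hF1 : DifferentiableAt ℝ (fderiv ℝ F) (X u) :=
    (hF.fderiv_right (m := ∞) (by simp)).differentiableAt (by simp)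
  have hev : ∀ᶠ v in nhds u, pd b (fun v => F (X v)) v = fderiv ℝ F (X v) (pd b X v) := by
    have h1 : ∀ᶠ y in nhds (X u), ContDiffAt ℝ 1 F y :=
      (hF.of_le (by simp)).eventually (by simp)
    filter_upwards [(hX.differentiableAt hu).continuousAt.eventually h1,
      hX.isOpen.mem_nhds hu] with v hv hvU
    exact pd_comp_left (hv.differentiableAt (by simp)) (hX.differentiableAt hvU)
  have h2 : pd a (pd b fun v => F (X v)) u =
      fderiv ℝ (fderiv ℝ F) (X u) (pd a X u) (pd b X u) +
        fderiv ℝ F (X u) (pd a (pd b X) u) := by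
    rw [pd_congr hev]
    have hc : DifferentiableAt ℝ (fun v => fderiv ℝ F (X v)) u :=
      hF1.comp u (hX.differentiableAt hu)
    have := pd_comp_left (i := a) hF1 (hX.differentiableAt hu)
    simp only [pd] at this
    change fderiv ℝ (fun v => fderiv ℝ F (X v) (pd b X v)) u (Pi.single a 1) = _
    rw [fderiv_clm_apply hc (hX.differentiableAt_pd hu b)]
    simp only [add_apply, ContinuousLinearMap.comp_apply,
      ContinuousLinearMap.flip_apply, this]
    rw [add_comm]
    rfl
  rw [hess, h2, hX.gauss hu a b]
  simp only [map_sub, map_sum, map_smul, smul_eq_mul, pd_comp_left hFd (hX.differentiableAt hu)]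
  ring

lemma comps_apply (A : (Fin 4 → ℝ) → Fin 4 → Fin 4 → ℝ) (a b : Fin 3) :
    comps X A u a b = bil (A (X u)) (pd a X u) (pd b X u) := rfl

/-- Differentiating the coordinate vectors produces tangential parts, which cancel the Christoffel
terms, and normal parts, which are the correction terms in `nablaAt`. -/
lemma IsChart.covD_comps (hX : IsChart hyp U X) (hu : u ∈ U)
    {A : (Fin 4 → ℝ) → Fin 4 → Fin 4 → ℝ} (hA : DifferentiableAt ℝ A (X u)) (c a b : Fin 3) :
    covD (metric X) (comps X A) c a b u = nablaAt A (X u) (pd c X u) (pd a X u) (pd b X u) := by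
  have hAX : DifferentiableAt ℝ (fun v => A (X v)) u := hA.comp u (hX.differentiableAt hu)
  have hAc : ∀ i j, DifferentiableAt ℝ (fun v => A (X v) i j) u := fun i j =>
    differentiableAt_pi.1 (differentiableAt_pi.1 hAX i) j
  have hAd : ∀ i j, pd c (fun v => A (X v) i j) u = fderiv ℝ A (X u) (pd c X u) i j := by
    intro i j
    rw [← pd_comp_left hA (hX.differentiableAt hu)]
    simp only [pd]
    rw [(hasFDerivAt_pi'.1 (hasFDerivAt_pi'.1 hAX.hasFDerivAt i) j).fderiv]
    rfl
  have he : ∀ a i, DifferentiableAt ℝ (fun v => pd a X v i) u := fun a =>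
    differentiableAt_pi.1 (hX.differentiableAt_pd hu a)
  have h1 : pd c (fun v => comps X A v a b) u =
      bil (fderiv ℝ A (X u) (pd c X u)) (pd a X u) (pd b X u) +
      bil (A (X u)) (pd c (pd a X) u) (pd b X u) + bil (A (X u)) (pd a X u) (pd c (pd b X) u) := by
    simp only [comps, Matrix.of_apply, bil_apply, ← Finset.sum_add_distrib]
    have hd : ∀ i j, DifferentiableAt ℝ (fun v => A (X v) i j * pd a X v i * pd b X v j) u :=
      fun i j => ((hAc i j).fun_mul (he a i)).fun_mul (he b j)
    rw [pd_sum fun i _ => DifferentiableAt.fun_sum fun j _ => hd i j]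
    refine Finset.sum_congr rfl fun i _ => ?_
    rw [pd_sum fun j _ => hd i j]
    refine Finset.sum_congr rfl fun j _ => ?_
    rw [pd_mul ((hAc i j).fun_mul (he a i)) (he b j), pd_mul (hAc i j) (he a i), hAd,
      pd_apply (hX.differentiableAt_pd hu a), pd_apply (hX.differentiableAt_pd hu b)]
    ring
  rw [covD, h1]
  simp only [comps_apply, nablaAt]
  rw [hX.gauss hu c a, hX.gauss hu c b]
  simp only [map_sub, map_sum, map_smul, smul_eq_mul, LinearMap.sub_apply, LinearMap.sum_apply,
    LinearMap.smul_apply]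
  simp only [metric, Matrix.of_apply]
  ring

lemma IsChart.tr_comps (hX : IsChart hyp U X) (hu : u ∈ U)
    (A : (Fin 4 → ℝ) → Fin 4 → Fin 4 → ℝ) :
    tr (metric X) (comps X A) u = traceAt (A (X u)) (X u) := by
  simp only [tr, comps_apply, hX.sum_inv_metric hu, traceAt, bil_single]

/-- Tangential traces differ from ambient ones by a normal term, and here each normal term contains
the volume form evaluated on X, hence vanishes. -/
lemma IsChart.sum_sum_inv_metric (hX : IsChart hyp U X) (hu : u ∈ U) (v : Fin 4 → ℝ)
    (n : (Fin 4 → ℝ) →ₗ[ℝ] (Fin 4 → ℝ) →ₗ[ℝ] ℝ) :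
    ∑ c, ∑ d, (∑ e, ∑ f, (metric X u)⁻¹ c e * (metric X u)⁻¹ d f *
      vol (X u) v (pd e X u) (pd f X u)) * n (pd c X u) (pd d X u) =
    ∑ i, ∑ j, sgn i * sgn j * vol (X u) v (Pi.single i 1) (Pi.single j 1) *
      n (Pi.single i 1) (Pi.single j 1) := by
  let V : (Fin 4 → ℝ) →ₗ[ℝ] (Fin 4 → ℝ) →ₗ[ℝ] ℝ := LinearMap.mk₂ ℝ (vol (X u) v)
    (fun a b c => by simp only [vol_eq, Pi.add_apply]; ring)
    (fun a b c => by simp only [vol_eq, Pi.smul_apply, smul_eq_mul]; ring)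
    (fun a b c => by simp only [vol_eq, Pi.add_apply]; ring)
    (fun a b c => by simp only [vol_eq, Pi.smul_apply, smul_eq_mul]; ring)
  have hV : ∀ a b, V a b = vol (X u) v a b := fun _ _ => rfl
  have hV0 : ∀ a, V a (X u) = 0 := fun a => by rw [hV, vol_eq]; ring
  have hV1 : ∀ a, V (X u) a = 0 := fun a => by rw [hV, vol_eq]; ring
  have inner : ∀ a b, ∑ d, ∑ f, (metric X u)⁻¹ d f * (n a (pd d X u) * V b (pd f X u)) =
      ∑ j, sgn j * (n a (Pi.single j 1) * V b (Pi.single j 1)) := by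
    intro a b
    have := hX.sum_inv_metric hu ((LinearMap.mul ℝ ℝ).compl₁₂ (n a) (V b))
    simpa [hV0] using this
  have outer : ∀ j, ∑ c, ∑ e, (metric X u)⁻¹ c e *
      (n (pd c X u) (Pi.single j 1) * V (pd e X u) (Pi.single j 1)) =
      ∑ i, sgn i * (n (Pi.single i 1) (Pi.single j 1) * V (Pi.single i 1) (Pi.single j 1)) := by
    intro j
    have := hX.sum_inv_metric hu
      ((LinearMap.mul ℝ ℝ).compl₁₂ (n.flip (Pi.single j 1)) (V.flip (Pi.single j 1)))
    simpa [hV1] using this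
  calc _ = ∑ c, ∑ e, (metric X u)⁻¹ c e *
        ∑ d, ∑ f, (metric X u)⁻¹ d f * (n (pd c X u) (pd d X u) * V (pd e X u) (pd f X u)) := by
        refine Finset.sum_congr rfl fun c _ => ?_
        simp only [Finset.sum_mul, Finset.mul_sum, hV]
        rw [Finset.sum_comm]
        refine Finset.sum_congr rfl fun e _ => Finset.sum_congr rfl fun d _ =>
          Finset.sum_congr rfl fun f _ => by ring
    _ = ∑ j, sgn j * ∑ c, ∑ e, (metric X u)⁻¹ c e *
        (n (pd c X u) (Pi.single j 1) * V (pd e X u) (Pi.single j 1)) := by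
        simp only [inner, Finset.mul_sum]
        rw [Finset.sum_congr rfl fun c _ => Finset.sum_comm, Finset.sum_comm]
        refine Finset.sum_congr rfl fun j _ => Finset.sum_congr rfl fun c _ =>
          Finset.sum_congr rfl fun e _ => by ring
    _ = _ := by
        simp only [outer, Finset.mul_sum]
        rw [Finset.sum_comm]
        exact Finset.sum_congr rfl fun i _ => Finset.sum_congr rfl fun j _ => by rw [hV]; ring

/-- This frees the curl from the chart: `curlAt` depends only on the point and two vectors, so
identities can be moved between charts and extended by continuity. -/
lemma IsChart.curl_comps (hX : IsChart hyp U X) (hu : u ∈ U)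
    {A : (Fin 4 → ℝ) → Fin 4 → Fin 4 → ℝ} (hA : DifferentiableAt ℝ A (X u)) (a b : Fin 3) :
    curl (metric X) (comps X A) a b u = curlAt A (X u) (pd a X u) (pd b X u) := by
  let n : (Fin 4 → ℝ) →ₗ[ℝ] (Fin 4 → ℝ) →ₗ[ℝ] ℝ :=
    LinearMap.mk₂ ℝ (fun v w => nablaAt A (X u) v w (pd b X u))
    (fun a b c => by
      simp only [nablaAt, map_add, bil_add, mink_add_left]; ring)
    (fun a b c => by
      simp only [nablaAt, map_smul, bil_smul, mink_smul_left, smul_eq_mul]; ring)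
    (fun a b c => by
      simp only [nablaAt, map_add, LinearMap.add_apply, mink_add_right]; ring)
    (fun a b c => by
      simp only [nablaAt, map_smul, LinearMap.smul_apply, mink_smul_right, smul_eq_mul]; ring)
  have := hX.sum_sum_inv_metric hu (pd a X u) n
  simp only [curl, hX.eps_eq hu, hX.covD_comps hu hA]
  exact this

end Naturality

end UnitHyperboloid

namespace UnitHyperboloid

/-! ### The extension homogeneous of degree one and its derivatives. -/

section HomogeneousExtension

/-- The solid cone of spacelike vectors. -/
def cone : Set (Fin 4 → ℝ) := {x | 0 < mink x x}

lemma contDiff_mink_self : ContDiff ℝ ∞ (fun x : Fin 4 → ℝ => mink x x) := by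
  unfold mink; fun_prop

lemma isOpen_cone : IsOpen cone := isOpen_lt continuous_const contDiff_mink_self.continuous

lemma hyp_subset_cone : hyp ⊆ cone := fun x hx => by
  have : mink x x = 1 := hx
  simp [cone, this]

/-- The extension of a scalar field from the hyperboloid to the solid cone that is homogeneous
of degree one. -/
noncomputable def homExt (Φ : (Fin 4 → ℝ) → ℝ) (x : Fin 4 → ℝ) : ℝ :=
  √(mink x x) * Φ ((√(mink x x))⁻¹ • x)

variable {Φ : (Fin 4 → ℝ) → ℝ}

lemma homExt_of_mem {x : Fin 4 → ℝ} (hx : x ∈ hyp) : homExt Φ x = Φ x := by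
  have : mink x x = 1 := hx
  simp [homExt, this]

lemma normalize_mem_hyp {x : Fin 4 → ℝ} (hx : x ∈ cone) : (√(mink x x))⁻¹ • x ∈ hyp := by
  have h : 0 < mink x x := hx
  have h2 := Real.sq_sqrt h.le
  have h3 := (Real.sqrt_pos.2 h).ne'
  simp only [hyp, Set.mem_ofPred_eq, mink_smul_left, mink_smul_right]
  field_simp
  exact h2.symm

/-- Φ is smooth only along a hypersurface; composing it with the radial retraction of the cone gives
smoothness on an open set, where ambient derivatives can be used. -/
lemma contDiffOn_homExt (hΦ : ContDiffOn ℝ ∞ Φ hyp) : ContDiffOn ℝ ∞ (homExt Φ) cone := by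
  have hs : ContDiffOn ℝ ∞ (fun x : Fin 4 → ℝ => √(mink x x)) cone :=
    contDiff_mink_self.contDiffOn.sqrt fun x hx => ne_of_gt hx
  refine hs.mul (hΦ.comp ((hs.inv fun x hx => (Real.sqrt_pos.2 hx).ne').smul contDiffOn_id) ?_)
  exact fun x hx => normalize_mem_hyp hx

lemma smul_mem_cone {x : Fin 4 → ℝ} (hx : x ∈ cone) {c : ℝ} (hc : 0 < c) : c • x ∈ cone := by
  have h : 0 < mink x x := hx
  simp only [cone, Set.mem_ofPred_eq, mink_smul_left, mink_smul_right]
  positivity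

lemma homExt_smul (x : Fin 4 → ℝ) {c : ℝ} (hc : 0 < c) : homExt Φ (c • x) = c * homExt Φ x := by
  have h1 : √(mink (c • x) (c • x)) = c * √(mink x x) := by
    rw [mink_smul_left, mink_smul_right, ← mul_assoc, Real.sqrt_mul (by positivity),
      Real.sqrt_mul_self hc.le]
  rw [homExt, homExt, h1, smul_smul, mul_inv, mul_comm c⁻¹, mul_assoc _ c⁻¹, inv_mul_cancel₀ hc.ne',
    mul_one, mul_assoc]

lemma contDiffAt_homExt (hΦ : ContDiffOn ℝ ∞ Φ hyp) {x : Fin 4 → ℝ} (hx : x ∈ cone) :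
    ContDiffAt ℝ ∞ (homExt Φ) x :=
  (contDiffOn_homExt hΦ).contDiffAt (isOpen_cone.mem_nhds hx)

lemma differentiableAt_homExt (hΦ : ContDiffOn ℝ ∞ Φ hyp) {x : Fin 4 → ℝ} (hx : x ∈ cone) :
    DifferentiableAt ℝ (homExt Φ) x :=
  (contDiffAt_homExt hΦ hx).differentiableAt (by simp)

lemma contDiffAt_fderiv_homExt (hΦ : ContDiffOn ℝ ∞ Φ hyp) {x : Fin 4 → ℝ} (hx : x ∈ cone) :
    ContDiffAt ℝ ∞ (fderiv ℝ (homExt Φ)) x :=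
  (contDiffAt_homExt hΦ hx).fderiv_right (by simp)

/-- Euler's relation, from differentiating c ↦ F(c x) at c = 1 in two ways. -/
lemma fderiv_homExt_self (hΦ : ContDiffOn ℝ ∞ Φ hyp) {x : Fin 4 → ℝ} (hx : x ∈ cone) :
    fderiv ℝ (homExt Φ) x x = homExt Φ x := by
  have hl : HasDerivAt (fun c : ℝ => c • x) x 1 := by
    simpa using (hasDerivAt_id (1 : ℝ)).smul_const x
  have h1 : HasDerivAt (fun c : ℝ => homExt Φ (c • x)) (fderiv ℝ (homExt Φ) x x) 1 := by
    have := (differentiableAt_homExt hΦ hx).hasFDerivAt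
    rw [← one_smul ℝ x] at this
    have := this.comp_hasDerivAt (1 : ℝ) hl
    simp only [one_smul] at this
    exact this
  have h2 : HasDerivAt (fun c : ℝ => homExt Φ (c • x)) (homExt Φ x) 1 := by
    refine HasDerivAt.congr_of_eventuallyEq (f := fun c : ℝ => c * homExt Φ x) ?_ ?_
    · simpa using (hasDerivAt_id (1 : ℝ)).mul_const (homExt Φ x)
    · filter_upwards [lt_mem_nhds (zero_lt_one (α := ℝ))] with c hc
      exact homExt_smul x hc
  exact h1.unique h2

lemma fderiv_homExt_smul (hΦ : ContDiffOn ℝ ∞ Φ hyp) {x : Fin 4 → ℝ} (hx : x ∈ cone) {c : ℝ}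
    (hc : 0 < c) : fderiv ℝ (homExt Φ) (c • x) = fderiv ℝ (homExt Φ) x := by
  have h1 : HasFDerivAt (fun y : Fin 4 → ℝ => homExt Φ (c • y))
      (c • fderiv ℝ (homExt Φ) (c • x)) x := by
    have h := (differentiableAt_homExt hΦ (smul_mem_cone hx hc)).hasFDerivAt
    have hl : HasFDerivAt (fun y : Fin 4 → ℝ => c • y)
        (c • ContinuousLinearMap.id ℝ (Fin 4 → ℝ)) x := (hasFDerivAt_id x).const_smul c
    have := HasFDerivAt.comp x h hl
    rw [ContinuousLinearMap.comp_smul, ContinuousLinearMap.comp_id] at this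
    exact this
  have h2 : HasFDerivAt (fun y : Fin 4 → ℝ => homExt Φ (c • y)) (c • fderiv ℝ (homExt Φ) x) x := by
    simp only [homExt_smul _ hc]
    exact (differentiableAt_homExt hΦ hx).hasFDerivAt.const_mul c
  exact smul_right_injective _ hc.ne' (h1.unique h2)

/-- The differential of a function of degree one has degree zero, so it is constant along rays.
Hence the Hessian annihilates the normal direction. -/
lemma fderiv_fderiv_homExt_self (hΦ : ContDiffOn ℝ ∞ Φ hyp) {x : Fin 4 → ℝ} (hx : x ∈ cone) :
    fderiv ℝ (fderiv ℝ (homExt Φ)) x x = 0 := by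
  have hl : HasDerivAt (fun c : ℝ => c • x) x 1 := by
    simpa using (hasDerivAt_id (1 : ℝ)).smul_const x
  have h1 : HasDerivAt (fun c : ℝ => fderiv ℝ (homExt Φ) (c • x))
      (fderiv ℝ (fderiv ℝ (homExt Φ)) x x) 1 := by
    have := ((contDiffAt_fderiv_homExt hΦ hx).differentiableAt (by simp)).hasFDerivAt
    rw [← one_smul ℝ x] at this
    have := this.comp_hasDerivAt (1 : ℝ) hl
    simp only [one_smul] at this
    exact this
  have h2 : HasDerivAt (fun c : ℝ => fderiv ℝ (homExt Φ) (c • x)) 0 1 := by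
    refine HasDerivAt.congr_of_eventuallyEq (f := fun _ => fderiv ℝ (homExt Φ) x)
      (hasDerivAt_const _ _) ?_
    filter_upwards [lt_mem_nhds (zero_lt_one (α := ℝ))] with c hc
    exact fderiv_homExt_smul hΦ hx hc
  exact h1.unique h2

/-- The second derivatives of the homogeneous extension, which represent `D_a D_b Φ + h_ab Φ`. -/
noncomputable def hessField (Φ : (Fin 4 → ℝ) → ℝ) (x : Fin 4 → ℝ) (i j : Fin 4) : ℝ :=
  fderiv ℝ (fderiv ℝ (homExt Φ)) x (Pi.single i 1) (Pi.single j 1)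

lemma bil_eq_of_single {G : Type*} [FunLike G (Fin 4 → ℝ) ((Fin 4 → ℝ) →L[ℝ] ℝ)]
    [LinearMapClass G ℝ (Fin 4 → ℝ) ((Fin 4 → ℝ) →L[ℝ] ℝ)] (B : G) (v w : Fin 4 → ℝ) :
    bil (fun i j => B (Pi.single i 1) (Pi.single j 1)) v w = B v w := by
  have hv : ∀ v : Fin 4 → ℝ, v = ∑ i, v i • (Pi.single i 1 : Fin 4 → ℝ) := by
    intro v; funext k; simp [Pi.single_apply]
  conv_rhs => rw [hv v, hv w]
  simp only [map_sum, map_smul, bil_apply, sum_apply,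
    smul_apply, smul_eq_mul, Finset.mul_sum]
  rw [Finset.sum_comm]
  exact Finset.sum_congr rfl fun i _ => Finset.sum_congr rfl fun j _ => by ring

lemma bil_hessField (x v w : Fin 4 → ℝ) :
    bil (hessField Φ x) v w = fderiv ℝ (fderiv ℝ (homExt Φ)) x v w :=
  bil_eq_of_single (fderiv ℝ (fderiv ℝ (homExt Φ)) x) v w

lemma contDiffOn_hessField (hΦ : ContDiffOn ℝ ∞ Φ hyp) : ContDiffOn ℝ ∞ (hessField Φ) cone := by
  rw [contDiffOn_pi]; intro i
  rw [contDiffOn_pi]; intro j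
  have h1 : ContDiffOn ℝ ∞ (fderiv ℝ (homExt Φ)) cone :=
    (contDiffOn_homExt hΦ).fderiv_of_isOpen isOpen_cone (by simp)
  have h2 : ContDiffOn ℝ ∞ (fderiv ℝ (fderiv ℝ (homExt Φ))) cone :=
    h1.fderiv_of_isOpen isOpen_cone (by simp)
  exact (h2.clm_apply contDiffOn_const).clm_apply contDiffOn_const

lemma hessField_symm (hΦ : ContDiffOn ℝ ∞ Φ hyp) {x : Fin 4 → ℝ} (hx : x ∈ cone) (i j : Fin 4) :
    hessField Φ x i j = hessField Φ x j i :=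
  (contDiffAt_homExt hΦ hx).isSymmSndFDerivAt
    (by simpa using WithTop.coe_le_coe.2 (le_top (a := (2 : ℕ∞)))) _ _

lemma bil_hessField_left (hΦ : ContDiffOn ℝ ∞ Φ hyp) {x : Fin 4 → ℝ} (hx : x ∈ cone)
    (v : Fin 4 → ℝ) : bil (hessField Φ x) x v = 0 := by
  rw [bil_hessField, fderiv_fderiv_homExt_self hΦ hx]; simp

lemma bil_comm {M : Fin 4 → Fin 4 → ℝ} (hM : ∀ i j, M i j = M j i) (v w : Fin 4 → ℝ) :
    bil M v w = bil M w v := by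
  rw [bil_apply, bil_apply, Finset.sum_comm]
  exact Finset.sum_congr rfl fun i _ => Finset.sum_congr rfl fun j _ => by rw [hM]; ring

lemma differentiableAt_hessField (hΦ : ContDiffOn ℝ ∞ Φ hyp) {x : Fin 4 → ℝ} (hx : x ∈ cone) :
    DifferentiableAt ℝ (hessField Φ) x :=
  ((contDiffOn_hessField hΦ).contDiffAt (isOpen_cone.mem_nhds hx)).differentiableAt (by simp)

lemma fderiv_hessField_apply (hΦ : ContDiffOn ℝ ∞ Φ hyp) {x : Fin 4 → ℝ} (hx : x ∈ cone)
    (c : Fin 4 → ℝ) (i j : Fin 4) : fderiv ℝ (hessField Φ) x c i j =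
      fderiv ℝ (fderiv ℝ (fderiv ℝ (homExt Φ))) x c (Pi.single i 1) (Pi.single j 1) := by
  have h := hasFDerivAt_pi'.1 (hasFDerivAt_pi'.1 (differentiableAt_hessField hΦ hx).hasFDerivAt i) j
  have hd : DifferentiableAt ℝ (fderiv ℝ (fderiv ℝ (homExt Φ))) x :=
    ((contDiffAt_fderiv_homExt hΦ hx).fderiv_right (m := ∞) (by simp)).differentiableAt (by simp)
  have h1 : HasFDerivAt (fun y => fderiv ℝ (fderiv ℝ (homExt Φ)) y (Pi.single i 1))
      ((fderiv ℝ (fderiv ℝ (fderiv ℝ (homExt Φ))) x).flip (Pi.single i 1)) x := by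
    simpa using hd.hasFDerivAt.clm_apply (hasFDerivAt_const (Pi.single i (1 : ℝ)) x)
  have h2 := h1.clm_apply (hasFDerivAt_const (Pi.single j (1 : ℝ)) x)
  have := congrArg (fun L => L c) (h.unique h2)
  simpa using this

lemma bil_fderiv_hessField (hΦ : ContDiffOn ℝ ∞ Φ hyp) {x : Fin 4 → ℝ} (hx : x ∈ cone)
    (c v w : Fin 4 → ℝ) : bil (fderiv ℝ (hessField Φ) x c) v w =
      fderiv ℝ (fderiv ℝ (fderiv ℝ (homExt Φ))) x c v w := by
  rw [← bil_eq_of_single (fderiv ℝ (fderiv ℝ (fderiv ℝ (homExt Φ))) x c)]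
  rw [show fderiv ℝ (hessField Φ) x c = fun i j =>
    fderiv ℝ (fderiv ℝ (fderiv ℝ (homExt Φ))) x c (Pi.single i 1) (Pi.single j 1) from
    funext fun i => funext fun j => fderiv_hessField_apply hΦ hx c i j]

/-- Symmetry of the second derivative of dF. Together with symmetry in the last two arguments, it
makes the third derivatives of the extension totally symmetric. -/
lemma bil_fderiv_hessField_swap (hΦ : ContDiffOn ℝ ∞ Φ hyp) {x : Fin 4 → ℝ} (hx : x ∈ cone)
    (c v w : Fin 4 → ℝ) : bil (fderiv ℝ (hessField Φ) x c) v w =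
      bil (fderiv ℝ (hessField Φ) x v) c w := by
  rw [bil_fderiv_hessField hΦ hx, bil_fderiv_hessField hΦ hx,
    (contDiffAt_fderiv_homExt hΦ hx).isSymmSndFDerivAt
    (by simpa using WithTop.coe_le_coe.2 (le_top (a := (2 : ℕ∞))))]

lemma bil_fderiv_hessField_symm (hΦ : ContDiffOn ℝ ∞ Φ hyp) {x : Fin 4 → ℝ} (hx : x ∈ cone)
    (c v w : Fin 4 → ℝ) : bil (fderiv ℝ (hessField Φ) x c) v w =
      bil (fderiv ℝ (hessField Φ) x c) w v := by
  refine bil_comm (fun i j => ?_) v w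
  have h := fun i j =>
    hasFDerivAt_pi'.1 (hasFDerivAt_pi'.1 (differentiableAt_hessField hΦ hx).hasFDerivAt i) j
  have h2 := (h j i).congr_of_eventuallyEq (f₁ := fun x => hessField Φ x i j) (by
    filter_upwards [isOpen_cone.mem_nhds hx] with y hy
    exact hessField_symm hΦ hy i j)
  have := congrArg (fun L => L c) ((h i j).unique h2)
  simpa using this

end HomogeneousExtension

end UnitHyperboloid

namespace UnitHyperboloid

/-! ### The tensor T: symmetry, trace, curl and divergence. -/

section HessianTensor

variable {U : Set (Fin 3 → ℝ)} {X : (Fin 3 → ℝ) → Fin 4 → ℝ} {u : Fin 3 → ℝ}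
  {Φ : (Fin 4 → ℝ) → ℝ}

lemma IsChart.mem_cone (hX : IsChart hyp U X) (hu : u ∈ U) : X u ∈ cone :=
  hyp_subset_cone (hX.mapsTo u hu)

/-- By Euler's relation the normal term in `IsChart.hess_eq` is −h_ab Φ, exactly what the added h_ab
Φ cancels. -/
lemma IsChart.hessPlus_eq (hX : IsChart hyp U X) (hΦ : ContDiffOn ℝ ∞ Φ hyp) (hu : u ∈ U) :
    hessPlus (metric X) (fun v => Φ (X v)) u = comps X (hessField Φ) u := by
  have hev : (fun v => Φ (X v)) =ᶠ[nhds u] fun v => homExt Φ (X v) := by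
    filter_upwards [hX.isOpen.mem_nhds hu] with v hv
    exact (homExt_of_mem (hX.mapsTo v hv)).symm
  have hev2 : ∀ b, pd b (fun v => Φ (X v)) =ᶠ[nhds u] pd b (fun v => homExt Φ (X v)) := fun b =>
    hev.eventuallyEq_nhds.mono fun v hv => pd_congr hv
  ext a b
  rw [comps_apply, bil_hessField]
  have h := hX.hess_eq hu (contDiffAt_homExt hΦ (hX.mem_cone hu)) a b
  rw [fderiv_homExt_self hΦ (hX.mem_cone hu)] at h
  simp only [hessPlus, Matrix.of_apply]
  rw [show hess (metric X) (fun v => Φ (X v)) a b u =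
    hess (metric X) (fun v => homExt Φ (X v)) a b u by
      simp only [hess, pd_congr (hev2 b), pd_congr hev], h, homExt_of_mem (hX.mapsTo u hu)]
  ring

lemma covD_congr {g T T' : (Fin 3 → ℝ) → Matrix (Fin 3) (Fin 3) ℝ} (h : T =ᶠ[nhds u] T')
    (c a b : Fin 3) : covD g T c a b u = covD g T' c a b u := by
  have h1 : (fun v => T v a b) =ᶠ[nhds u] fun v => T' v a b := h.mono fun v hv => by simp only [hv]
  simp only [covD, pd_congr h1, h.eq_of_nhds]

lemma curl_congr {g T T' : (Fin 3 → ℝ) → Matrix (Fin 3) (Fin 3) ℝ} (h : T =ᶠ[nhds u] T')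
    (a b : Fin 3) : curl g T a b u = curl g T' a b u := by
  simp only [curl, covD_congr h]

lemma divg_congr {g T T' : (Fin 3 → ℝ) → Matrix (Fin 3) (Fin 3) ℝ} (h : T =ᶠ[nhds u] T')
    (b : Fin 3) : divg g T b u = divg g T' b u := by
  simp only [divg, covD_congr h]

lemma IsChart.hessPlus_eventuallyEq (hX : IsChart hyp U X) (hΦ : ContDiffOn ℝ ∞ Φ hyp)
    (hu : u ∈ U) : hessPlus (metric X) (fun v => Φ (X v)) =ᶠ[nhds u] comps X (hessField Φ) := by
  filter_upwards [hX.isOpen.mem_nhds hu] with v hv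
  exact hX.hessPlus_eq hΦ hv

lemma IsChart.tr_hessPlus (hX : IsChart hyp U X) (hu : u ∈ U) (f : (Fin 3 → ℝ) → ℝ) :
    tr (metric X) (hessPlus (metric X) f) u = box (metric X) f u + 3 * f u := by
  have hsymm : ∀ a b, metric X u a b = metric X u b a := fun a b => mink_comm _ _
  have h1 : ((metric X u)⁻¹ * metric X u).trace = 3 := by
    rw [Matrix.nonsing_inv_mul _ (hX.isUnit_det_metric hu)]; simp
  have h2 : ∑ a, ∑ b, (metric X u)⁻¹ a b * metric X u a b = 3 := by
    rw [← h1]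
    simp only [Matrix.trace, Matrix.diag, Matrix.mul_apply]
    exact Finset.sum_congr rfl fun a _ => Finset.sum_congr rfl fun b _ => by rw [hsymm a b]
  rw [← h2]
  simp only [tr, box, hessPlus, Matrix.of_apply, mul_add, Finset.sum_add_distrib, Finset.sum_mul]
  congr 1
  exact Finset.sum_congr rfl fun a _ => Finset.sum_congr rfl fun b _ => by ring

lemma nablaAt_hessField (hΦ : ContDiffOn ℝ ∞ Φ hyp) {x : Fin 4 → ℝ} (hx : x ∈ cone)
    (c v w : Fin 4 → ℝ) : nablaAt (hessField Φ) x c v w =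
      bil (fderiv ℝ (hessField Φ) x c) v w := by
  rw [nablaAt, bil_hessField_left hΦ hx, bil_comm (hessField_symm hΦ hx) v x,
    bil_hessField_left hΦ hx]
  ring

/-- The volume form is antisymmetric and the third derivatives are symmetric in the contracted pair,
so exchanging the summation indices reverses the sign of the sum. -/
lemma curlAt_hessField (hΦ : ContDiffOn ℝ ∞ Φ hyp) {x : Fin 4 → ℝ} (hx : x ∈ cone)
    (v w : Fin 4 → ℝ) : curlAt (hessField Φ) x v w = 0 := by
  have h : curlAt (hessField Φ) x v w = -curlAt (hessField Φ) x v w := by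
    conv_lhs => rw [curlAt, Finset.sum_comm]
    rw [curlAt, ← Finset.sum_neg_distrib]
    refine Finset.sum_congr rfl fun i _ => ?_
    rw [← Finset.sum_neg_distrib]
    refine Finset.sum_congr rfl fun j _ => ?_
    rw [nablaAt_hessField hΦ hx, nablaAt_hessField hΦ hx, bil_fderiv_hessField_swap hΦ hx,
      show vol x v (Pi.single j 1) (Pi.single i 1) = -vol x v (Pi.single i 1) (Pi.single j 1) by
        simp only [vol_eq]; ring]
    ring
  linarith

/-- Total symmetry of the third derivatives turns the divergence into the derivative of the trace,
which vanishes throughout the chart. -/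
lemma IsChart.divg_hessPlus (hX : IsChart hyp U X) (hΦ : ContDiffOn ℝ ∞ Φ hyp) (hu : u ∈ U)
    (htr : ∀ v ∈ U, tr (metric X) (hessPlus (metric X) (fun v => Φ (X v))) v = 0) (b : Fin 3) :
    divg (metric X) (hessPlus (metric X) (fun v => Φ (X v))) b u = 0 := by
  have hx := hX.mem_cone hu
  have hA := differentiableAt_hessField hΦ hx
  have h0 : ∀ v ∈ U, ∑ i, sgn i * hessField Φ (X v) i i = 0 := by
    intro v hv
    have h := htr v hv
    rw [show tr (metric X) (hessPlus (metric X) (fun v => Φ (X v))) v =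
      tr (metric X) (comps X (hessField Φ)) v by simp only [tr, hX.hessPlus_eq hΦ hv],
      hX.tr_comps hv, traceAt, bil_hessField_left hΦ (hX.mem_cone hv)] at h
    linarith
  have h1 : ∑ i, sgn i * fderiv ℝ (hessField Φ) (X u) (pd b X u) i i = 0 := by
    have hd : ∀ i, HasFDerivAt (fun x => hessField Φ x i i) _ (X u) := fun i =>
      hasFDerivAt_pi'.1 (hasFDerivAt_pi'.1 hA.hasFDerivAt i) i
    have h2 : pd b (fun v => ∑ i, sgn i * hessField Φ (X v) i i) u = 0 := by
      rw [pd_congr_on hX.isOpen (g := fun _ => 0) h0 hu, pd_const]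
    have hd' : ∀ i, DifferentiableAt ℝ (fun v => sgn i * hessField Φ (X v) i i) u := fun i =>
      ((hd i).differentiableAt.comp u (hX.differentiableAt hu)).const_mul (sgn i)
    rw [pd_sum fun i _ => hd' i] at h2
    rw [← h2]
    refine Finset.sum_congr rfl fun i _ => ?_
    rw [pd_const_mul, pd_comp_left (hd i).differentiableAt (hX.differentiableAt hu), (hd i).fderiv]
    rfl
  -- The ambient and the tangential trace differ by this normal component. It vanishes on
  -- differentiating the identity "Hessian at y applied to y is 0" along ∂_b X and pairing with X.
  have h3 : bil (fderiv ℝ (hessField Φ) (X u) (pd b X u)) (X u) (X u) = 0 := by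
    have hd : DifferentiableAt ℝ (fderiv ℝ (fderiv ℝ (homExt Φ))) (X u) :=
      ((contDiffAt_fderiv_homExt hΦ hx).fderiv_right (m := ∞) (by simp)).differentiableAt (by simp)
    have h4 := (hd.hasFDerivAt.clm_apply (hasFDerivAt_id (X u))).congr_of_eventuallyEq
      (f₁ := fun _ => 0) (by
        filter_upwards [isOpen_cone.mem_nhds hx] with y hy
        exact (fderiv_fderiv_homExt_self hΦ hy).symm)
    have h5 := congrArg (fun L => L (pd b X u) (X u)) (h4.unique (hasFDerivAt_const _ _))
    have h6 : fderiv ℝ (fderiv ℝ (homExt Φ)) (X u) (pd b X u) (X u) = 0 := by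
      rw [← bil_hessField, bil_comm (hessField_symm hΦ hx), bil_hessField_left hΦ hx]
    simp [h6] at h5
    rw [bil_fderiv_hessField hΦ hx]
    exact h5
  rw [divg_congr (hX.hessPlus_eventuallyEq hΦ hu)]
  simp only [divg, hX.covD_comps hu hA, nablaAt_hessField hΦ hx]
  have h5 := hX.sum_inv_metric hu (bil (fderiv ℝ (hessField Φ) (X u) (pd b X u)))
  simp only [bil_single, h1, h3, sub_zero] at h5
  rw [← h5]
  refine Finset.sum_congr rfl fun a _ => Finset.sum_congr rfl fun c _ => ?_
  rw [bil_fderiv_hessField_symm hΦ hx, bil_fderiv_hessField_swap hΦ hx,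
    bil_fderiv_hessField_symm hΦ hx]

theorem hessPlus_props (hΦ : IsSolution Φ) (hX : IsChart hyp U X) (hu : u ∈ U) :
    (∀ a b, hessPlus (metric X) (fun v => Φ (X v)) u a b =
        hessPlus (metric X) (fun v => Φ (X v)) u b a) ∧
      tr (metric X) (hessPlus (metric X) (fun v => Φ (X v))) u = 0 ∧
      (∀ a b, curl (metric X) (hessPlus (metric X) (fun v => Φ (X v))) a b u = 0) ∧
      (∀ b, divg (metric X) (hessPlus (metric X) (fun v => Φ (X v))) b u = 0) := by
  have hx := hX.mem_cone hu
  have htr : ∀ v ∈ U, tr (metric X) (hessPlus (metric X) (fun v => Φ (X v))) v = 0 := by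
    intro v hv
    rw [hX.tr_hessPlus hv]
    exact hΦ.2 U X hX v hv
  refine ⟨fun a b => ?_, htr u hu, fun a b => ?_, fun b => hX.divg_hessPlus hΦ.1 hu htr b⟩
  · rw [hX.hessPlus_eq hΦ.1 hu, comps_apply, comps_apply]
    exact bil_comm (hessField_symm hΦ.1 hx) _ _
  · rw [curl_congr (hX.hessPlus_eventuallyEq hΦ.1 hu),
      hX.curl_comps hu (differentiableAt_hessField hΦ.1 hx), curlAt_hessField hΦ.1 hx]

end HessianTensor

end UnitHyperboloid

namespace UnitHyperboloid

/-! ### Density of the chart (τ, θ, φ) and reduction of the potential equations to it. -/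

section Density

lemma sph_mem_hyp (u : Fin 3 → ℝ) : sph u ∈ hyp := by
  have h0 := Real.cosh_sq (u 0)
  have h1 := Real.sin_sq_add_cos_sq (u 1)
  have h2 := Real.sin_sq_add_cos_sq (u 2)
  simp only [hyp, mink, sph, Set.mem_ofPred_eq]
  simp
  grind

lemma isChart_sph : IsChart hyp sphDom sph := by
  refine ⟨isOpen_sphDom, contDiff_sph.contDiffOn, fun u _ => sph_mem_hyp u, fun u hu => ?_⟩
  have hs := sin_pos_of_mem hu
  have hc := Real.cosh_pos (u 0)
  have h0 := Real.cosh_sq (u 0)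
  have h1 := Real.sin_sq_add_cos_sq (u 1)
  have h2 := Real.sin_sq_add_cos_sq (u 2)
  have : vol (sph u) (pd 0 sph u) (pd 1 sph u) (pd 2 sph u) =
      Real.cosh (u 0) ^ 2 * Real.sin (u 1) := by
    rw [vol_eq, pd_sph, pd_sph, pd_sph]
    simp [sph]
    grind
  change 0 < vol (sph u) (pd 0 sph u) (pd 1 sph u) (pd 2 sph u)
  rw [this]
  positivity

lemma closure_sphDom : closure sphDom = {u | 0 ≤ u 1 ∧ u 1 ≤ Real.pi} := by
  have h := (isOpenMap_eval (X := fun _ : Fin 3 => ℝ) 1).preimage_closure_eq_closure_preimage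
    (continuous_apply 1) (Set.Ioo 0 Real.pi)
  rw [closure_Ioo Real.pi_pos.ne] at h
  exact h.symm

/-- Take τ = arsinh x⁰, θ = arccos (x³ / √(1 + (x⁰)²)) and φ = arg (x¹ + i x²). The closure is
needed for θ = 0 and θ = π. -/
lemma exists_sph_eq {x : Fin 4 → ℝ} (hx : x ∈ hyp) : ∃ u ∈ closure sphDom, sph u = x := by
  have hx1 : -(x 0 * x 0) + x 1 * x 1 + x 2 * x 2 + x 3 * x 3 = 1 := hx
  have hch : Real.cosh (Real.arsinh (x 0)) = √(1 + x 0 ^ 2) := Real.cosh_arsinh _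
  set r := √(1 + x 0 ^ 2) with hr
  have hr2 : r ^ 2 = 1 + x 0 ^ 2 := Real.sq_sqrt (by positivity)
  have hr0 : 0 < r := Real.sqrt_pos.2 (by positivity)
  set z : ℂ := ⟨x 1, x 2⟩
  have hz : ‖z‖ ^ 2 = x 1 ^ 2 + x 2 ^ 2 := by
    rw [Complex.sq_norm, Complex.normSq_apply]; ring
  have habs : |x 3 / r| ≤ 1 := by
    rw [abs_div, abs_of_pos hr0, div_le_one hr0]
    apply abs_le_of_sq_le_sq' _ hr0.le |> abs_le.2
    nlinarith [sq_nonneg (x 1), sq_nonneg (x 2)]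
  have hcos : Real.cos (Real.arccos (x 3 / r)) = x 3 / r :=
    Real.cos_arccos (abs_le.1 habs).1 (abs_le.1 habs).2
  have hsin : r * Real.sin (Real.arccos (x 3 / r)) = ‖z‖ := by
    rw [Real.sin_arccos]
    have : 1 - (x 3 / r) ^ 2 = (‖z‖ / r) ^ 2 := by
      rw [div_pow, div_pow, hz]; field_simp; nlinarith
    rw [this, Real.sqrt_sq (by positivity)]
    field_simp
  refine ⟨![Real.arsinh (x 0), Real.arccos (x 3 / r), Complex.arg z], ?_, ?_⟩
  · rw [closure_sphDom]
    exact ⟨Real.arccos_nonneg _, Real.arccos_le_pi _⟩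
  · funext i
    fin_cases i
    · simp [sph]
    · simp [sph, hch, hsin, Complex.norm_mul_cos_arg, z]
    · simp [sph, hch, hsin, Complex.norm_mul_sin_arg, z]
    · simp [sph, hch, hcos]; field_simp

lemma eq_zero_of_sph {q : (Fin 4 → ℝ) → ℝ} {V : Set (Fin 4 → ℝ)} (hV : IsOpen V)
    (hq : ContinuousOn q V) (h0 : ∀ u ∈ sphDom, sph u ∈ V → q (sph u) = 0) {x : Fin 4 → ℝ}
    (hx : x ∈ hyp) (hxV : x ∈ V) : q x = 0 := by
  obtain ⟨u, hu, rfl⟩ := exists_sph_eq hx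
  have hc : Filter.Tendsto (fun v => q (sph v)) (nhds u) (nhds (q (sph u))) :=
    ((hq.continuousAt (hV.mem_nhds hxV)).comp contDiff_sph.continuous.continuousAt)
  have hev : ∀ᶠ v in nhds u, sph v ∈ V :=
    contDiff_sph.continuous.continuousAt.eventually (hV.mem_nhds hxV)
  have hfr := (mem_closure_iff_frequently.1 hu).and_eventually hev
  exact (isClosed_singleton (x := (0 : ℝ))).mem_of_frequently_of_tendsto
    (hfr.mono fun v hv => h0 v hv.1 hv.2) hc

lemma IsChart.eq_zero_of_frame {U : Set (Fin 3 → ℝ)} {X : (Fin 3 → ℝ) → Fin 4 → ℝ}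
    {u : Fin 3 → ℝ} (hX : IsChart hyp U X) (hu : u ∈ U)
    (Z : (Fin 4 → ℝ) →ₗ[ℝ] (Fin 4 → ℝ) →ₗ[ℝ] ℝ) (hZ : ∀ a b, Z (pd a X u) (pd b X u) = 0)
    {v w : Fin 4 → ℝ} (hv : mink v (X u) = 0) (hw : mink w (X u) = 0) : Z v w = 0 := by
  rw [hX.expand hu v, hX.expand hu w, hv, hw]
  simp only [zero_smul, add_zero, map_sum, map_smul, LinearMap.sum_apply, LinearMap.smul_apply, hZ,
    smul_zero, Finset.sum_const_zero]

/-- The orthogonal projection to the tangent space of the hyperboloid at `x`. -/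
def proj (x v : Fin 4 → ℝ) : Fin 4 → ℝ := v - mink v x • x

lemma mink_proj {x : Fin 4 → ℝ} (hx : x ∈ hyp) (v : Fin 4 → ℝ) : mink (proj x v) x = 0 := by
  have hx1 : mink x x = 1 := hx
  rw [proj, sub_eq_add_neg, ← neg_smul, mink_add_left, mink_smul_left, hx1]
  ring

lemma proj_of_tangent {x v : Fin 4 → ℝ} (h : mink v x = 0) : proj x v = v := by
  rw [proj, h, zero_smul, sub_zero]

lemma continuous_proj (v : Fin 4 → ℝ) : Continuous (fun x => proj x v) := by
  unfold proj mink; fun_prop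

lemma ContinuousOn.bil {M : (Fin 4 → ℝ) → Fin 4 → Fin 4 → ℝ} {v w : (Fin 4 → ℝ) → Fin 4 → ℝ}
    {V : Set (Fin 4 → ℝ)} (hM : ContinuousOn M V) (hv : ContinuousOn v V)
    (hw : ContinuousOn w V) : ContinuousOn (fun x => bil (M x) (v x) (w x)) V := by
  simp only [bil_apply]
  refine continuousOn_finsetSum _ fun i _ => continuousOn_finsetSum _ fun j _ => ?_
  exact ((continuousOn_pi.1 (continuousOn_pi.1 hM i) j).mul (continuousOn_pi.1 hv i)).mul
    (continuousOn_pi.1 hw j)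

lemma continuousOn_curlAt {A : (Fin 4 → ℝ) → Fin 4 → Fin 4 → ℝ} {V : Set (Fin 4 → ℝ)}
    (hV : IsOpen V) (hA : ContDiffOn ℝ ∞ A V) {v w : (Fin 4 → ℝ) → Fin 4 → ℝ}
    (hv : Continuous v) (hw : Continuous w) : ContinuousOn (fun x => curlAt A x (v x) (w x)) V := by
  have hA0 := hA.continuousOn
  have hA1 : ∀ c, ContinuousOn (fun x => fderiv ℝ A x c) V := fun c =>
    (hA.continuousOn_fderiv_of_isOpen hV (by simp)).clm_apply continuousOn_const
  have hv' : ∀ i, Continuous fun x => v x i := fun i => (continuous_apply i).comp hv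
  have hw' : ∀ i, Continuous fun x => w x i := fun i => (continuous_apply i).comp hw
  refine continuousOn_finsetSum _ fun i _ => continuousOn_finsetSum _ fun j _ => ?_
  refine ContinuousOn.mul (Continuous.continuousOn ?_) ?_
  · simp only [vol_eq]; fun_prop
  · have h1 := (hA1 (Pi.single i 1)).bil (continuousOn_const (c := Pi.single j 1)) hw.continuousOn
    have h2 := hA0.bil continuousOn_id hw.continuousOn
    have h3 := hA0.bil (continuousOn_const (c := Pi.single j 1)) continuousOn_id
    have h4 : ContinuousOn (fun x => mink (Pi.single i 1) (w x)) V := by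
      simp only [mink_single]; fun_prop
    exact (h1.sub (continuousOn_const.mul h2)).sub (h4.mul h3)

/-- The equations of a potential need only be checked in the coordinates `(τ, θ, φ)`. -/
theorem isPotentialOn_of_sph {S V : Set (Fin 4 → ℝ)} (hS : S ⊆ hyp) (hV : IsOpen V) (hSV : S ⊆ V)
    {Φ : (Fin 4 → ℝ) → ℝ} (hΦ : ContDiffOn ℝ ∞ Φ hyp) {P : (Fin 4 → ℝ) → Fin 4 → Fin 4 → ℝ}
    (hP : ContDiffOn ℝ ∞ P V)
    (hsymm : ∀ u ∈ sphDom, ∀ a b, comps sph P u a b = comps sph P u b a)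
    (htr : ∀ u ∈ sphDom, tr (metric sph) (comps sph P) u = 0)
    (hcurl : ∀ u ∈ sphDom, ∀ a b, hessPlus (metric sph) (fun v => Φ (sph v)) u a b =
      curl (metric sph) (comps sph P) a b u) :
    IsPotentialOn S Φ P := by
  intro U X hX u hu
  have hX' := hX.mono hS
  have hxV : X u ∈ V ∩ cone := ⟨hSV (hX.mapsTo u hu), hX'.mem_cone hu⟩
  have hx : X u ∈ hyp := hX'.mapsTo u hu
  have hVc : IsOpen (V ∩ cone) := hV.inter isOpen_cone
  have hP' : ContDiffOn ℝ ∞ P (V ∩ cone) := hP.mono Set.inter_subset_left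
  have hdP : ∀ x ∈ V ∩ cone, DifferentiableAt ℝ P x := fun x hx =>
    (hP'.contDiffAt (hVc.mem_nhds hx)).differentiableAt (by simp)
  have hH : ContinuousOn (hessField Φ) (V ∩ cone) :=
    (contDiffOn_hessField hΦ).continuousOn.mono Set.inter_subset_right
  refine ⟨fun a b => ?_, ?_, fun a b => ?_⟩
  -- The fixed vectors ∂_a X(u) are made into tangent vectors at every x by projection, which
  -- changes nothing at x = X(u). The equation becomes the vanishing of a continuous function of x,
  -- to be tested only at points of the dense chart; the curl equation is treated likewise.
  · have h := eq_zero_of_sph hVc (q := fun x => bil (P x) (proj x (pd a X u)) (proj x (pd b X u)) -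
      bil (P x) (proj x (pd b X u)) (proj x (pd a X u)))
      ((hP'.continuousOn.bil (continuous_proj _).continuousOn (continuous_proj _).continuousOn).sub
        (hP'.continuousOn.bil (continuous_proj _).continuousOn (continuous_proj _).continuousOn))
      (fun v hv hvV => by
        refine isChart_sph.eq_zero_of_frame hv (bil (P (sph v)) - (bil (P (sph v))).flip)
          (fun a b => ?_) (mink_proj (sph_mem_hyp v) _) (mink_proj (sph_mem_hyp v) _)
        have := hsymm v hv a b
        simp only [comps_apply] at this
        simp [this]) hx hxV
    simp only [proj_of_tangent (hX'.mink_tangent hu _)] at h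
    exact sub_eq_zero.1 h
  · rw [hX'.tr_comps hu]
    refine eq_zero_of_sph hVc (q := fun x => traceAt (P x) x) ?_ (fun v hv hvV => ?_) hx hxV
    · refine ContinuousOn.sub (continuousOn_finsetSum _ fun i _ => continuousOn_const.mul ?_)
        (hP'.continuousOn.bil continuousOn_id continuousOn_id)
      exact continuousOn_pi.1 (continuousOn_pi.1 hP'.continuousOn i) i
    · rw [← isChart_sph.tr_comps hv]; exact htr v hv
  · rw [hX'.hessPlus_eq hΦ hu, hX'.curl_comps hu (hdP _ hxV), comps_apply]
    have h := eq_zero_of_sph hVc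
      (q := fun x => bil (hessField Φ x) (proj x (pd a X u)) (proj x (pd b X u)) -
        curlAt P x (proj x (pd a X u)) (proj x (pd b X u)))
      ((hH.bil (continuous_proj _).continuousOn (continuous_proj _).continuousOn).sub
        (continuousOn_curlAt hVc hP' (continuous_proj _) (continuous_proj _)))
      (fun v hv hvV => by
        refine isChart_sph.eq_zero_of_frame hv (bil (hessField Φ (sph v)) - curlForm P (sph v))
          (fun a b => ?_) (mink_proj (sph_mem_hyp v) _) (mink_proj (sph_mem_hyp v) _)
        have := hcurl v hv a b
        rw [isChart_sph.hessPlus_eq hΦ hv, isChart_sph.curl_comps hv (hdP _ hvV), comps_apply]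
          at this
        simp [this]) hx hxV
    simp only [proj_of_tangent (hX'.mink_tangent hu _)] at h
    exact sub_eq_zero.1 h

end Density

end UnitHyperboloid

namespace UnitHyperboloid

/-! ### The odd parity ansatz for the potential. -/

section RegularPotential

open Real

/-- The Laplacian of the unit sphere in the coordinates `(θ, φ)`. -/
noncomputable def sphLap (f : (Fin 3 → ℝ) → ℝ) (u : Fin 3 → ℝ) : ℝ :=
  pd 1 (pd 1 f) u + cos (u 1) / sin (u 1) * pd 1 f u + pd 2 (pd 2 f) u / sin (u 1) ^ 2

/-- The odd parity tensor whose `τ` components are the dual of the angular one-form `p` and whose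
angular components are the dual of the trace-free angular Hessian of `χ`. -/
noncomputable def oddTensor (p : Fin 3 → (Fin 3 → ℝ) → ℝ) (χ : (Fin 3 → ℝ) → ℝ) (u : Fin 3 → ℝ) : Matrix (Fin 3) (Fin 3) ℝ :=
  !![0, -(p 2 u / sin (u 1)), sin (u 1) * p 1 u;
    -(p 2 u / sin (u 1)), cos (u 1) * pd 2 χ u / sin (u 1) ^ 2 - pd 1 (pd 2 χ) u / sin (u 1),
      1 / 2 * (sin (u 1) * pd 1 (pd 1 χ) u - cos (u 1) * pd 1 χ u - pd 2 (pd 2 χ) u / sin (u 1));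
    sin (u 1) * p 1 u,
      1 / 2 * (sin (u 1) * pd 1 (pd 1 χ) u - cos (u 1) * pd 1 χ u - pd 2 (pd 2 χ) u / sin (u 1)),
      sin (u 1) * pd 1 (pd 2 χ) u - cos (u 1) * pd 2 χ u]

lemma oddTensor_symm (p : Fin 3 → (Fin 3 → ℝ) → ℝ) (χ : (Fin 3 → ℝ) → ℝ) (u : Fin 3 → ℝ) (a b : Fin 3) :
    oddTensor p χ u a b = oddTensor p χ u b a := by
  unfold oddTensor
  fin_cases a <;> fin_cases b <;> simp

lemma tr_oddTensor {u : Fin 3 → ℝ} (hu : u ∈ sphDom) (p : Fin 3 → (Fin 3 → ℝ) → ℝ) (χ : (Fin 3 → ℝ) → ℝ) :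
    tr (metric sph) (oddTensor p χ) u = 0 := by
  have hs := (sin_pos_of_mem hu).ne'
  have hc := (cosh_pos (u 0)).ne'
  rw [tr_sph hu]
  simp [oddTensor]
  field_simp
  ring

variable {Φ V χ : (Fin 3 → ℝ) → ℝ}

-- `h1` and `h3` are elliptic constraints at fixed τ, while `h2` and `h4` are evolution equations.
-- The ττ component of the curl equation follows from `hwave` and `h1`, the τθ and τφ components
-- from the angular gradient of `h3`, and θθ and φφ from `h1` with the evolution equations. The
-- other components need only the evolution equations and commuting derivatives.
set_option maxHeartbeats 1000000 in
lemma hessPlus_eq_curl_oddTensor (hΦ : ContDiffOn ℝ ∞ Φ sphDom) (hV : ContDiffOn ℝ ∞ V sphDom)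
    (hχ : ContDiffOn ℝ ∞ χ sphDom)
    (hwave : ∀ u ∈ sphDom, pd 0 (pd 0 Φ) u = -2 * (sinh (u 0) / cosh (u 0)) * pd 0 Φ u +
      sphLap Φ u / cosh (u 0) ^ 2 + 3 * Φ u)
    (h1 : ∀ u ∈ sphDom, sphLap V u = cosh (u 0) ^ 2 * Φ u - cosh (u 0) * sinh (u 0) * pd 0 Φ u)
    (h2 : ∀ u ∈ sphDom, pd 0 V u = -(sinh (u 0) / cosh (u 0)) * (V u + Φ u))
    (h3 : ∀ u ∈ sphDom, sphLap χ u + 2 * χ u =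
      4 * (cosh (u 0) * sinh (u 0)) * V u + 2 * cosh (u 0) ^ 2 * pd 0 Φ u)
    (h4 : ∀ u ∈ sphDom, pd 0 χ u = sinh (u 0) / cosh (u 0) * χ u + 2 * (Φ u + V u))
    {u : Fin 3 → ℝ} (hu : u ∈ sphDom) (a b : Fin 3) :
    hessPlus (metric sph) Φ u a b =
      curl (metric sph) (oddTensor (fun i v => pd i Φ v + 2 * pd i V v) χ) a b u := by
  have hs := (sin_pos_of_mem hu).ne'
  have hs2 : sin (u 1) ^ 2 ≠ 0 := pow_ne_zero _ hs
  have hc := (cosh_pos (u 0)).ne'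
  have hc2 : cosh (u 0) ^ 2 ≠ 0 := pow_ne_zero _ hc
  have hO := isOpen_sphDom
  have smooth1 : ∀ {f : (Fin 3 → ℝ) → ℝ}, ContDiffOn ℝ ∞ f sphDom → ∀ i,
    ContDiffOn ℝ ∞ (pd i f) sphDom := fun hf i => contDiffOn_pd hO hf
  have diff : ∀ {f : (Fin 3 → ℝ) → ℝ}, ContDiffOn ℝ ∞ f sphDom → ∀ {v}, v ∈ sphDom →
    DifferentiableAt ℝ f v := fun hf v hv => (hf.contDiffAt (hO.mem_nhds hv)).differentiableAt
      (by simp)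
  have d0 : ∀ {v}, v ∈ sphDom → DifferentiableAt ℝ Φ v ∧ DifferentiableAt ℝ V v ∧
      DifferentiableAt ℝ χ v := fun hv => ⟨diff hΦ hv, diff hV hv, diff hχ hv⟩
  have d1 : ∀ i {v}, v ∈ sphDom → DifferentiableAt ℝ (pd i Φ) v ∧ DifferentiableAt ℝ (pd i V) v ∧
      DifferentiableAt ℝ (pd i χ) v := fun i v hv =>
    ⟨diff (smooth1 hΦ i) hv, diff (smooth1 hV i) hv, diff (smooth1 hχ i) hv⟩
  have d2 : ∀ i j {v}, v ∈ sphDom → DifferentiableAt ℝ (pd i (pd j χ)) v := fun i j v hv =>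
    diff (smooth1 (smooth1 hχ j) i) hv
  have dΦ := (d0 hu).1
  have dV := (d0 hu).2.1
  have dχ := (d0 hu).2.2
  have dΦ0 := (d1 0 hu).1
  have dΦ1 := (d1 1 hu).1
  have dΦ2 := (d1 2 hu).1
  have dV1 := (d1 1 hu).2.1
  have dV2 := (d1 2 hu).2.1
  have dχ1 := (d1 1 hu).2.2
  have dχ2 := (d1 2 hu).2.2
  have dχ11 := d2 1 1 hu
  have dχ12 := d2 1 2 hu
  have dχ22 := d2 2 2 hu
  -- the angular derivatives of the evolution equations
  have ev1 : ∀ v ∈ sphDom, ∀ i, i ≠ 0 → pd 0 (pd i χ) v =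
      sinh (v 0) / cosh (v 0) * pd i χ v + 2 * (pd i Φ v + pd i V v) := by
    intro v hv i hi
    have hcv := (cosh_pos (v 0)).ne'
    have e1 := (d0 hv).1
    have e2 := (d0 hv).2.1
    have e3 := (d0 hv).2.2
    rw [pd_comm hO hχ hv, pd_congr_on hO h4 hv]
    simp (disch := first | assumption | fun_prop (disch := assumption))
      [pd_mul, pd_add, pd_div, pd_sinh, pd_cosh, hi.symm]
  have ev2 : ∀ i j, i ≠ 0 → j ≠ 0 → pd 0 (pd i (pd j χ)) u =
      sinh (u 0) / cosh (u 0) * pd i (pd j χ) u + 2 * (pd i (pd j Φ) u + pd i (pd j V) u) := by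
    intro i j hi hj
    have e1 := (d1 j hu).1
    have e2 := (d1 j hu).2.1
    have e3 := (d1 j hu).2.2
    rw [pd_comm hO (smooth1 hχ j) hu, pd_congr_on hO (fun v hv => ev1 v hv j hj) hu]
    simp (disch := first | assumption | fun_prop (disch := assumption))
      [pd_mul, pd_add, pd_div, pd_sinh, pd_cosh, hi.symm]
  have evV : ∀ i, i ≠ 0 → pd 0 (pd i V) u = -(sinh (u 0) / cosh (u 0)) * (pd i V u + pd i Φ u) := by
    intro i hi
    rw [pd_comm hO hV hu, pd_congr_on hO h2 hu]
    simp (disch := first | assumption | fun_prop (disch := assumption))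
      [pd_mul, pd_add, pd_div, pd_sinh, pd_cosh, pd_neg, hi.symm]
  -- The angular gradient of the constraint on χ controls the third derivatives of χ in the τθ and
  -- τφ components.
  have con1 := pd_congr_on (i := 1) hO h3 hu
  have con2 := pd_congr_on (i := 2) hO h3 hu
  unfold sphLap at con1 con2
  simp (disch := first | assumption | fun_prop (disch := assumption))
      [pd_mul, pd_add, pd_div, pd_sinh, pd_cosh, pd_sin, pd_cos, pd_pow]
      at con1 con2
  have c10Φ := pd_comm hO hΦ hu 1 0
  have c20Φ := pd_comm hO hΦ hu 2 0
  have c21Φ := pd_comm hO hΦ hu 2 1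
  have c21V := pd_comm hO hV hu 2 1
  have c21χ := pd_comm hO hχ hu 2 1
  have c212χ := pd_comm hO (smooth1 hχ 2) hu 2 1
  have c211χ : pd 2 (pd 1 (pd 1 χ)) u = pd 1 (pd 1 (pd 2 χ)) u := by
    rw [pd_comm hO (smooth1 hχ 1) hu 2 1]
    exact pd_congr_on hO (fun v hv => pd_comm hO hχ hv 2 1) hu
  have w := hwave u hu
  have p2 := sin_sq (u 1)
  have p3 : sin (u 1) ^ 3 = sin (u 1) * (1 - cos (u 1) ^ 2) := by rw [← p2]; ring
  have p4 : sin (u 1) ^ 4 = (1 - cos (u 1) ^ 2) ^ 2 := by rw [← p2]; ring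
  have e1 := h1 u hu
  have e2 := h2 u hu
  have e3 := h3 u hu
  have e4 := h4 u hu
  have v1 := evV 1 (by decide)
  have v2 := evV 2 (by decide)
  have x1 := ev1 u hu 1 (by decide)
  have x2 := ev1 u hu 2 (by decide)
  have x11 := ev2 1 1 (by decide) (by decide)
  have x12 := ev2 1 2 (by decide) (by decide)
  have x22 := ev2 2 2 (by decide) (by decide)
  clear ev1 ev2 evV h1 h2 h3 h4 hwave d0 d1 d2 diff smooth1
  unfold sphLap at w e1 e3
  simp only [c10Φ, c20Φ, c21χ, c211χ] at w e1 e3 con1 con2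
  rw [curl_sph hu, hess_sph hu]
  simp only [covD_sph hu]
  unfold oddTensor sphGamma
  fin_cases a <;> fin_cases b <;>
    simp (disch := first | assumption | fun_prop (disch := assumption))
      [pd_mul, pd_sub, pd_add, pd_div, pd_sin, pd_cos, pd_neg, pd_pow,
        Matrix.diagonal]
  all_goals try simp only [c10Φ, c20Φ, c21Φ, c21V, c21χ, c212χ, c211χ, x1, x2, x11, x12, x22, v1, v2]
  · linear_combination (norm := skip) w - 2 / cosh (u 0) ^ 2 * e1
    field_simp
    ring
  · linear_combination (norm := skip) -1 / (2 * cosh (u 0) ^ 2) * con1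
    field_simp
    ring
  · linear_combination (norm := skip) -1 / (2 * cosh (u 0) ^ 2) * con2
    field_simp
    ring
  · field_simp
    ring
  · linear_combination (norm := skip) -e1
    field_simp
    ring
  · field_simp
    ring
  · field_simp
    ring
  · field_simp
    ring
  · linear_combination (norm := skip) -sin (u 1) ^ 2 * e1
    field_simp
    ring

end RegularPotential

end UnitHyperboloid

namespace UnitHyperboloid

/-! ### Rotation derivatives on ℝ × (ℝ³ ∖ 0), which avoid coordinate singularities at the poles. -/

section AngularDerivatives

/-- Euclidean space, whose punctured version retracts to the unit sphere. -/
abbrev E3 := EuclideanSpace ℝ (Fin 3)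

/-- The pairs `(τ, y)` with `y ≠ 0`, which represent points of `ℝ × S²`. -/
def punctured : Set (ℝ × E3) := {p | p.2 ≠ 0}

lemma isOpen_punctured : IsOpen punctured := isOpen_ne_fun continuous_snd continuous_const

/-- The generator `y ↦ e_k × y` of the rotations about the `k`-th axis. -/
noncomputable def rotGen (k : Fin 3) : E3 →L[ℝ] E3 :=
  (EuclideanSpace.proj (k + 1)).smulRight (EuclideanSpace.single (k + 2) 1) -
    (EuclideanSpace.proj (k + 2)).smulRight (EuclideanSpace.single (k + 1) 1)

lemma rotGen_apply (k : Fin 3) (y : E3) : rotGen k y =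
    y (k + 1) • EuclideanSpace.single (k + 2) 1 - y (k + 2) • EuclideanSpace.single (k + 1) 1 := by
  simp [rotGen]

/-- The derivative `∂_τ f`. -/
noncomputable def dtau (f : ℝ × E3 → ℝ) (p : ℝ × E3) : ℝ := fderiv ℝ f p (1, 0)

/-- The derivative of `f` along the rotations about the `k`-th axis. -/
noncomputable def ang (k : Fin 3) (f : ℝ × E3 → ℝ) (p : ℝ × E3) : ℝ :=
  fderiv ℝ f p (0, rotGen k p.2)

/-- The Laplacian of the unit sphere. -/
noncomputable def angLap (f : ℝ × E3 → ℝ) (p : ℝ × E3) : ℝ := ∑ k, ang k (ang k f) p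

variable {f g : ℝ × E3 → ℝ} {p : ℝ × E3}

lemma contDiffOn_fderiv_punctured (hf : ContDiffOn ℝ ∞ f punctured) :
    ContDiffOn ℝ ∞ (fderiv ℝ f) punctured :=
  hf.fderiv_of_isOpen isOpen_punctured (by simp)

lemma contDiffOn_dtau (hf : ContDiffOn ℝ ∞ f punctured) : ContDiffOn ℝ ∞ (dtau f) punctured :=
  (contDiffOn_fderiv_punctured hf).clm_apply contDiffOn_const

lemma contDiff_rotField (k : Fin 3) :
    ContDiff ℝ ∞ (fun p : ℝ × E3 => ((0 : ℝ), rotGen k p.2)) := by fun_prop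

lemma contDiffOn_ang (k : Fin 3) (hf : ContDiffOn ℝ ∞ f punctured) :
    ContDiffOn ℝ ∞ (ang k f) punctured :=
  (contDiffOn_fderiv_punctured hf).clm_apply (contDiff_rotField k).contDiffOn

lemma contDiffOn_angLap (hf : ContDiffOn ℝ ∞ f punctured) : ContDiffOn ℝ ∞ (angLap f) punctured :=
  ContDiffOn.sum fun k _ => contDiffOn_ang k (contDiffOn_ang k hf)

lemma differentiableAt_of_punctured (hf : ContDiffOn ℝ ∞ f punctured) (hp : p ∈ punctured) :
    DifferentiableAt ℝ f p :=
  (hf.contDiffAt (isOpen_punctured.mem_nhds hp)).differentiableAt (by simp)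

lemma dtau_congr (h : Set.EqOn f g punctured) (hp : p ∈ punctured) : dtau f p = dtau g p := by
  rw [dtau, dtau, (h.eventuallyEq_of_mem (isOpen_punctured.mem_nhds hp)).fderiv_eq]

lemma ang_congr {k : Fin 3} (h : Set.EqOn f g punctured) (hp : p ∈ punctured) :
    ang k f p = ang k g p := by
  rw [ang, ang, (h.eventuallyEq_of_mem (isOpen_punctured.mem_nhds hp)).fderiv_eq]

lemma angLap_congr (h : Set.EqOn f g punctured) (hp : p ∈ punctured) :
    angLap f p = angLap g p :=
  Finset.sum_congr rfl fun _ _ => ang_congr (fun _ hq => ang_congr h hq) hp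

lemma dtau_ang (k : Fin 3) (hf : ContDiffOn ℝ ∞ f punctured) (hp : p ∈ punctured) :
    dtau (ang k f) p = ang k (dtau f) p := by
  have hd : DifferentiableAt ℝ (fderiv ℝ f) p :=
    ((contDiffOn_fderiv_punctured hf).contDiffAt (isOpen_punctured.mem_nhds hp)).differentiableAt
      (by simp)
  have hv : HasFDerivAt (fun p : ℝ × E3 => ((0 : ℝ), rotGen k p.2))
      ((0 : (ℝ × E3) →L[ℝ] ℝ).prod ((rotGen k).comp (ContinuousLinearMap.snd ℝ ℝ E3))) p :=
    (hasFDerivAt_const _ _).prodMk ((rotGen k).hasFDerivAt.comp p hasFDerivAt_snd)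
  have h1 := hd.hasFDerivAt.clm_apply hv
  have h2 := hd.hasFDerivAt.clm_apply (hasFDerivAt_const ((1 : ℝ), (0 : E3)) p)
  have e1 : dtau (ang k f) p = fderiv ℝ (fderiv ℝ f) p (1, 0) (0, rotGen k p.2) := by
    rw [dtau]
    change fderiv ℝ (fun p => fderiv ℝ f p (0, rotGen k p.2)) p (1, 0) = _
    rw [h1.fderiv]
    simp [show ((0 : ℝ), (0 : E3)) = 0 from rfl]
  have e2 : ang k (dtau f) p = fderiv ℝ (fderiv ℝ f) p (0, rotGen k p.2) (1, 0) := by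
    rw [ang]
    change fderiv ℝ (fun p => fderiv ℝ f p (1, 0)) p (0, rotGen k p.2) = _
    rw [h2.fderiv]; simp
  rw [e1, e2]
  exact ((hf.contDiffAt (isOpen_punctured.mem_nhds hp)).isSymmSndFDerivAt
    (by simpa using WithTop.coe_le_coe.2 (le_top (a := (2 : ℕ∞))))) _ _

lemma dtau_angLap (hf : ContDiffOn ℝ ∞ f punctured) (hp : p ∈ punctured) :
    dtau (angLap f) p = angLap (dtau f) p := by
  have h : ∀ k, DifferentiableAt ℝ (ang k (ang k f)) p := fun k =>
    differentiableAt_of_punctured (contDiffOn_ang k (contDiffOn_ang k hf)) hp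
  have e : dtau (angLap f) p = ∑ k, dtau (ang k (ang k f)) p := by
    change fderiv ℝ (fun p => ∑ k, ang k (ang k f) p) p (1, 0) = _
    rw [fderiv_fun_sum fun k _ => h k]
    simp [dtau]
  rw [e]
  refine Finset.sum_congr rfl fun k _ => ?_
  rw [dtau_ang k (contDiffOn_ang k hf) hp]
  exact ang_congr (fun q hq => dtau_ang k hf hq) hp

lemma dtau_add (hf : ContDiffOn ℝ ∞ f punctured) (hg : ContDiffOn ℝ ∞ g punctured)
    (hp : p ∈ punctured) : dtau (fun p => f p + g p) p = dtau f p + dtau g p := by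
  simp [dtau, fderiv_fun_add (differentiableAt_of_punctured hf hp)
    (differentiableAt_of_punctured hg hp)]

lemma ang_add {k : Fin 3} (hf : ContDiffOn ℝ ∞ f punctured) (hg : ContDiffOn ℝ ∞ g punctured)
    (hp : p ∈ punctured) : ang k (fun p => f p + g p) p = ang k f p + ang k g p := by
  simp [ang, fderiv_fun_add (differentiableAt_of_punctured hf hp)
    (differentiableAt_of_punctured hg hp)]

lemma hasFDerivAt_timeFun_mul {a : ℝ → ℝ} {a' : ℝ} (ha : HasDerivAt a a' p.1)
    (hf : ContDiffOn ℝ ∞ f punctured) (hp : p ∈ punctured) :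
    HasFDerivAt (fun p => a p.1 * f p)
      (a p.1 • fderiv ℝ f p + f p • (a' • ContinuousLinearMap.fst ℝ ℝ E3)) p :=
  (ha.comp_hasFDerivAt p hasFDerivAt_fst).mul (differentiableAt_of_punctured hf hp).hasFDerivAt

lemma dtau_timeFun_mul {a : ℝ → ℝ} {a' : ℝ} (ha : HasDerivAt a a' p.1)
    (hf : ContDiffOn ℝ ∞ f punctured) (hp : p ∈ punctured) :
    dtau (fun p => a p.1 * f p) p = a' * f p + a p.1 * dtau f p := by
  rw [dtau, (hasFDerivAt_timeFun_mul ha hf hp).fderiv]; simp [dtau]; ring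

lemma ang_timeFun_mul {k : Fin 3} {a : ℝ → ℝ} (ha : ContDiff ℝ ∞ a)
    (hf : ContDiffOn ℝ ∞ f punctured) (hp : p ∈ punctured) :
    ang k (fun p => a p.1 * f p) p = a p.1 * ang k f p := by
  rw [ang, (hasFDerivAt_timeFun_mul (ha.differentiable (by simp) p.1).hasDerivAt hf hp).fderiv]
  simp [ang]

lemma contDiffOn_timeFun_mul {a : ℝ → ℝ} (ha : ContDiff ℝ ∞ a) (hf : ContDiffOn ℝ ∞ f punctured) :
    ContDiffOn ℝ ∞ (fun p => a p.1 * f p) punctured :=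
  (ha.comp contDiff_fst).contDiffOn.mul hf

lemma angLap_timeFun_mul {a : ℝ → ℝ} (ha : ContDiff ℝ ∞ a)
    (hf : ContDiffOn ℝ ∞ f punctured) (hp : p ∈ punctured) :
    angLap (fun p => a p.1 * f p) p = a p.1 * angLap f p := by
  rw [angLap, angLap, Finset.mul_sum]
  refine Finset.sum_congr rfl fun k _ => ?_
  rw [ang_congr (fun q hq => ang_timeFun_mul ha hf hq) hp,
    ang_timeFun_mul ha (contDiffOn_ang k hf) hp]

lemma angLap_add (hf : ContDiffOn ℝ ∞ f punctured) (hg : ContDiffOn ℝ ∞ g punctured)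
    (hp : p ∈ punctured) : angLap (fun p => f p + g p) p = angLap f p + angLap g p := by
  rw [angLap, angLap, angLap, ← Finset.sum_add_distrib]
  refine Finset.sum_congr rfl fun k _ => ?_
  rw [ang_congr (fun q hq => ang_add hf hg hq) hp,
    ang_add (contDiffOn_ang k hf) (contDiffOn_ang k hg) hp]

/-- The rotation by the angle `t` about the `k`-th axis. -/
noncomputable def rot (k : Fin 3) (t : ℝ) (y : E3) : E3 :=
  -- Rodrigues' formula.
  y + Real.sin t • rotGen k y + (1 - Real.cos t) • rotGen k (rotGen k y)

lemma inner_rot (k : Fin 3) (t : ℝ) (y z : E3) : inner ℝ (rot k t y) (rot k t z) = inner ℝ y z := by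
  have h := Real.sin_sq_add_cos_sq t
  simp only [PiLp.inner_apply, Fin.sum_univ_three, rot, rotGen_apply]
  fin_cases k <;> simp <;> grind

/-- Rotations as linear isometries. -/
noncomputable def rotIso (k : Fin 3) (t : ℝ) : E3 ≃ₗᵢ[ℝ] E3 :=
  LinearIsometry.toLinearIsometryEquiv
    { toLinearMap := LinearMap.id + Real.sin t • (rotGen k : E3 →ₗ[ℝ] E3) +
        (1 - Real.cos t) • ((rotGen k : E3 →ₗ[ℝ] E3) ∘ₗ (rotGen k : E3 →ₗ[ℝ] E3))
      norm_map' := fun y => by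
        have h := inner_rot k t y y
        rw [real_inner_self_eq_norm_sq, real_inner_self_eq_norm_sq] at h
        have := (pow_left_inj₀ (norm_nonneg _) (norm_nonneg _) two_ne_zero).1 h
        simpa [rot] using this } rfl

lemma rotIso_apply (k : Fin 3) (t : ℝ) (y : E3) : rotIso k t y = rot k t y := by
  simp [rotIso, rot]

lemma contDiff_rot (k : Fin 3) : ContDiff ℝ ∞ (fun q : ℝ × E3 => rot k q.1 q.2) := by
  unfold rot; fun_prop

lemma hasDerivAt_rot (k : Fin 3) (y : E3) : HasDerivAt (fun t => rot k t y) (rotGen k y) 0 := by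
  have h1 := (Real.hasDerivAt_sin 0).smul_const (rotGen k y)
  have h2 := ((Real.hasDerivAt_cos 0).const_sub 1).smul_const (rotGen k (rotGen k y))
  refine ((h1.const_add y).add h2).congr_deriv ?_
  simp

end AngularDerivatives

/-! ### Integrals over the shell: rotation invariance and dependence on parameters. -/

section ShellIntegral

open MeasureTheory

/-- The spherical shell `1 ≤ ‖y‖ ≤ 2`. Integrals over the sphere are represented by
integrals over the shell. -/
def shell : Set E3 := {y | 1 ≤ ‖y‖ ∧ ‖y‖ ≤ 2}

lemma isCompact_shell : IsCompact shell := by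
  have : shell = Metric.closedBall 0 2 ∩ {y | 1 ≤ ‖y‖} := by
    ext y; simp [shell, and_comm]
  rw [this]
  exact (isCompact_closedBall _ _).inter_right (isClosed_le continuous_const continuous_norm)

lemma measurableSet_shell : MeasurableSet shell := isCompact_shell.isClosed.measurableSet

lemma ne_zero_of_mem_shell {y : E3} (hy : y ∈ shell) : y ≠ 0 := by
  rintro rfl
  have := hy.1
  simp at this
  linarith

lemma setIntegral_shell_comp (R : E3 ≃ₗᵢ[ℝ] E3) (h : E3 → ℝ) :
    ∫ y in shell, h (R y) = ∫ y in shell, h y := by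
  have hp : R ⁻¹' shell = shell := by ext y; simp [shell]
  have := R.measurePreserving.setIntegral_preimage_emb R.toMeasurableEquiv.measurableEmbedding h
    shell
  rwa [hp] at this

lemma integrableOn_shell {h : E3 → ℝ} (hh : ContinuousOn h shell) :
    IntegrableOn h shell := hh.integrableOn_compact isCompact_shell

/-- The integral is the value at 0 of a convolution with a parameter, for which smoothness is known.
A cutoff supplies compact support and removes the possible singularity of `h` at the origin. -/
lemma contDiffOn_integral_shell {P : Type} [NormedAddCommGroup P] [NormedSpace ℝ P] {s : Set P}
    (hs : IsOpen s) {w : E3 → ℝ} (hw : ContinuousOn w shell) {h : P × E3 → ℝ}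
    (hh : ContDiffOn ℝ ∞ h (s ×ˢ {0}ᶜ)) :
    ContDiffOn ℝ ∞ (fun p => ∫ y in shell, w y * h (p, y)) s := by
  -- The constants make χ equal to 1 for 1 ≤ ‖y‖ ≤ 2 and equal to 0 both for ‖y‖ < 1/2 and for ‖y‖ >
  -- 3.
  let χ : E3 → ℝ := fun y => Real.smoothTransition (2 * ‖y‖ ^ 2 - 1) *
    Real.smoothTransition (5 - ‖y‖ ^ 2)
  have hχ : ContDiff ℝ ∞ χ := by
    have h2 : ContDiff ℝ ∞ (fun y : E3 => ‖y‖ ^ 2) := contDiff_norm_sq ℝ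
    exact (Real.smoothTransition.contDiff.comp ((contDiff_const.mul h2).sub contDiff_const)).mul
      (Real.smoothTransition.contDiff.comp (contDiff_const.sub h2))
  have hχ1 : ∀ y ∈ shell, χ y = 1 := by
    intro y hy
    have h1 : 1 ≤ ‖y‖ ^ 2 := one_le_pow₀ hy.1
    have h2 : ‖y‖ ^ 2 ≤ 2 ^ 2 := pow_le_pow_left₀ (norm_nonneg _) hy.2 2
    simp only [χ]
    rw [Real.smoothTransition.one_of_one_le (by linarith),
      Real.smoothTransition.one_of_one_le (by linarith), one_mul]
  have hχ0 : ∀ y, ‖y‖ < 1 / 2 → χ y = 0 := by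
    intro y hy
    have h1 : ‖y‖ ^ 2 ≤ (1 / 2) ^ 2 := pow_le_pow_left₀ (norm_nonneg _) hy.le 2
    simp only [χ]
    rw [Real.smoothTransition.zero_of_nonpos (by linarith), zero_mul]
  have hχ3 : ∀ y, 3 < ‖y‖ → χ y = 0 := by
    intro y hy
    have h1 : 3 ^ 2 ≤ ‖y‖ ^ 2 := pow_le_pow_left₀ (by norm_num) hy.le 2
    simp only [χ]
    rw [Real.smoothTransition.zero_of_nonpos (x := 5 - ‖y‖ ^ 2) (by linarith), mul_zero]
  have hconv := contDiffOn_convolution_right_with_param (μ := (volume : Measure E3)) (n := ⊤)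
    (f := shell.indicator w) (ContinuousLinearMap.mul ℝ ℝ)
    (g := fun p y => χ (-y) * h (p, -y)) (s := s) (k := Metric.closedBall 0 3) hs
    (isCompact_closedBall _ _) (fun p y _ hy => by
      have : χ (-y) = 0 := hχ3 _ (by simpa using hy)
      simp [this])
    (((integrableOn_shell hw).integrable_indicator measurableSet_shell).locallyIntegrable) (by
      rintro ⟨p, y⟩ ⟨hp, -⟩
      apply ContDiffAt.contDiffWithinAt
      by_cases hy : ‖y‖ < 1 / 2
      · refine ContDiffAt.congr_of_eventuallyEq (f := fun _ => (0 : ℝ)) contDiffAt_const ?_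
        have : ∀ᶠ q : P × E3 in nhds (p, y), ‖q.2‖ < 1 / 2 :=
          (continuous_snd.norm.continuousAt).eventually_lt continuousAt_const hy
        filter_upwards [this] with q hq
        have : χ (-q.2) = 0 := hχ0 _ (by simpa using hq)
        simp [Function.HasUncurry.uncurry, this]
      · have hy0 : y ≠ 0 := by rintro rfl; simp at hy
        have hm : s ×ˢ ({0}ᶜ : Set E3) ∈ nhds (p, -y) :=
          (hs.prod isOpen_compl_singleton).mem_nhds ⟨hp, by simpa using hy0⟩
        have h1 : ContDiffAt ℝ ∞ (fun q : P × E3 => h (q.1, -q.2)) (p, y) :=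
          ContDiffAt.comp (p, y) (hh.contDiffAt hm)
            (contDiff_fst.prodMk contDiff_snd.neg).contDiffAt
        exact (hχ.comp contDiff_snd.neg).contDiffAt.mul h1)
  have h0 : ContDiffOn ℝ ∞ (fun p : P => (p, (0 : E3))) s :=
    (contDiff_id.prodMk contDiff_const).contDiffOn
  refine (hconv.comp h0 fun p hp => ⟨hp, trivial⟩).congr fun p hp => ?_
  simp only [Function.comp_apply, convolution_def, ContinuousLinearMap.mul_apply', zero_sub, neg_neg]
  rw [← integral_indicator measurableSet_shell]
  refine integral_congr_ae (Filter.Eventually.of_forall fun y => ?_)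
  by_cases hy : y ∈ shell
  · simp [hy, hχ1 y hy]
  · simp [hy]

lemma hasDerivAt_integral_shell {w : E3 → ℝ} (hw : ContinuousOn w shell) {h : ℝ × E3 → ℝ}
    (hh : ContDiffOn ℝ ∞ h punctured) (t : ℝ) :
    HasDerivAt (fun t => ∫ y in shell, w y * h (t, y)) (∫ y in shell, w y * dtau h (t, y)) t := by
  have hsub : ∀ {s : Set ℝ} {q : ℝ × E3}, q ∈ s ×ˢ shell → q ∈ punctured := fun hq =>
    ne_zero_of_mem_shell hq.2
  have hcont : ∀ s : ℝ, Continuous fun y : E3 => (s, y) := fun s => by fun_prop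
  have hslice : ∀ {k : ℝ × E3 → ℝ}, ContinuousOn k punctured → ∀ s,
      ContinuousOn (fun y => w y * k (s, y)) shell := fun hk s =>
    hw.mul (hk.comp (hcont s).continuousOn fun y hy => ne_zero_of_mem_shell hy)
  have hd := (contDiffOn_dtau hh).continuousOn
  have hK : IsCompact (Set.Icc (t - 1) (t + 1) ×ˢ shell) := isCompact_Icc.prod isCompact_shell
  -- Compactness of [t − 1, t + 1] × shell provides a constant dominating function.
  obtain ⟨C, hC⟩ := hK.exists_bound_of_continuousOn (f := fun q => w q.2 * dtau h q)
    ((hw.comp continuousOn_snd fun q hq => hq.2).mul (hd.mono fun q hq => hsub hq))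
  refine (hasDerivAt_integral_of_dominated_loc_of_deriv_le (bound := fun _ => C)
    (s := Set.Icc (t - 1) (t + 1)) (F' := fun s y => w y * dtau h (s, y))
    (Icc_mem_nhds (by linarith) (by linarith)) ?_ ?_ ?_ ?_ ?_ ?_).2
  · exact Filter.Eventually.of_forall fun s =>
      (hslice hh.continuousOn s).aestronglyMeasurable measurableSet_shell
  · exact integrableOn_shell (hslice hh.continuousOn t)
  · exact (hslice hd t).aestronglyMeasurable measurableSet_shell
  · refine (ae_restrict_iff' measurableSet_shell).2 (Filter.Eventually.of_forall ?_)
    exact fun y hy s hs => hC (s, y) ⟨hs, hy⟩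
  · exact integrableOn_shell continuousOn_const
  · refine (ae_restrict_iff' measurableSet_shell).2 (Filter.Eventually.of_forall ?_)
    intro y hy s hs
    have h1 := (differentiableAt_of_punctured (p := (s, y)) hh
      (ne_zero_of_mem_shell hy)).hasFDerivAt
    have h2 : HasDerivAt (fun s : ℝ => (s, y)) ((1 : ℝ), (0 : E3)) s :=
      (hasDerivAt_id s).prodMk (hasDerivAt_const s y)
    exact (h1.comp_hasDerivAt s h2).const_mul (w y)

end ShellIntegral

end UnitHyperboloid

namespace UnitHyperboloid

/-! ### Zonal integral operators, their smoothness and their commutation with derivatives. -/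

section Zonal

open MeasureTheory

/-- The cosine of the angle between two vectors. -/
noncomputable def cosAngle (x y : E3) : ℝ := inner ℝ x y / (‖x‖ * ‖y‖)

lemma cosAngle_isometry (R : E3 ≃ₗᵢ[ℝ] E3) (x y : E3) : cosAngle (R x) (R y) = cosAngle x y := by
  simp [cosAngle]

lemma cosAngle_mem (x y : E3) : cosAngle x y ∈ Set.Icc (-1) 1 :=
  abs_le.1 (abs_real_inner_div_norm_mul_norm_le_one x y)

lemma cosAngle_smul_left (x y : E3) {c : ℝ} (hc : 0 < c) : cosAngle (c • x) y = cosAngle x y := by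
  rw [cosAngle, cosAngle, real_inner_smul_left, norm_smul, Real.norm_of_nonneg hc.le, mul_assoc,
    mul_div_mul_left _ _ hc.ne']

lemma continuousOn_cosAngle {x : E3} (hx : x ≠ 0) : ContinuousOn (cosAngle x) {0}ᶜ := by
  refine ContinuousOn.div (by fun_prop) (by fun_prop) fun y hy => ?_
  exact mul_ne_zero (norm_ne_zero_iff.2 hx) (norm_ne_zero_iff.2 hy)

lemma continuousOn_comp_cosAngle {g : ℝ → ℝ} (hg : ContinuousOn g (Set.Icc (-1) 1)) {x : E3}
    (hx : x ≠ 0) : ContinuousOn (fun y => g (cosAngle x y)) shell :=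
  hg.comp ((continuousOn_cosAngle hx).mono fun _ hy => ne_zero_of_mem_shell hy)
    fun y _ => cosAngle_mem x y

/-- The integral operator on the sphere whose kernel is a function of the angle. -/
noncomputable def zonal (g : ℝ → ℝ) (f : ℝ × E3 → ℝ) (p : ℝ × E3) : ℝ :=
  ∫ y in shell, g (cosAngle p.2 y) * f (p.1, y)

/-- The rotation taking the unit vector `a` to the unit vector `b` and fixing the orthogonal
complement of their span. -/
noncomputable def rotTo (a b y : E3) : E3 :=
  y - ((inner ℝ a y + inner ℝ b y) / (1 + inner ℝ a b)) • (a + b) + (2 * inner ℝ a y) • b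

lemma inner_rotTo_right {a b : E3} (hb : ‖b‖ = 1) (hab : 1 + inner ℝ a b ≠ 0)
    (y : E3) : inner ℝ b (rotTo a b y) = inner ℝ a y := by
  have hbb : inner ℝ b b = (1 : ℝ) := by rw [real_inner_self_eq_norm_sq, hb]; norm_num
  have hba : inner ℝ b a = inner ℝ a b := real_inner_comm a b
  simp only [rotTo, inner_add_right, inner_sub_right, real_inner_smul_right, hbb, hba]
  field_simp
  ring

lemma norm_rotTo {a b : E3} (ha : ‖a‖ = 1) (hb : ‖b‖ = 1) (hab : 1 + inner ℝ a b ≠ 0) (y : E3) :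
    ‖rotTo a b y‖ = ‖y‖ := by
  have haa : inner ℝ a a = (1 : ℝ) := by rw [real_inner_self_eq_norm_sq, ha]; norm_num
  have hbb : inner ℝ b b = (1 : ℝ) := by rw [real_inner_self_eq_norm_sq, hb]; norm_num
  have hba : inner ℝ b a = inner ℝ a b := real_inner_comm a b
  have hya : inner ℝ y a = inner ℝ a y := real_inner_comm a y
  have hyb : inner ℝ y b = inner ℝ b y := real_inner_comm b y
  refine (pow_left_inj₀ (norm_nonneg _) (norm_nonneg _) two_ne_zero).1 ?_
  rw [← real_inner_self_eq_norm_sq, ← real_inner_self_eq_norm_sq]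
  simp only [rotTo, inner_add_right, inner_sub_right, real_inner_smul_right, inner_add_left,
    inner_sub_left, real_inner_smul_left, hbb, haa, hba, hya, hyb]
  field_simp
  ring

lemma rotTo_ne_zero {a b : E3} (ha : ‖a‖ = 1) (hb : ‖b‖ = 1) (hab : 1 + inner ℝ a b ≠ 0) {y : E3}
    (hy : y ≠ 0) : rotTo a b y ≠ 0 := by
  rw [← norm_ne_zero_iff, norm_rotTo ha hb hab]
  exact norm_ne_zero_iff.2 hy

/-- `rotTo` as a linear isometry. -/
noncomputable def rotToIso {a b : E3} (ha : ‖a‖ = 1) (hb : ‖b‖ = 1) (hab : 1 + inner ℝ a b ≠ 0) :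
    E3 ≃ₗᵢ[ℝ] E3 :=
  LinearIsometry.toLinearIsometryEquiv
    { toFun := rotTo a b
      map_add' := fun y z => by
        simp only [rotTo, inner_add_right]
        module
      map_smul' := fun c y => by
        simp only [rotTo, real_inner_smul_right, RingHom.id_apply]
        module
      norm_map' := norm_rotTo ha hb hab } rfl

lemma rotToIso_apply {a b : E3} (ha : ‖a‖ = 1) (hb : ‖b‖ = 1) (hab : 1 + inner ℝ a b ≠ 0) (y : E3) :
    rotToIso ha hb hab y = rotTo a b y := rfl

/-- The kernel is merely continuous, so it must not be differentiated. Rotating the integration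
variable by the rotation that takes a fixed direction `a` to the direction of the evaluation point
freezes the kernel and puts the whole dependence on that point into the smooth `f`. -/
lemma contDiffOn_zonal {g : ℝ → ℝ} (hg : ContinuousOn g (Set.Icc (-1) 1)) {f : ℝ × E3 → ℝ}
    (hf : ContDiffOn ℝ ∞ f punctured) : ContDiffOn ℝ ∞ (zonal g f) punctured := by
  intro p hp
  apply ContDiffAt.contDiffWithinAt
  have hp0 : 0 < ‖p.2‖ := norm_pos_iff.2 hp
  set a : E3 := ‖p.2‖⁻¹ • p.2 with ha
  have ha1 : ‖a‖ = 1 := by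
    rw [ha, norm_smul, norm_inv, norm_norm, inv_mul_cancel₀ hp0.ne']
  have ha0 : a ≠ 0 := by rw [← norm_ne_zero_iff, ha1]; norm_num
  -- On this half-space no direction is opposite to `a`, so the denominator 1 + ⟨a, b⟩ of the
  -- rotation stays positive.
  let s : Set (ℝ × E3) := {q | 0 < inner ℝ a q.2}
  have hs : IsOpen s := isOpen_lt continuous_const (by fun_prop)
  have hps : p ∈ s := by
    change 0 < inner ℝ a p.2
    rw [ha, real_inner_smul_left, real_inner_self_eq_norm_sq]
    positivity
  have hs0 : ∀ q ∈ s, q.2 ≠ 0 := by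
    rintro q hq h
    have : 0 < inner ℝ a q.2 := hq
    simp [h] at this
  have hb1 : ∀ q ∈ s, ‖(‖q.2‖⁻¹ • q.2 : E3)‖ = 1 := fun q hq => by
    rw [norm_smul, norm_inv, norm_norm, inv_mul_cancel₀ (norm_ne_zero_iff.2 (hs0 q hq))]
  have hab : ∀ q ∈ s, 1 + inner ℝ a (‖q.2‖⁻¹ • q.2 : E3) ≠ 0 := fun q hq => by
    have h1 : 0 < inner ℝ a q.2 := hq
    have h2 : 0 < ‖q.2‖ := norm_pos_iff.2 (hs0 q hq)
    rw [real_inner_smul_right]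
    positivity
  let b : ℝ × E3 → E3 := fun q => ‖q.2‖⁻¹ • q.2
  have hbs : ContDiffOn ℝ ∞ b s := by
    have : ContDiffOn ℝ ∞ (fun q : ℝ × E3 => ‖q.2‖) s := contDiff_snd.contDiffOn.norm ℝ hs0
    exact (this.inv fun q hq => norm_ne_zero_iff.2 (hs0 q hq)).smul contDiff_snd.contDiffOn
  have hsm : ContDiffOn ℝ ∞ (fun q : (ℝ × E3) × E3 => f (q.1.1, rotTo a (b q.1) q.2))
      (s ×ˢ {0}ᶜ) := by
    have hb' : ContDiffOn ℝ ∞ (fun q : (ℝ × E3) × E3 => b q.1) (s ×ˢ {0}ᶜ) :=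
      hbs.comp contDiff_fst.contDiffOn fun q hq => hq.1
    have h2 : ContDiffOn ℝ ∞ (fun q : (ℝ × E3) × E3 => q.2) (s ×ˢ {0}ᶜ) := contDiff_snd.contDiffOn
    have hR : ContDiffOn ℝ ∞ (fun q : (ℝ × E3) × E3 => rotTo a (b q.1) q.2) (s ×ˢ {0}ᶜ) := by
      have i1 := contDiffOn_const (c := a) |>.inner ℝ h2
      have i2 := hb'.inner ℝ h2
      have i3 := contDiffOn_const (c := a) |>.inner ℝ hb'
      exact (h2.sub (((i1.add i2).div (contDiffOn_const.add i3) fun q hq => hab q.1 hq.1).smul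
        (contDiffOn_const.add hb'))).add ((contDiffOn_const.mul i1).smul hb')
    refine hf.comp ((contDiff_fst.comp contDiff_fst).contDiffOn.prodMk hR) fun q hq => ?_
    exact rotTo_ne_zero ha1 (hb1 q.1 hq.1) (hab q.1 hq.1) hq.2
  have key := contDiffOn_integral_shell hs (continuousOn_comp_cosAngle hg ha0) hsm
  refine (key.contDiffAt (hs.mem_nhds hps)).congr_of_eventuallyEq ?_
  filter_upwards [hs.mem_nhds hps] with q hq
  have hq0 : 0 < ‖q.2‖ := norm_pos_iff.2 (hs0 q hq)
  rw [zonal, ← setIntegral_shell_comp (rotToIso ha1 (hb1 q hq) (hab q hq))]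
  refine integral_congr_ae (Filter.Eventually.of_forall fun y => ?_)
  simp only [rotToIso_apply]
  congr 2
  have h1 := inner_rotTo_right (a := a) (hb1 q hq) (hab q hq) y
  rw [← cosAngle_smul_left q.2 _ (inv_pos.2 hq0), cosAngle, cosAngle, h1, hb1 q hq,
    norm_rotTo ha1 (hb1 q hq) (hab q hq), ha1]

variable {g : ℝ → ℝ} {f : ℝ × E3 → ℝ} {p : ℝ × E3}

lemma hasDerivAt_comp_rot (k : Fin 3) (hf : DifferentiableAt ℝ f p) :
    HasDerivAt (fun t => f (p.1, rot k t p.2)) (ang k f p) 0 := by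
  have h0 : rot k 0 p.2 = p.2 := by simp [rot]
  have h1 : HasDerivAt (fun t => (p.1, rot k t p.2)) (0, rotGen k p.2) 0 :=
    (hasDerivAt_const _ _).prodMk (hasDerivAt_rot k p.2)
  have h2 : HasFDerivAt f (fderiv ℝ f p) (p.1, rot k 0 p.2) := by rw [h0]; exact hf.hasFDerivAt
  exact h2.comp_hasDerivAt 0 h1

lemma rot_ne_zero (k : Fin 3) (t : ℝ) {y : E3} (hy : y ≠ 0) : rot k t y ≠ 0 := by
  rw [← rotIso_apply]
  exact (map_ne_zero_iff _ (rotIso k t).injective).2 hy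

lemma dtau_zonal (hg : ContinuousOn g (Set.Icc (-1) 1)) (hf : ContDiffOn ℝ ∞ f punctured)
    (hp : p ∈ punctured) : dtau (zonal g f) p = zonal g (dtau f) p := by
  have h1 := (differentiableAt_of_punctured (contDiffOn_zonal hg hf) hp).hasFDerivAt
  have h2 : HasDerivAt (fun t : ℝ => (t, p.2)) ((1 : ℝ), (0 : E3)) p.1 :=
    (hasDerivAt_id _).prodMk (hasDerivAt_const _ _)
  have h3 := h1.comp_hasDerivAt p.1 h2
  have h4 := hasDerivAt_integral_shell (continuousOn_comp_cosAngle hg hp) hf p.1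
  exact h3.unique h4

/-- The kernel is unchanged when both points are rotated, so rotating the evaluation point amounts
to rotating the argument of `f`; then one differentiates at t = 0 under the integral. -/
lemma ang_zonal (k : Fin 3) (hg : ContinuousOn g (Set.Icc (-1) 1))
    (hf : ContDiffOn ℝ ∞ f punctured) (hp : p ∈ punctured) :
    ang k (zonal g f) p = zonal g (ang k f) p := by
  have h1 := hasDerivAt_comp_rot k (differentiableAt_of_punctured (contDiffOn_zonal hg hf) hp)
  have hsm : ContDiffOn ℝ ∞ (fun q : ℝ × E3 => f (p.1, rot k q.1 q.2)) punctured :=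
    hf.comp (contDiff_const.prodMk (contDiff_rot k)).contDiffOn fun q hq => rot_ne_zero k q.1 hq
  have h2 := hasDerivAt_integral_shell (continuousOn_comp_cosAngle hg hp) hsm 0
  have h3 : (fun t => zonal g f (p.1, rot k t p.2)) =
      fun t => ∫ y in shell, g (cosAngle p.2 y) * f (p.1, rot k t y) := by
    funext t
    rw [zonal, ← setIntegral_shell_comp (rotIso k t)]
    simp only [← rotIso_apply, cosAngle_isometry]
  rw [h3] at h1
  rw [h1.unique h2, zonal]
  refine setIntegral_congr_fun measurableSet_shell fun y hy => ?_
  have hq : (p.1, y) ∈ punctured := ne_zero_of_mem_shell hy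
  have h4 := hasDerivAt_comp_rot k (differentiableAt_of_punctured hf hq)
  have h5 : HasDerivAt (fun t => f (p.1, rot k t y))
      (dtau (fun q : ℝ × E3 => f (p.1, rot k q.1 q.2)) (0, y)) 0 := by
    have e1 := (differentiableAt_of_punctured (p := (0, y)) hsm
      (ne_zero_of_mem_shell hy)).hasFDerivAt
    have e2 : HasDerivAt (fun t : ℝ => (t, y)) ((1 : ℝ), (0 : E3)) 0 :=
      (hasDerivAt_id _).prodMk (hasDerivAt_const _ _)
    have := e1.comp_hasDerivAt (0 : ℝ) e2
    exact this
  change _ * _ = _ * _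
  rw [h5.unique h4]

lemma zonal_congr {f' : ℝ × E3 → ℝ} (h : Set.EqOn f f' punctured) (p : ℝ × E3) :
    zonal g f p = zonal g f' p :=
  setIntegral_congr_fun measurableSet_shell fun y hy => by
    rw [h (show (p.1, y) ∈ punctured from ne_zero_of_mem_shell hy)]

lemma continuousOn_slice (hf : ContDiffOn ℝ ∞ f punctured) (t : ℝ) :
    ContinuousOn (fun y => f (t, y)) shell :=
  hf.continuousOn.comp (by fun_prop) fun y hy => ne_zero_of_mem_shell hy

lemma integrableOn_zonal (hg : ContinuousOn g (Set.Icc (-1) 1)) (hf : ContDiffOn ℝ ∞ f punctured)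
    (hp : p ∈ punctured) (t : ℝ) :
    IntegrableOn (fun y => g (cosAngle p.2 y) * f (t, y)) shell :=
  integrableOn_shell ((continuousOn_comp_cosAngle hg hp).mul (continuousOn_slice hf t))

lemma zonal_add {f' : ℝ × E3 → ℝ} (hg : ContinuousOn g (Set.Icc (-1) 1))
    (hf : ContDiffOn ℝ ∞ f punctured) (hf' : ContDiffOn ℝ ∞ f' punctured) (hp : p ∈ punctured) :
    zonal g (fun p => f p + f' p) p = zonal g f p + zonal g f' p := by
  rw [zonal, zonal, zonal, ← integral_add (integrableOn_zonal hg hf hp _)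
    (integrableOn_zonal hg hf' hp _)]
  simp only [mul_add]

lemma zonal_timeFun_mul (a : ℝ → ℝ) : zonal g (fun p => a p.1 * f p) p = a p.1 * zonal g f p := by
  rw [zonal, zonal, ← integral_const_mul]
  congr 1
  funext y
  ring

lemma zonal_kernel_add {g' : ℝ → ℝ} (hg : ContinuousOn g (Set.Icc (-1) 1))
    (hg' : ContinuousOn g' (Set.Icc (-1) 1)) (hf : ContDiffOn ℝ ∞ f punctured) (hp : p ∈ punctured) :
    zonal (fun z => g z + g' z) f p = zonal g f p + zonal g' f p := by
  rw [zonal, zonal, zonal, ← integral_add (integrableOn_zonal hg hf hp _)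
    (integrableOn_zonal hg' hf hp _)]
  simp only [add_mul]

lemma zonal_kernel_const_mul (c : ℝ) : zonal (fun z => c * g z) f p = c * zonal g f p := by
  rw [zonal, zonal, ← integral_const_mul]
  simp only [mul_assoc]

lemma zonal_angLap_comm (hg : ContinuousOn g (Set.Icc (-1) 1)) (hf : ContDiffOn ℝ ∞ f punctured)
    (hp : p ∈ punctured) : angLap (zonal g f) p = zonal g (angLap f) p := by
  have h : ∀ k, ang k (ang k (zonal g f)) p = zonal g (ang k (ang k f)) p := fun k => by
    rw [ang_congr (fun q hq => ang_zonal k hg hf hq) hp, ang_zonal k hg (contDiffOn_ang k hf) hp]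
  have h2 := fun k => contDiffOn_ang k (contDiffOn_ang k hf)
  rw [angLap, Finset.sum_congr rfl fun k _ => h k, Fin.sum_univ_three,
    ← zonal_add hg (h2 0) (h2 1) hp, ← zonal_add hg ((h2 0).add (h2 1)) (h2 2) hp]
  refine zonal_congr (fun q _ => ?_) p
  rw [angLap, Fin.sum_univ_three]

end Zonal

end UnitHyperboloid

namespace UnitHyperboloid

/-! ### Integration by parts and the Legendre operator. -/

section ZonalKernels

open MeasureTheory

variable {g g' g'' : ℝ → ℝ} {f h : ℝ × E3 → ℝ} {p : ℝ × E3} {k : Fin 3}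

lemma ang_mul (hf : ContDiffOn ℝ ∞ f punctured) (hh : ContDiffOn ℝ ∞ h punctured)
    (hp : p ∈ punctured) : ang k (fun q => f q * h q) p = ang k f p * h p + f p * ang k h p := by
  simp [ang, fderiv_fun_mul (differentiableAt_of_punctured hf hp)
    (differentiableAt_of_punctured hh hp)]
  ring

lemma ang_comp {d : ℝ} (hg : HasDerivAt g d (f p)) (hf : ContDiffOn ℝ ∞ f punctured)
    (hp : p ∈ punctured) : ang k (fun q => g (f q)) p = d * ang k f p := by
  have := (hg.comp_hasFDerivAt p (differentiableAt_of_punctured hf hp).hasFDerivAt).fderiv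
  rw [ang, show (fun q => g (f q)) = g ∘ f from rfl, this]
  simp [ang]

/-- With the constant kernel 1 the zonal integral does not depend on the direction, and `ang_zonal`
identifies its rotation derivative with the integral in question. -/
lemma integral_ang (k : Fin 3) (hf : ContDiffOn ℝ ∞ f punctured) (t : ℝ) :
    ∫ y in shell, ang k f (t, y) = 0 := by
  let p : ℝ × E3 := (t, EuclideanSpace.single 0 1)
  have hp : p ∈ punctured := by simp [p, punctured]
  have h1 := ang_zonal (g := fun _ => 1) k continuousOn_const hf hp
  have hd := differentiableAt_of_punctured (contDiffOn_zonal (g := fun _ => 1)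
    continuousOn_const hf) hp
  have h2 := (hasDerivAt_comp_rot k hd).unique (hasDerivAt_const 0 (zonal (fun _ => 1) f p))
  rw [h2] at h1
  simpa [zonal] using h1.symm

lemma integral_ang_mul (k : Fin 3) (hf : ContDiffOn ℝ ∞ f punctured)
    (hh : ContDiffOn ℝ ∞ h punctured) (t : ℝ) :
    ∫ y in shell, ang k f (t, y) * h (t, y) = -∫ y in shell, f (t, y) * ang k h (t, y) := by
  have h0 := integral_ang k (hf.mul hh) t
  rw [setIntegral_congr_fun measurableSet_shell fun y hy =>
    ang_mul hf hh (p := (t, y)) (ne_zero_of_mem_shell hy), integral_add] at h0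
  · linarith
  · exact integrableOn_shell ((continuousOn_slice (contDiffOn_ang k hf) t).mul
      (continuousOn_slice hh t))
  · exact integrableOn_shell ((continuousOn_slice hf t).mul
      (continuousOn_slice (contDiffOn_ang k hh) t))

lemma integral_mul_angLap (hf : ContDiffOn ℝ ∞ f punctured) (hh : ContDiffOn ℝ ∞ h punctured)
    (t : ℝ) : ∫ y in shell, h (t, y) * angLap f (t, y) =
      ∫ y in shell, angLap h (t, y) * f (t, y) := by
  have i1 : ∀ k, IntegrableOn (fun y => h (t, y) * ang k (ang k f) (t, y)) shell := fun k =>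
    integrableOn_shell ((continuousOn_slice hh t).mul
      (continuousOn_slice (contDiffOn_ang k (contDiffOn_ang k hf)) t))
  have i2 : ∀ k, IntegrableOn (fun y => ang k (ang k h) (t, y) * f (t, y)) shell := fun k =>
    integrableOn_shell ((continuousOn_slice (contDiffOn_ang k (contDiffOn_ang k hh)) t).mul
      (continuousOn_slice hf t))
  simp only [angLap, Finset.mul_sum, Finset.sum_mul]
  rw [integral_finsetSum _ fun k _ => i1 k, integral_finsetSum _ fun k _ => i2 k]
  refine Finset.sum_congr rfl fun k _ => ?_
  rw [integral_ang_mul k (contDiffOn_ang k hh) hf,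
    ← neg_eq_iff_eq_neg.2 (integral_ang_mul k hh (contDiffOn_ang k hf) t)]

/-- The angular function `⟨x, B ŷ⟩` of the direction `ŷ`, where `x` is normalized as well. -/
noncomputable def dirFun (x : E3) (B : E3 →L[ℝ] E3) (q : ℝ × E3) : ℝ :=
  inner ℝ x (B q.2) / (‖x‖ * ‖q.2‖)

lemma contDiffOn_dirFun {x : E3} (hx : x ≠ 0) (B : E3 →L[ℝ] E3) :
    ContDiffOn ℝ ∞ (dirFun x B) punctured := by
  have h1 : ContDiffOn ℝ ∞ (fun q : ℝ × E3 => ‖q.2‖) punctured :=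
    contDiff_snd.contDiffOn.norm ℝ fun q hq => hq
  refine ContDiffOn.div (ContDiff.contDiffOn ?_) (contDiffOn_const.mul h1) fun q hq => ?_
  · exact contDiff_const.inner ℝ (B.contDiff.comp contDiff_snd)
  · exact mul_ne_zero (norm_ne_zero_iff.2 hx) (norm_ne_zero_iff.2 hq)

lemma norm_rot (k : Fin 3) (t : ℝ) (y : E3) : ‖rot k t y‖ = ‖y‖ := by
  rw [← rotIso_apply, (rotIso k t).norm_map]

lemma ang_dirFun {x : E3} (hx : x ≠ 0) (B : E3 →L[ℝ] E3) (hp : p ∈ punctured) :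
    ang k (dirFun x B) p = dirFun x (B.comp (rotGen k)) p := by
  have h1 := hasDerivAt_comp_rot k (differentiableAt_of_punctured (contDiffOn_dirFun hx B) hp)
  have h2 : HasDerivAt (fun t => dirFun x B (p.1, rot k t p.2))
      (dirFun x (B.comp (rotGen k)) p) 0 := by
    simp only [dirFun, norm_rot]
    have h3 := B.hasFDerivAt.comp_hasDerivAt (0 : ℝ) (hasDerivAt_rot k p.2)
    have h4 := ((hasDerivAt_const (0 : ℝ) x).inner ℝ h3).div_const (‖x‖ * ‖p.2‖)
    simpa using h4
  exact h1.unique h2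

lemma sum_rotGen_rotGen (y : E3) : ∑ k, rotGen k (rotGen k y) = (-2 : ℝ) • y := by
  ext i
  simp only [Fin.sum_univ_three, rotGen_apply]
  fin_cases i <;> simp <;> ring

lemma sum_inner_rotGen_sq (x y : E3) :
    ∑ k, inner ℝ x (rotGen k y) ^ 2 = ‖x‖ ^ 2 * ‖y‖ ^ 2 - inner ℝ x y ^ 2 := by
  rw [← real_inner_self_eq_norm_sq, ← real_inner_self_eq_norm_sq]
  simp only [Fin.sum_univ_three, rotGen_apply, PiLp.inner_apply]
  simp
  ring

/-- Let L_k denote the rotation derivatives and z the cosine. The chain rule together with Σ (L_k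
z)² = 1 − z² and Σ L_k² z = −2z produces the Legendre operator. The bound a > 1 keeps all cosines
inside the region of smoothness. -/
lemma angLap_comp_cosAngle {a : ℝ} (ha : 1 < a) (hg : ∀ z < a, HasDerivAt g (g' z) z)
    (hg' : ∀ z < a, HasDerivAt g' (g'' z) z) (hgs : ContDiffOn ℝ ∞ g' (Set.Iio a)) {x : E3}
    (hx : x ≠ 0) (hp : p ∈ punctured) :
    angLap (fun q => g (cosAngle x q.2)) p =
      (1 - cosAngle x p.2 ^ 2) * g'' (cosAngle x p.2) -
        2 * cosAngle x p.2 * g' (cosAngle x p.2) := by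
  have hlt : ∀ q : ℝ × E3, cosAngle x q.2 < a := fun q => (cosAngle_mem _ _).2.trans_lt ha
  set I : E3 →L[ℝ] E3 := ContinuousLinearMap.id ℝ E3
  have hI : ∀ q, dirFun x I q = cosAngle x q.2 := fun q => rfl
  have hI' := contDiffOn_dirFun hx I
  have h1 : ∀ k, Set.EqOn (ang k fun q => g (cosAngle x q.2))
      (fun q => g' (dirFun x I q) * dirFun x (I.comp (rotGen k)) q) punctured := fun k q hq => by
    change _ = g' (dirFun x I q) * dirFun x (I.comp (rotGen k)) q
    rw [← ang_dirFun hx I hq]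
    exact ang_comp (hg _ (hlt q)) hI' hq
  have hs : ContDiffOn ℝ ∞ (fun q => g' (dirFun x I q)) punctured :=
    hgs.comp hI' fun q _ => hlt q
  have h2 : ∀ k, ang k (ang k fun q => g (cosAngle x q.2)) p =
      g'' (dirFun x I p) * dirFun x (I.comp (rotGen k)) p ^ 2 +
        g' (dirFun x I p) * dirFun x ((I.comp (rotGen k)).comp (rotGen k)) p := fun k => by
    rw [ang_congr (h1 k) hp, ang_mul hs (contDiffOn_dirFun hx _) hp,
      ang_comp (hg' _ (hlt p)) hI' hp, ang_dirFun hx _ hp, ang_dirFun hx _ hp]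
    ring
  have hx0 := norm_ne_zero_iff.2 hx
  have hy0 : ‖p.2‖ ≠ 0 := norm_ne_zero_iff.2 hp
  have s1 : ∑ k, dirFun x (I.comp (rotGen k)) p ^ 2 = 1 - cosAngle x p.2 ^ 2 := by
    simp only [dirFun, div_pow, ← Finset.sum_div]
    have := sum_inner_rotGen_sq x p.2
    simp only [I, ContinuousLinearMap.id_comp]
    rw [this, cosAngle]
    field_simp
  have s2 : ∑ k, dirFun x ((I.comp (rotGen k)).comp (rotGen k)) p = -2 * cosAngle x p.2 := by
    simp only [dirFun, ← Finset.sum_div, I, ContinuousLinearMap.id_comp,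
      ContinuousLinearMap.comp_apply]
    rw [← inner_sum, sum_rotGen_rotGen, real_inner_smul_right, cosAngle, mul_div_assoc]
  rw [angLap, Finset.sum_congr rfl fun k _ => h2 k, Finset.sum_add_distrib, ← Finset.mul_sum,
    ← Finset.mul_sum, s1, s2, hI]
  ring

/-- Green's formula for zonal kernels. -/
lemma zonal_angLap {a : ℝ} (ha : 1 < a) (hg : ∀ z < a, HasDerivAt g (g' z) z)
    (hg' : ∀ z < a, HasDerivAt g' (g'' z) z) (hgs : ContDiffOn ℝ ∞ g (Set.Iio a))
    (hgs' : ContDiffOn ℝ ∞ g' (Set.Iio a)) (hf : ContDiffOn ℝ ∞ f punctured)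
    (hp : p ∈ punctured) :
    zonal g (angLap f) p = zonal (fun z => (1 - z ^ 2) * g'' z - 2 * z * g' z) f p := by
  have hs : ContDiffOn ℝ ∞ (fun q : ℝ × E3 => g (cosAngle p.2 q.2)) punctured :=
    hgs.comp (contDiffOn_dirFun hp (ContinuousLinearMap.id ℝ E3))
      fun q _ => (cosAngle_mem _ _).2.trans_lt ha
  have := integral_mul_angLap hf hs p.1
  rw [zonal, zonal]
  refine this.trans (setIntegral_congr_fun measurableSet_shell fun y hy => ?_)
  have h2 := angLap_comp_cosAngle ha hg hg' hgs' hp (p := (p.1, y)) (ne_zero_of_mem_shell hy)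
  exact congrArg (· * f (p.1, y)) h2

end ZonalKernels

end UnitHyperboloid

namespace UnitHyperboloid

/-! ### The fundamental solution of Δ(Δ + 2) modulo degrees 0 and 1. -/

section FundamentalSolution

open MeasureTheory Filter Topology

variable {g g' : ℝ → ℝ} {f : ℝ × E3 → ℝ} {p : ℝ × E3}

/-- The fundamental solution of `Δ(Δ + 2)` on the sphere for `a = 1`, as a function of the cosine
of the angle, and its regularizations for `1 < a`. -/
noncomputable def greenKer (a z : ℝ) : ℝ := (a - z) * Real.log (a - z)

lemma continuous_greenKer : Continuous fun q : ℝ × ℝ => greenKer q.1 q.2 :=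
  Real.continuous_mul_log.comp (continuous_fst.sub continuous_snd)

lemma continuousOn_greenKer (a : ℝ) : ContinuousOn (greenKer a) (Set.Icc (-1) 1) :=
  (continuous_greenKer.comp (by fun_prop : Continuous fun z : ℝ => (a, z))).continuousOn

lemma zonal_kernel_congr (h : Set.EqOn g g' (Set.Icc (-1) 1)) (f : ℝ × E3 → ℝ) (p : ℝ × E3) :
    zonal g f p = zonal g' f p := by
  rw [zonal, zonal]
  congr 1
  funext y
  rw [h (cosAngle_mem p.2 y)]

/-- For a > 1 the kernel is smooth, so both operators can be moved onto it by Green's formula. The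
terms in z and 1 are multiples of the projections to degrees 1 and 0; the remaining kernel
concentrates at z = 1 as a → 1. -/
lemma zonal_greenKer_angLap {a : ℝ} (ha : 1 < a) (hf : ContDiffOn ℝ ∞ f punctured)
    (hp : p ∈ punctured) :
    zonal (greenKer a) (fun q => angLap (angLap f) q + 2 * angLap f q) p =
      zonal (fun z => 2 * (a ^ 2 - 1) ^ 2 / (a - z) ^ 3) f p - 6 * zonal (fun z => z) f p -
        2 * a * zonal (fun _ => 1) f p := by
  have hsub : ∀ z : ℝ, HasDerivAt (fun z => a - z) (-1) z := fun z => by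
    simpa using (hasDerivAt_id z).const_sub a
  have hne : ∀ z < a, a - z ≠ 0 := fun z hz => (sub_pos.2 hz).ne'
  have hlog : ∀ z < a, HasDerivAt (fun z => Real.log (a - z)) (-1 / (a - z)) z := fun z hz =>
    (hsub z).log (hne z hz)
  have hinv : ∀ z < a, HasDerivAt (fun z => (a - z)⁻¹) (1 / (a - z) ^ 2) z := fun z hz => by
    have := (hsub z).fun_inv (hne z hz)
    simpa using this
  have clog : ContDiffOn ℝ ∞ (fun z => Real.log (a - z)) (Set.Iio a) :=
    (contDiffOn_const.sub contDiffOn_id).log fun z hz => hne z hz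
  have cinv : ContDiffOn ℝ ∞ (fun z => (a - z)⁻¹) (Set.Iio a) :=
    (contDiffOn_const.sub contDiffOn_id).inv fun z hz => hne z hz
  have hIcc : ∀ z ∈ Set.Icc (-1 : ℝ) 1, z < a := fun z hz => hz.2.trans_lt ha
  have hL := contDiffOn_angLap hf
  have hLL := contDiffOn_angLap hL
  -- This is Δ + 2 applied to the kernel; applying Δ once more gives the final kernel.
  let H : ℝ → ℝ := fun z => 3 * z + a + (1 - a ^ 2) * (a - z)⁻¹ + 2 * a * Real.log (a - z)
  have cH : ContDiffOn ℝ ∞ H (Set.Iio a) := by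
    exact (((contDiffOn_const.mul contDiffOn_id).add contDiffOn_const).add
      (contDiffOn_const.mul cinv)).add (contDiffOn_const.mul clog)
  have g1 : ∀ z < a, HasDerivAt (greenKer a) (-Real.log (a - z) - 1) z := fun z hz => by
    refine ((hsub z).mul (hlog z hz)).congr_deriv ?_
    have := hne z hz
    field_simp
    ring
  have g2 : ∀ z < a, HasDerivAt (fun z => -Real.log (a - z) - 1) ((a - z)⁻¹) z := fun z hz => by
    refine ((hlog z hz).neg.sub_const 1).congr_deriv ?_
    have := hne z hz
    field_simp
  have h1 : ∀ z < a, HasDerivAt H (3 + (1 - a ^ 2) * (1 / (a - z) ^ 2) - 2 * a * (a - z)⁻¹) z :=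
      fun z hz => by
    refine (((((hasDerivAt_id z).const_mul 3).add_const a).add ((hinv z hz).const_mul _)).add
      ((hlog z hz).const_mul (2 * a))).congr_deriv ?_
    have := hne z hz
    field_simp
    ring
  have h2 : ∀ z < a, HasDerivAt (fun z => 3 + (1 - a ^ 2) * (1 / (a - z) ^ 2) - 2 * a * (a - z)⁻¹)
      (2 * (1 - a ^ 2) / (a - z) ^ 3 - 2 * a / (a - z) ^ 2) z := fun z hz => by
    have e : (fun z => 3 + (1 - a ^ 2) * (1 / (a - z) ^ 2) - 2 * a * (a - z)⁻¹) =
        fun z => 3 + (1 - a ^ 2) * (a - z)⁻¹ ^ 2 - 2 * a * (a - z)⁻¹ := by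
      funext z; rw [one_div, inv_pow]
    rw [e]
    refine (((((hinv z hz).fun_pow 2).const_mul (1 - a ^ 2)).const_add 3).sub
      ((hinv z hz).const_mul (2 * a))).congr_deriv ?_
    have := hne z hz
    simp
    field_simp
  have cG : ContDiffOn ℝ ∞ (greenKer a) (Set.Iio a) := (contDiffOn_const.sub contDiffOn_id).mul clog
  have cG' : ContDiffOn ℝ ∞ (fun z => -Real.log (a - z) - 1) (Set.Iio a) :=
    clog.neg.sub contDiffOn_const
  have cH' : ContDiffOn ℝ ∞ (fun z => 3 + (1 - a ^ 2) * (1 / (a - z) ^ 2) - 2 * a * (a - z)⁻¹)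
      (Set.Iio a) := by
    refine (contDiffOn_const.add (contDiffOn_const.mul ?_)).sub (contDiffOn_const.mul cinv)
    exact contDiffOn_const.div ((contDiffOn_const.sub contDiffOn_id).pow 2)
      fun z hz => pow_ne_zero _ (hne z hz)
  have hsubIcc : Set.Icc (-1 : ℝ) 1 ⊆ Set.Iio a := fun z hz => hIcc z hz
  have c1 : ContinuousOn (fun z => (1 - z ^ 2) * (a - z)⁻¹ - 2 * z * (-Real.log (a - z) - 1))
      (Set.Icc (-1) 1) := by
    have := cinv.continuousOn.mono hsubIcc
    have := clog.continuousOn.mono hsubIcc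
    fun_prop
  have cG2 : ContinuousOn (fun z => 2 * greenKer a z) (Set.Icc (-1) 1) :=
    continuousOn_const.mul (continuousOn_greenKer a)
  have cD : ContinuousOn (fun z => 2 * (a ^ 2 - 1) ^ 2 / (a - z) ^ 3) (Set.Icc (-1) 1) := by
    refine ContinuousOn.div (by fun_prop) (by fun_prop) fun z hz => ?_
    exact pow_ne_zero _ (hne z (hIcc z hz))
  rw [zonal_add (continuousOn_greenKer a) hLL (contDiffOn_const.mul hL) hp,
    zonal_timeFun_mul (fun _ => 2), zonal_angLap ha g1 g2 cG cG' hL hp, ← zonal_kernel_const_mul,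
    ← zonal_kernel_add c1 cG2 hL hp,
    zonal_kernel_congr (g' := H) (fun z hz => ?_), zonal_angLap ha h1 h2 cH cH' hf hp,
    zonal_kernel_congr
      (g' := fun z => 2 * (a ^ 2 - 1) ^ 2 / (a - z) ^ 3 + (-1) * (6 * z + 2 * a * 1))
      (fun z hz => ?_), zonal_kernel_add cD (by fun_prop) hf hp, zonal_kernel_const_mul,
    zonal_kernel_add (by fun_prop) (by fun_prop) hf hp, zonal_kernel_const_mul,
    zonal_kernel_const_mul]
  · ring
  · have := hne z (hIcc z hz)
    simp only
    field_simp
    ring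
  · have := hne z (hIcc z hz)
    simp only [H, greenKer]
    field_simp
    ring

/-- As t log t is continuous at 0, the kernel is jointly continuous up to a = z = 1. It is therefore
bounded on a compact set, and convergence is dominated. -/
lemma tendsto_zonal_greenKer (hf : ContDiffOn ℝ ∞ f punctured) (hp : p ∈ punctured) :
    Tendsto (fun a => zonal (greenKer a) f p) (𝓝[>] 1) (𝓝 (zonal (greenKer 1) f p)) := by
  have hcont : ContinuousOn (fun q : ℝ × E3 => greenKer q.1 (cosAngle p.2 q.2) * f (p.1, q.2))
      (Set.Icc 1 2 ×ˢ shell) := by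
    refine ContinuousOn.mul ?_ ((continuousOn_slice hf p.1).comp continuousOn_snd fun q hq => hq.2)
    refine continuous_greenKer.comp_continuousOn (continuousOn_fst.prodMk ?_)
    exact (continuousOn_cosAngle hp).comp continuousOn_snd fun q hq => ne_zero_of_mem_shell hq.2
  obtain ⟨C, hC⟩ := (isCompact_Icc.prod isCompact_shell).exists_bound_of_continuousOn hcont
  refine tendsto_integral_filter_of_dominated_convergence (fun _ => C) ?_ ?_
    (integrableOn_shell continuousOn_const) ?_
  · exact Eventually.of_forall fun a =>
      (integrableOn_zonal (continuousOn_greenKer a) hf hp p.1).aestronglyMeasurable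
  · filter_upwards [Ioo_mem_nhdsGT (one_lt_two (α := ℝ))] with a ha
    refine (ae_restrict_iff' measurableSet_shell).2 (Eventually.of_forall fun y hy => ?_)
    exact hC (a, y) ⟨⟨ha.1.le, ha.2.le⟩, hy⟩
  · refine Eventually.of_forall fun y => ?_
    have : Continuous fun a => greenKer a (cosAngle p.2 y) * f (p.1, y) :=
      (continuous_greenKer.comp (by fun_prop : Continuous fun a : ℝ => (a, cosAngle p.2 y))).mul
        continuous_const
    exact (this.tendsto 1).mono_left nhdsWithin_le_nhds

/-- Functions of the direction `y / ‖y‖`. -/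
def IsHom (f : ℝ × E3 → ℝ) : Prop :=
  ∀ p ∈ punctured, ∀ c : ℝ, 0 < c → f (p.1, c • p.2) = f p

lemma integral_cosAngle (x : E3) : ∫ y in shell, cosAngle x y = 0 := by
  have h := setIntegral_shell_comp (LinearIsometryEquiv.neg ℝ) (cosAngle x)
  have h2 : ∀ y, cosAngle x ((LinearIsometryEquiv.neg ℝ : E3 ≃ₗᵢ[ℝ] E3) y) = -cosAngle x y := by
    intro y
    simp [cosAngle, neg_div]
  simp only [h2, integral_neg] at h
  linarith

lemma ang_const (k : Fin 3) (c : ℝ) : ang k (fun _ => c) = fun _ => 0 := by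
  funext q
  simp [ang]

/-- Apply `zonal_greenKer_angLap` to the constant function 1: the left side vanishes, and the cosine
integrates to zero by the antipodal symmetry. -/
lemma integral_approxDelta {a : ℝ} (ha : 1 < a) {x : E3} (hx : x ≠ 0) :
    ∫ y in shell, 2 * (a ^ 2 - 1) ^ 2 / (a - cosAngle x y) ^ 3 = 2 * a * volume.real shell := by
  have h := zonal_greenKer_angLap (f := fun _ => 1) (p := (0, x)) ha contDiffOn_const hx
  have e : angLap (fun _ => (1 : ℝ)) = fun _ => 0 := by
    funext q
    simp [angLap, ang_const]
  have e2 : angLap (fun _ => (0 : ℝ)) = fun _ => 0 := by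
    funext q
    simp [angLap, ang_const]
  simp only [e, e2] at h
  simp [zonal, integral_cosAngle] at h
  linarith

lemma exists_cosAngle_close (hf : ContDiffOn ℝ ∞ f punctured) (hfh : IsHom f)
    (hp : p ∈ punctured) {η : ℝ} (hη : 0 < η) :
    ∃ δ > 0, ∀ y ∈ shell, 1 - δ < cosAngle p.2 y → ‖f (p.1, y) - f p‖ ≤ η := by
  have hx : 0 < ‖p.2‖ := norm_pos_iff.2 hp
  set b : E3 := ‖p.2‖⁻¹ • p.2 with hb
  have hb1 : ‖b‖ = 1 := by rw [hb, norm_smul, norm_inv, norm_norm, inv_mul_cancel₀ hx.ne']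
  have hbp : (p.1, b) ∈ punctured := by
    change b ≠ 0
    rw [← norm_ne_zero_iff, hb1]
    norm_num
  have hfb : f (p.1, b) = f p := hfh p hp _ (inv_pos.2 hx)
  have hc : ContinuousAt (fun y => f (p.1, y)) b :=
    ((hf.contDiffAt (isOpen_punctured.mem_nhds hbp)).continuousAt).comp (by fun_prop)
  obtain ⟨r, hr, hrf⟩ := Metric.continuousAt_iff.1 hc η hη
  -- The squared distance of two unit vectors is 2 minus twice the cosine of their angle.
  refine ⟨r ^ 2 / 2, by positivity, fun y hy hlt => ?_⟩
  have hy0 : 0 < ‖y‖ := norm_pos_iff.2 (ne_zero_of_mem_shell hy)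
  have hy1 : ‖(‖y‖⁻¹ • y : E3)‖ = 1 := by
    rw [norm_smul, norm_inv, norm_norm, inv_mul_cancel₀ hy0.ne']
  have hi : inner ℝ (‖y‖⁻¹ • y : E3) b = cosAngle p.2 y := by
    rw [hb, real_inner_smul_left, real_inner_smul_right, real_inner_comm, cosAngle]
    field_simp
  have hd : dist (‖y‖⁻¹ • y : E3) b < r := by
    rw [dist_eq_norm]
    refine lt_of_pow_lt_pow_left₀ 2 hr.le ?_
    rw [norm_sub_sq_real, hi, hy1, hb1]
    linarith
  have := hrf hd
  rw [hfb, hfh (p.1, y) (ne_zero_of_mem_shell hy) _ (inv_pos.2 hy0)] at this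
  exact this.le

/-- An approximate identity argument: the kernel is nonnegative, has total mass 2a·vol, and is at
most 2(a² − 1)²/δ³ where z ≤ 1 − δ. Homogeneity lets nearness in angle control the values of `f`. -/
lemma tendsto_zonal_approxDelta (hf : ContDiffOn ℝ ∞ f punctured) (hfh : IsHom f)
    (hp : p ∈ punctured) :
    Tendsto (fun a => zonal (fun z => 2 * (a ^ 2 - 1) ^ 2 / (a - z) ^ 3) f p) (𝓝[>] 1)
      (𝓝 (2 * volume.real shell * f p)) := by
  have hx : p.2 ≠ 0 := hp
  have hx0 : 0 < ‖p.2‖ := norm_pos_iff.2 hx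
  set v := volume.real shell
  have hv : 0 ≤ v := measureReal_nonneg
  rw [Metric.tendsto_nhds]
  intro ε hε
  -- The budget is at most 4vη from the near region, as a < 2, and η each from the far region and
  -- from replacing the mass 2a·vol by 2·vol.
  set η := ε / (4 * v + 2) with hη
  have hη0 : 0 < η := by positivity
  obtain ⟨M, hM⟩ := isCompact_shell.exists_bound_of_continuousOn
    ((continuousOn_slice hf p.1).sub (continuousOn_const (c := f p)))
  obtain ⟨δ, hδ, hclose⟩ := exists_cosAngle_close hf hfh hp hη0
  have hM0 : 0 ≤ |M| := abs_nonneg M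
  have hl1 : Tendsto (fun a : ℝ => 2 / δ ^ 3 * (a ^ 2 - 1) ^ 2 * |M| * v) (𝓝[>] 1) (𝓝 0) := by
    refine ((Continuous.tendsto (by fun_prop) 1).mono_left nhdsWithin_le_nhds).trans (by simp)
  have hl2 : Tendsto (fun a : ℝ => (a - 1) * |2 * v * f p|) (𝓝[>] 1) (𝓝 0) := by
    refine ((Continuous.tendsto (by fun_prop) 1).mono_left nhdsWithin_le_nhds).trans (by simp)
  filter_upwards [Ioo_mem_nhdsGT (one_lt_two (α := ℝ)), hl1.eventually_lt_const hη0,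
    hl2.eventually_lt_const hη0] with a ha h1 h2
  set D : E3 → ℝ := fun y => 2 * (a ^ 2 - 1) ^ 2 / (a - cosAngle p.2 y) ^ 3 with hD
  have hpos : ∀ y, 0 < a - cosAngle p.2 y := fun y => by
    linarith [(cosAngle_mem p.2 y).2, ha.1]
  have hDc : ContinuousOn D shell := by
    refine continuousOn_comp_cosAngle (g := fun z => 2 * (a ^ 2 - 1) ^ 2 / (a - z) ^ 3) ?_ hx
    refine ContinuousOn.div (by fun_prop) (by fun_prop) fun z hz => ?_
    have : 0 < a - z := by linarith [hz.2, ha.1]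
    positivity
  have hDint : ∫ y in shell, D y = 2 * a * v := integral_approxDelta ha.1 hx
  have hfc := continuousOn_slice hf p.1
  have e1 : zonal (fun z => 2 * (a ^ 2 - 1) ^ 2 / (a - z) ^ 3) f p - 2 * a * v * f p =
      ∫ y in shell, D y * (f (p.1, y) - f p) := by
    have i1 : IntegrableOn (fun y => D y * f (p.1, y)) shell := integrableOn_shell (hDc.mul hfc)
    have i2 : IntegrableOn (fun y => D y * f p) shell :=
      integrableOn_shell (hDc.mul continuousOn_const)
    simp only [mul_sub]
    rw [← hDint, ← integral_mul_const, integral_sub i1 i2]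
    rfl
  have e2 : |∫ y in shell, D y * (f (p.1, y) - f p)| ≤
      ∫ y in shell, (η * D y + 2 / δ ^ 3 * (a ^ 2 - 1) ^ 2 * |M|) := by
    rw [← Real.norm_eq_abs]
    refine norm_integral_le_of_norm_le (integrableOn_shell (by fun_prop))
      ((ae_restrict_iff' measurableSet_shell).2 (Eventually.of_forall fun y hy => ?_))
    have hD0 : 0 ≤ D y := div_nonneg (by positivity) (pow_nonneg (hpos y).le 3)
    rw [norm_mul, Real.norm_of_nonneg hD0]
    by_cases hc : 1 - δ < cosAngle p.2 y
    · have := hclose y hy hc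
      have h3 : D y * ‖f (p.1, y) - f p‖ ≤ D y * η := mul_le_mul_of_nonneg_left this hD0
      have h4 : 0 ≤ 2 / δ ^ 3 * (a ^ 2 - 1) ^ 2 * |M| := by positivity
      linarith
    · have h3 : δ ≤ a - cosAngle p.2 y := by linarith [ha.1, not_lt.1 hc]
      have h4 : D y ≤ 2 / δ ^ 3 * (a ^ 2 - 1) ^ 2 := by
        rw [div_mul_eq_mul_div]
        exact div_le_div_of_nonneg_left (by positivity) (by positivity)
          (pow_le_pow_left₀ hδ.le h3 3)
      have h5 : D y * ‖f (p.1, y) - f p‖ ≤ 2 / δ ^ 3 * (a ^ 2 - 1) ^ 2 * |M| :=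
        mul_le_mul h4 ((hM y hy).trans (le_abs_self M)) (norm_nonneg _) (by positivity)
      have h6 : 0 ≤ η * D y := by positivity
      linarith
  rw [integral_add (integrableOn_shell (by fun_prop)) (integrableOn_shell continuousOn_const),
    integral_const_mul, hDint, setIntegral_const, smul_eq_mul, ← e1] at e2
  have e3 : |2 * a * v * f p - 2 * v * f p| < η := by
    have : 2 * a * v * f p - 2 * v * f p = (a - 1) * (2 * v * f p) := by ring
    rw [this, abs_mul, abs_of_pos (by linarith [ha.1])]
    exact h2
  have e4 : η * (2 * a * v) ≤ η * (4 * v) := by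
    apply mul_le_mul_of_nonneg_left _ hη0.le
    nlinarith [ha.2]
  have e5 : η * (4 * v + 2) = ε := by rw [hη]; field_simp
  rw [Real.dist_eq]
  refine (abs_sub_le _ (2 * a * v * f p) _).trans_lt ?_
  have : volume.real shell = v := rfl
  linarith

/-- The fundamental solution inverts `Δ(Δ + 2)` up to the spherical harmonics of degree at most
one. -/
theorem zonal_greenKer_one (hf : ContDiffOn ℝ ∞ f punctured) (hfh : IsHom f)
    (hp : p ∈ punctured) :
    zonal (greenKer 1) (fun q => angLap (angLap f) q + 2 * angLap f q) p =
      2 * volume.real shell * f p - 6 * zonal (fun z => z) f p - 2 * zonal (fun _ => 1) f p := by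
  have hL := contDiffOn_angLap hf
  have h1 := tendsto_zonal_greenKer
    ((contDiffOn_angLap hL).add (contDiffOn_const (c := 2) |>.mul hL)) hp
  have h2 : Tendsto (fun a : ℝ => 2 * a * zonal (fun _ => 1) f p) (𝓝[>] 1)
      (𝓝 (2 * 1 * zonal (fun _ => 1) f p)) :=
    (Continuous.tendsto (by fun_prop) 1).mono_left nhdsWithin_le_nhds
  have h3 := ((tendsto_zonal_approxDelta hf hfh hp).sub_const (6 * zonal (fun z => z) f p)).sub h2
  rw [mul_one] at h3
  refine tendsto_nhds_unique (h1.congr' ?_) h3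
  filter_upwards [self_mem_nhdsWithin] with a ha
  exact zonal_greenKer_angLap ha hf hp

end FundamentalSolution

end UnitHyperboloid

namespace UnitHyperboloid

/-! ### Comparison of rotation derivatives with derivatives in (θ, φ). -/

section PolarCoordinates

open Real

/-- The point of `ℝ × S²` with the coordinates `(τ, θ, φ)`. -/
noncomputable def polar (u : Fin 3 → ℝ) : ℝ × E3 :=
  (u 0, !₂[sin (u 1) * cos (u 2), sin (u 1) * sin (u 2), cos (u 1)])

/-- The coordinate vectors of `polar`. -/
noncomputable def polarVec (i : Fin 3) (u : Fin 3 → ℝ) : ℝ × E3 :=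
  ![(1, 0), (0, !₂[cos (u 1) * cos (u 2), cos (u 1) * sin (u 2), -sin (u 1)]),
    (0, !₂[-(sin (u 1) * sin (u 2)), sin (u 1) * cos (u 2), 0])] i

lemma norm_polar (u : Fin 3 → ℝ) : ‖(polar u).2‖ = 1 := by
  have h1 := sin_sq_add_cos_sq (u 1)
  have h2 := sin_sq_add_cos_sq (u 2)
  refine (pow_left_inj₀ (norm_nonneg _) zero_le_one two_ne_zero).1 ?_
  rw [EuclideanSpace.norm_sq_eq, Fin.sum_univ_three]
  simp [polar]
  grind

lemma polar_mem (u : Fin 3 → ℝ) : polar u ∈ punctured := by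
  change (polar u).2 ≠ 0
  rw [← norm_ne_zero_iff, norm_polar]
  norm_num

lemma contDiff_polar : ContDiff ℝ ∞ polar := by
  refine ContDiff.prodMk (by fun_prop) (contDiff_euclidean.2 fun i => ?_)
  fin_cases i <;> simp <;> fun_prop

lemma pd_polar (i : Fin 3) (u : Fin 3 → ℝ) : pd i polar u = polarVec i u := by
  have hd := contDiff_polar.differentiable (by simp) u
  have h1 : (pd i polar u).1 = pd i (fun v => (polar v).1) u := by
    have := (hasFDerivAt_fst.comp u hd.hasFDerivAt).fderiv
    rw [pd, pd, show (fun v => (polar v).1) = Prod.fst ∘ polar from rfl, this]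
    rfl
  have h2 : ∀ j, (pd i polar u).2 j = pd i (fun v => (polar v).2 j) u := fun j => by
    have h := ((EuclideanSpace.proj j : E3 →L[ℝ] ℝ).comp
      (ContinuousLinearMap.snd ℝ ℝ E3)).hasFDerivAt.comp u hd.hasFDerivAt
    have := h.fderiv
    rw [pd, pd, show (fun v => (polar v).2 j) = ((EuclideanSpace.proj j : E3 →L[ℝ] ℝ).comp (ContinuousLinearMap.snd ℝ ℝ E3)) ∘ polar from rfl, this]
    rfl
  refine Prod.ext ?_ ?_
  · rw [h1]
    simp only [polar, pd_coord]
    fin_cases i <;> simp [polarVec]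
  · ext j
    rw [h2]
    fin_cases j <;> simp only [polar] <;> fin_cases i <;>
      simp (disch := fun_prop) [polarVec, pd_mul, pd_sin, pd_cos]

variable {f : ℝ × E3 → ℝ} {u : Fin 3 → ℝ}

lemma contDiffOn_comp_polar (hf : ContDiffOn ℝ ∞ f punctured) :
    ContDiff ℝ ∞ (fun v => f (polar v)) := by
  rw [← contDiffOn_univ]
  exact hf.comp contDiff_polar.contDiffOn fun v _ => polar_mem v

lemma pd_comp_polar (hf : ContDiffOn ℝ ∞ f punctured) (i : Fin 3) (u : Fin 3 → ℝ) :
    pd i (fun v => f (polar v)) u = fderiv ℝ f (polar u) (polarVec i u) := by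
  rw [← pd_polar]
  have := ((differentiableAt_of_punctured hf (polar_mem u)).hasFDerivAt.comp u
    (contDiff_polar.differentiable (by simp) u).hasFDerivAt).fderiv
  rw [pd, show (fun v => f (polar v)) = f ∘ polar from rfl, this]
  rfl

lemma pd_zero_comp_polar (hf : ContDiffOn ℝ ∞ f punctured) (u : Fin 3 → ℝ) :
    pd 0 (fun v => f (polar v)) u = dtau f (polar u) := by
  rw [pd_comp_polar hf]
  rfl

/-- The components of the generators of the rotations in the coordinates `(θ, φ)`. -/
noncomputable def angCoord (k : Fin 3) (h : (Fin 3 → ℝ) → ℝ) (u : Fin 3 → ℝ) : ℝ :=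
  ![-(sin (u 2) * pd 1 h u) - cos (u 1) / sin (u 1) * cos (u 2) * pd 2 h u,
    cos (u 2) * pd 1 h u - cos (u 1) / sin (u 1) * sin (u 2) * pd 2 h u,
    pd 2 h u] k

lemma ang_polar (hf : ContDiffOn ℝ ∞ f punctured) (hu : u ∈ sphDom) (k : Fin 3) :
    ang k f (polar u) = angCoord k (fun v => f (polar v)) u := by
  have hs := (sin_pos_of_mem hu).ne'
  have h1 := sin_sq_add_cos_sq (u 1)
  have h2 := sin_sq_add_cos_sq (u 2)
  have hv : ((0 : ℝ), rotGen k (polar u).2) =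
      ![-sin (u 2) • polarVec 1 u - (cos (u 1) / sin (u 1) * cos (u 2)) • polarVec 2 u,
        cos (u 2) • polarVec 1 u - (cos (u 1) / sin (u 1) * sin (u 2)) • polarVec 2 u,
        polarVec 2 u] k := by
    refine Prod.ext ?_ ?_
    · fin_cases k <;> simp [polarVec]
    · ext j
      fin_cases k <;> fin_cases j <;> simp [polarVec, polar, rotGen_apply] <;> field_simp <;> grind
  rw [ang, hv]
  fin_cases k <;> simp [angCoord, pd_comp_polar hf]

lemma sphLap_polar (hf : ContDiffOn ℝ ∞ f punctured) (hu : u ∈ sphDom) :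
    sphLap (fun v => f (polar v)) u = angLap f (polar u) := by
  have hs := (sin_pos_of_mem hu).ne'
  have h1 := sin_sq_add_cos_sq (u 1)
  have h2 := sin_sq_add_cos_sq (u 2)
  have hF := (contDiffOn_comp_polar hf).contDiffOn (s := sphDom)
  set F := fun v => f (polar v) with hFdef
  have hA : ∀ k, ang k (ang k f) (polar u) = angCoord k (angCoord k F) u := fun k => by
    rw [ang_polar (contDiffOn_ang k hf) hu]
    have := fun i => pd_congr_on (i := i) isOpen_sphDom
      (fun v hv => ang_polar hf hv k : Set.EqOn (fun v => ang k f (polar v)) (angCoord k F) _) hu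
    simp only [angCoord, this]
    rfl
  have diff : ∀ {h : (Fin 3 → ℝ) → ℝ}, ContDiffOn ℝ ∞ h sphDom → DifferentiableAt ℝ h u := fun hh =>
    (hh.contDiffAt (isOpen_sphDom.mem_nhds hu)).differentiableAt (by simp)
  have d1 := diff (contDiffOn_pd (i := 1) isOpen_sphDom hF)
  have d2 := diff (contDiffOn_pd (i := 2) isOpen_sphDom hF)
  have hc := pd_comm isOpen_sphDom hF hu 2 1
  simp only [angLap, Fin.sum_univ_three, hA, sphLap]
  have g0 : angCoord 0 F =
    fun v => -(sin (v 2) * pd 1 F v) - cos (v 1) / sin (v 1) * cos (v 2) * pd 2 F v := rfl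
  have g1 : angCoord 1 F =
    fun v => cos (v 2) * pd 1 F v - cos (v 1) / sin (v 1) * sin (v 2) * pd 2 F v := rfl
  have g2 : angCoord 2 F = pd 2 F := rfl
  rw [g0, g1, g2]
  simp only [angCoord]
  simp (disch := first | assumption | fun_prop (disch := assumption))
    [pd_mul, pd_sub, pd_div, pd_sin, pd_cos, pd_neg]
  rw [hc]
  field_simp
  grind

end PolarCoordinates

/-! ### Transfer between the hyperboloid and ℝ × S², and the wave equation there. -/

section Lift

/-- The function on `ℝ × S²` given by a function on the hyperboloid. -/
noncomputable def liftPt (p : ℝ × E3) : Fin 4 → ℝ :=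
  ![Real.sinh p.1, Real.cosh p.1 * (p.2 0 / ‖p.2‖), Real.cosh p.1 * (p.2 1 / ‖p.2‖),
    Real.cosh p.1 * (p.2 2 / ‖p.2‖)]

lemma liftPt_polar (u : Fin 3 → ℝ) : liftPt (polar u) = sph u := by
  rw [liftPt, norm_polar]
  funext i
  fin_cases i <;> simp [polar, sph] <;> ring

lemma liftPt_mem {p : ℝ × E3} (hp : p ∈ punctured) : liftPt p ∈ hyp := by
  have h0 : ‖p.2‖ ≠ 0 := norm_ne_zero_iff.2 hp
  have h1 : ‖p.2‖ ^ 2 = p.2 0 ^ 2 + p.2 1 ^ 2 + p.2 2 ^ 2 := by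
    rw [EuclideanSpace.norm_sq_eq, Fin.sum_univ_three]
    simp
  have h2 := Real.cosh_sq p.1
  simp only [hyp, mink, liftPt, Set.mem_ofPred_eq]
  simp
  field_simp
  linear_combination -(Real.cosh p.1 ^ 2) * h1 + ‖p.2‖ ^ 2 * h2

lemma contDiffOn_liftPt : ContDiffOn ℝ ∞ liftPt punctured := by
  rw [contDiffOn_pi]
  have hn : ContDiffOn ℝ ∞ (fun q : ℝ × E3 => ‖q.2‖) punctured :=
    contDiff_snd.contDiffOn.norm ℝ fun q hq => hq
  have hc : ∀ i : Fin 3, ContDiffOn ℝ ∞ (fun q : ℝ × E3 => Real.cosh q.1 * (q.2 i / ‖q.2‖))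
      punctured := fun i => by
    have h1 : ContDiff ℝ ∞ (fun q : ℝ × E3 => Real.cosh q.1) := Real.contDiff_cosh.comp contDiff_fst
    have h2 : ContDiff ℝ ∞ (fun q : ℝ × E3 => q.2 i) :=
      (EuclideanSpace.proj i : E3 →L[ℝ] ℝ).contDiff.comp contDiff_snd
    exact h1.contDiffOn.mul (h2.contDiffOn.div hn fun q hq => norm_ne_zero_iff.2 hq)
  have h0 : ContDiff ℝ ∞ (fun q : ℝ × E3 => Real.sinh q.1) := Real.contDiff_sinh.comp contDiff_fst
  intro i
  fin_cases i
  · exact h0.contDiffOn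
  · exact hc 0
  · exact hc 1
  · exact hc 2

lemma isHom_comp_liftPt (Φ : (Fin 4 → ℝ) → ℝ) : IsHom (fun p => Φ (liftPt p)) := by
  intro p hp c hc
  have h0 : ‖p.2‖ ≠ 0 := norm_ne_zero_iff.2 hp
  simp only [liftPt, norm_smul, Real.norm_of_nonneg hc.le, PiLp.smul_apply, smul_eq_mul,
    mul_div_mul_left _ _ hc.ne']

/-- The vectors of Minkowski space that are not parallel to the time axis. -/
def spatial : Set (Fin 4 → ℝ) := {x | !₂[x 1, x 2, x 3] ≠ (0 : E3)}

/-- The projection of Minkowski space to the pairs `(τ, y)`. -/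
noncomputable def sphPt (x : Fin 4 → ℝ) : ℝ × E3 :=
  (Real.arsinh (x 0), (√(1 + x 0 ^ 2))⁻¹ • !₂[x 1, x 2, x 3])

lemma contDiff_spatialPart : ContDiff ℝ ∞ (fun x : Fin 4 → ℝ => (!₂[x 1, x 2, x 3] : E3)) := by
  refine contDiff_euclidean.2 fun i => ?_
  fin_cases i <;> simp <;> fun_prop

lemma isOpen_spatial : IsOpen spatial := isOpen_ne_fun contDiff_spatialPart.continuous continuous_const

lemma contDiff_sphPt : ContDiff ℝ ∞ sphPt := by
  have h : ContDiff ℝ ∞ (fun x : Fin 4 → ℝ => √(1 + x 0 ^ 2)) :=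
    ContDiff.sqrt (by fun_prop) fun x => by positivity
  refine (Real.contDiff_arsinh.comp (by fun_prop)).prodMk ((h.inv fun x => ?_).smul
    contDiff_spatialPart)
  positivity

lemma sphPt_mem {x : Fin 4 → ℝ} (hx : x ∈ spatial) : sphPt x ∈ punctured := by
  have : √(1 + x 0 ^ 2) ≠ 0 := by positivity
  exact smul_ne_zero (inv_ne_zero this) hx

lemma hyp_subset_spatial : hyp ⊆ spatial := by
  intro x hx h
  have h1 : x 1 = 0 := by simpa using congrArg (fun y : E3 => y 0) h
  have h2 : x 2 = 0 := by simpa using congrArg (fun y : E3 => y 1) h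
  have h3 : x 3 = 0 := by simpa using congrArg (fun y : E3 => y 2) h
  have : mink x x = 1 := hx
  simp only [mink, h1, h2, h3] at this
  nlinarith [mul_self_nonneg (x 0)]

lemma sphPt_sph (u : Fin 3 → ℝ) : sphPt (sph u) = polar u := by
  have h : √(1 + Real.sinh (u 0) ^ 2) = Real.cosh (u 0) := by
    rw [add_comm, ← Real.cosh_sq, Real.sqrt_sq (Real.cosh_pos _).le]
  have hc := (Real.cosh_pos (u 0)).ne'
  refine Prod.ext ?_ ?_
  · simp [sphPt, sph, polar]
  · ext j
    fin_cases j <;> simp [sphPt, sph, polar, h] <;> field_simp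

lemma sphPt_liftPt (p : ℝ × E3) : sphPt (liftPt p) = (p.1, ‖p.2‖⁻¹ • p.2) := by
  have h : √(1 + Real.sinh p.1 ^ 2) = Real.cosh p.1 := by
    rw [add_comm, ← Real.cosh_sq, Real.sqrt_sq (Real.cosh_pos _).le]
  have hc := (Real.cosh_pos p.1).ne'
  refine Prod.ext ?_ ?_
  · simp [sphPt, liftPt]
  · ext j
    fin_cases j <;> simp [sphPt, liftPt, h] <;> field_simp

/-- Density of the chart covers the unit sphere, poles included, and homogeneity covers all other
radii. -/
lemma eq_zero_of_polar {Q : ℝ × E3 → ℝ} (hQ : ContinuousOn Q punctured) (hQh : IsHom Q)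
    (h0 : ∀ u ∈ sphDom, Q (polar u) = 0) {p : ℝ × E3} (hp : p ∈ punctured) : Q p = 0 := by
  have h := eq_zero_of_sph (q := fun x => Q (sphPt x)) isOpen_spatial
    (hQ.comp contDiff_sphPt.continuous.continuousOn fun x hx => sphPt_mem hx)
    (fun u hu _ => by rw [sphPt_sph]; exact h0 u hu) (liftPt_mem hp)
    (hyp_subset_spatial (liftPt_mem hp))
  rw [sphPt_liftPt, hQh p hp _ (inv_pos.2 (norm_pos_iff.2 hp))] at h
  exact h

variable {f : ℝ × E3 → ℝ}

lemma IsHom.fderiv_smul (hf : ContDiffOn ℝ ∞ f punctured) (hfh : IsHom f) {p : ℝ × E3}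
    (hp : p ∈ punctured) {c : ℝ} (hc : 0 < c) (s : ℝ) (v : E3) :
    fderiv ℝ f (p.1, c • p.2) (s, c • v) = fderiv ℝ f p (s, v) := by
  have hcp : (p.1, c • p.2) ∈ punctured := smul_ne_zero hc.ne' hp
  have hd := (differentiableAt_of_punctured hf hcp).hasFDerivAt
  let S : (ℝ × E3) →L[ℝ] (ℝ × E3) := (ContinuousLinearMap.id ℝ ℝ).prodMap (c • ContinuousLinearMap.id ℝ E3)
  have h1 : HasFDerivAt (f ∘ S) _ p := HasFDerivAt.comp p hd S.hasFDerivAt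
  have h2 : f ∘ S =ᶠ[nhds p] f := by
    filter_upwards [isOpen_punctured.mem_nhds hp] with q hq
    exact hfh q hq c hc
  have h3 := (h1.congr_of_eventuallyEq h2.symm).fderiv
  rw [h3]
  rfl

lemma IsHom.dtau (hf : ContDiffOn ℝ ∞ f punctured) (hfh : IsHom f) : IsHom (dtau f) :=
  fun p hp c hc => by
    have := hfh.fderiv_smul hf hp hc 1 0
    rwa [smul_zero] at this

lemma IsHom.ang (k : Fin 3) (hf : ContDiffOn ℝ ∞ f punctured) (hfh : IsHom f) : IsHom (ang k f) :=
  fun p hp c hc => by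
    have := hfh.fderiv_smul hf hp hc 0 (rotGen k p.2)
    rwa [← map_smul] at this

lemma IsHom.angLap (hf : ContDiffOn ℝ ∞ f punctured) (hfh : IsHom f) : IsHom (angLap f) :=
  fun p hp c hc => Finset.sum_congr rfl fun k _ =>
    (hfh.ang k hf).ang k (contDiffOn_ang k hf) p hp c hc

/-- The wave equation `□ f + 3 f = 0` on `ℝ × S²`. -/
def IsWave (f : ℝ × E3 → ℝ) : Prop := ∀ p ∈ punctured, dtau (dtau f) p =
  -2 * (Real.sinh p.1 / Real.cosh p.1) * dtau f p + (Real.cosh p.1 ^ 2)⁻¹ * angLap f p + 3 * f p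

lemma wave_sph {Φ : (Fin 3 → ℝ) → ℝ} {u : Fin 3 → ℝ} (hu : u ∈ sphDom)
    (h : box (metric sph) Φ u + 3 * Φ u = 0) : pd 0 (pd 0 Φ) u =
      -2 * (Real.sinh (u 0) / Real.cosh (u 0)) * pd 0 Φ u + sphLap Φ u / Real.cosh (u 0) ^ 2 +
        3 * Φ u := by
  rw [box_sph hu] at h
  rw [sphLap]
  linarith

lemma isWave_lift {Φ : (Fin 4 → ℝ) → ℝ} (hΦ : IsSolution Φ) :
    ContDiffOn ℝ ∞ (fun p => Φ (liftPt p)) punctured ∧ IsWave (fun p => Φ (liftPt p)) := by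
  have hsm : ContDiffOn ℝ ∞ (fun p => Φ (liftPt p)) punctured :=
    hΦ.1.comp contDiffOn_liftPt fun p hp => liftPt_mem hp
  refine ⟨hsm, fun p hp => ?_⟩
  have hh := isHom_comp_liftPt Φ
  set φ : ℝ × E3 → ℝ := fun p => Φ (liftPt p)
  have h1 := contDiffOn_dtau hsm
  have h2 := contDiffOn_dtau h1
  have h3 := contDiffOn_angLap hsm
  refine sub_eq_zero.1 (eq_zero_of_polar (Q := fun p => dtau (dtau φ) p -
    (-2 * (Real.sinh p.1 / Real.cosh p.1) * dtau φ p + (Real.cosh p.1 ^ 2)⁻¹ * angLap φ p +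
      3 * φ p)) ?_ ?_ ?_ hp)
  · have c0 := hsm.continuousOn
    have c1 := h1.continuousOn
    have c2 := h2.continuousOn
    have c3 := h3.continuousOn
    have hc : ∀ q ∈ punctured, Real.cosh q.1 ≠ 0 := fun q _ => (Real.cosh_pos _).ne'
    have hc2 : ∀ q ∈ punctured, Real.cosh q.1 ^ 2 ≠ 0 := fun q _ => pow_ne_zero _ (Real.cosh_pos _).ne'
    have e1 : Continuous fun q : ℝ × E3 => Real.sinh q.1 := Real.continuous_sinh.comp continuous_fst
    have e2 : Continuous fun q : ℝ × E3 => Real.cosh q.1 := Real.continuous_cosh.comp continuous_fst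
    exact c2.sub (((((e1.continuousOn.div e2.continuousOn hc).const_mul (-2)).mul c1).add
      (((e2.pow 2).continuousOn.inv₀ hc2).mul c3)).add (c0.const_mul 3))
  · intro q hq c hc
    simp only [hh q hq c hc, hh.dtau hsm q hq c hc, (hh.dtau hsm).dtau h1 q hq c hc,
      hh.angLap hsm q hq c hc]
  · intro u hu
    have hw := wave_sph hu (hΦ.2 _ _ isChart_sph u hu)
    have e0 : (fun v => Φ (sph v)) = fun v => φ (polar v) := by
      funext v
      simp only [φ, liftPt_polar]
    have e1 : pd 0 (fun v => φ (polar v)) = fun v => dtau φ (polar v) :=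
      funext fun v => pd_zero_comp_polar hsm v
    rw [e0, e1, pd_zero_comp_polar h1, sphLap_polar hsm hu] at hw
    have e2 : Φ (sph u) = φ (polar u) := congrFun e0 u
    rw [hw, e2]
    simp only [polar]
    ring

/-- The coefficients of the wave equation depend only on τ, and zonal operators commute with ∂_τ and
Δ. -/
lemma IsWave.zonal {g : ℝ → ℝ} (hg : ContinuousOn g (Set.Icc (-1) 1))
    (hf : ContDiffOn ℝ ∞ f punctured) (hw : IsWave f) : IsWave (zonal g f) := by
  intro p hp
  have h1 := contDiffOn_dtau hf
  have h3 := contDiffOn_angLap hf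
  have hc : ∀ x, Real.cosh x ≠ 0 := fun x => (Real.cosh_pos _).ne'
  have a1 : ContDiff ℝ ∞ fun x => -2 * (Real.sinh x / Real.cosh x) :=
    contDiff_const.mul (Real.contDiff_sinh.div Real.contDiff_cosh hc)
  have a2 : ContDiff ℝ ∞ fun x => (Real.cosh x ^ 2)⁻¹ :=
    (Real.contDiff_cosh.pow 2).inv fun x => pow_ne_zero _ (hc x)
  have s1 := contDiffOn_timeFun_mul a1 h1
  have s2 := contDiffOn_timeFun_mul a2 h3
  have s3 := contDiffOn_timeFun_mul (contDiff_const (c := (3 : ℝ))) hf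
  rw [dtau_congr (fun q hq => dtau_zonal hg hf hq) hp, dtau_zonal hg h1 hp, dtau_zonal hg hf hp,
    zonal_angLap_comm hg hf hp, zonal_congr hw, zonal_add hg (s1.add s2) s3 hp,
    zonal_add hg s1 s2 hp, zonal_timeFun_mul (fun x => -2 * (Real.sinh x / Real.cosh x)),
    zonal_timeFun_mul (fun x => (Real.cosh x ^ 2)⁻¹), zonal_timeFun_mul fun _ => 3]

end Lift

end UnitHyperboloid

namespace UnitHyperboloid

/-! ### Degrees 0 and 1: ordinary differential equations and the decomposition of Φ. -/

section LowModes

open Real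

/-- `F' = dF/dτ` and `F'' + 2 tanh τ F' = b F`. -/
def IsMode (b F F' : ℝ → ℝ) : Prop := ∀ x, HasDerivAt F (F' x) x ∧
  HasDerivAt F' (-2 * (sinh x / cosh x) * F' x + b x * F x) x

/-- Abel's identity: cosh² is the integrating factor of the damping term 2 tanh τ. -/
lemma IsMode.wronskian {b F F' u u' : ℝ → ℝ} (hF : IsMode b F F') (hu : IsMode b u u') (x : ℝ) :
    cosh x ^ 2 * (F x * u' x - F' x * u x) = F 0 * u' 0 - F' 0 * u 0 := by
  have hd : ∀ x, HasDerivAt (fun x => cosh x ^ 2 * (F x * u' x - F' x * u x)) 0 x := fun x => by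
    have hc := (cosh_pos x).ne'
    refine (((hasDerivAt_cosh x).fun_pow 2).fun_mul (((hF x).1.fun_mul (hu x).2).fun_sub
      ((hF x).2.fun_mul (hu x).1))).congr_deriv ?_
    simp
    field_simp
    ring
  have := is_const_of_deriv_eq_zero (fun x => (hd x).differentiableAt) (fun x => (hd x).deriv) x 0
  simpa using this

/-- Cramer's rule with the three conserved Wronskians; no uniqueness theorem for differential
equations is involved. -/
lemma IsMode.exists_eq_add {b F F' u u' v v' : ℝ → ℝ} (hF : IsMode b F F') (hu : IsMode b u u')
    (hv : IsMode b v v') (h0 : u 0 * v' 0 - u' 0 * v 0 ≠ 0) :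
    ∃ α β, ∀ x, F x = α * u x + β * v x := by
  set k := u 0 * v' 0 - u' 0 * v 0
  refine ⟨(F 0 * v' 0 - F' 0 * v 0) / k, -(F 0 * u' 0 - F' 0 * u 0) / k, fun x => ?_⟩
  have h1 := hF.wronskian hu x
  have h2 := hF.wronskian hv x
  have h3 : cosh x ^ 2 * (u x * v' x - u' x * v x) = k := hu.wronskian hv x
  rw [← h1, ← h2, eq_comm]
  field_simp
  rw [← h3]
  ring

lemma isMode_sinh : IsMode (fun _ => 3) sinh cosh := fun x => by
  have hc := (cosh_pos x).ne'
  refine ⟨hasDerivAt_sinh x, (hasDerivAt_cosh x).congr_deriv ?_⟩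
  field_simp
  ring

lemma isMode_cosh_two : IsMode (fun _ => 3) (fun x => cosh (2 * x) / cosh x)
    (fun x => 2 * sinh x + sinh x / cosh x ^ 2) := by
  have e : (fun x => cosh (2 * x) / cosh x) = fun x => 2 * cosh x - (cosh x)⁻¹ := by
    funext x
    have hc := (cosh_pos x).ne'
    have := cosh_sq x
    rw [cosh_two_mul]
    field_simp
    linarith
  rw [e]
  intro x
  have hc := (cosh_pos x).ne'
  have hq := cosh_sq x
  refine ⟨(((hasDerivAt_cosh x).const_mul 2).fun_sub ((hasDerivAt_cosh x).fun_inv hc)).congr_deriv ?_,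
    (((hasDerivAt_sinh x).const_mul 2).fun_add ((hasDerivAt_sinh x).fun_div
      ((hasDerivAt_cosh x).fun_pow 2) (pow_ne_zero _ hc))).congr_deriv ?_⟩
  · field_simp
    ring
  · simp
    field_simp
    grind

lemma isMode_cosh : IsMode (fun x => 3 - 2 * (cosh x ^ 2)⁻¹) cosh sinh := fun x => by
  have hc := (cosh_pos x).ne'
  have hq := cosh_sq x
  refine ⟨hasDerivAt_cosh x, (hasDerivAt_sinh x).congr_deriv ?_⟩
  field_simp
  grind

lemma isMode_radial : IsMode (fun x => 3 - 2 * (cosh x ^ 2)⁻¹)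
    (fun x => 2 * sinh x + sinh x / cosh x ^ 2)
    (fun x => 2 * cosh x + 2 / cosh x ^ 3 - 1 / cosh x) := fun x => by
  have hc := (cosh_pos x).ne'
  have hq := cosh_sq x
  have h3 := ((hasDerivAt_cosh x).fun_pow 3).fun_inv (pow_ne_zero 3 hc)
  have h1 := (hasDerivAt_cosh x).fun_inv hc
  refine ⟨(((hasDerivAt_sinh x).const_mul 2).fun_add ((hasDerivAt_sinh x).fun_div
      ((hasDerivAt_cosh x).fun_pow 2) (pow_ne_zero _ hc))).congr_deriv ?_, ?_⟩
  · simp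
    field_simp
    grind
  · simp only [div_eq_mul_inv, one_mul]
    refine ((((hasDerivAt_cosh x).const_mul 2).fun_add (h3.const_mul 2)).fun_sub h1).congr_deriv ?_
    simp
    field_simp
    grind

variable {f : ℝ × E3 → ℝ}

lemma hasDerivAt_time (hf : ContDiffOn ℝ ∞ f punctured) {x : E3} (hx : x ≠ 0) (t : ℝ) :
    HasDerivAt (fun t => f (t, x)) (dtau f (t, x)) t := by
  have h1 := (differentiableAt_of_punctured (p := (t, x)) hf hx).hasFDerivAt
  exact h1.comp_hasDerivAt t ((hasDerivAt_id t).prodMk (hasDerivAt_const t x))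

/-- Spherical harmonics which solve the wave equation. -/
lemma IsWave.isMode (hf : ContDiffOn ℝ ∞ f punctured) (hw : IsWave f) {x : E3} (hx : x ≠ 0) {l : ℝ}
    (hl : ∀ t, angLap f (t, x) = -l * f (t, x)) :
    IsMode (fun t => 3 - l * (cosh t ^ 2)⁻¹) (fun t => f (t, x)) (fun t => dtau f (t, x)) :=
  fun t => by
  refine ⟨hasDerivAt_time hf hx t, (hasDerivAt_time (contDiffOn_dtau hf) hx t).congr_deriv ?_⟩
  rw [hw (t, x) hx, hl]
  ring

lemma angLap_zonal_one (hf : ContDiffOn ℝ ∞ f punctured) {p : ℝ × E3} (hp : p ∈ punctured) :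
    angLap (zonal (fun _ => 1) f) p = -0 * zonal (fun _ => 1) f p := by
  rw [zonal_angLap_comm continuousOn_const hf hp, zonal_angLap (a := 2) (g' := fun _ => 0)
    (g'' := fun _ => 0) one_lt_two (fun z _ => hasDerivAt_const _ _)
    (fun z _ => hasDerivAt_const _ _) contDiffOn_const contDiffOn_const hf hp]
  simp [zonal]

lemma angLap_zonal_id (hf : ContDiffOn ℝ ∞ f punctured) {p : ℝ × E3} (hp : p ∈ punctured) :
    angLap (zonal (fun z => z) f) p = -2 * zonal (fun z => z) f p := by
  rw [zonal_angLap_comm (g := fun z => z) continuousOn_id hf hp,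
    zonal_angLap (g := fun z => z) (a := 2) (g' := fun _ => 1)
    (g'' := fun _ => 0) one_lt_two (fun z _ => hasDerivAt_id z)
    (fun z _ => hasDerivAt_const _ _) contDiffOn_id contDiffOn_const hf hp, ← zonal_kernel_const_mul]
  refine zonal_kernel_congr (fun z _ => ?_) f p
  ring

/-- For unit x the cosine of the angle is linear in x. The projection to degree 1 is therefore
determined by three functions of τ, its values at the basis vectors. -/
lemma zonal_id_eq_sum (hf : ContDiffOn ℝ ∞ f punctured) (t : ℝ) {x : E3} (hx : ‖x‖ = 1) :
    zonal (fun z => z) f (t, x) =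
      ∑ k, x k * zonal (fun z => z) f (t, EuclideanSpace.single k 1) := by
  have hi : ∀ k : Fin 3, MeasureTheory.IntegrableOn
      (fun y => cosAngle (EuclideanSpace.single k 1) y * f (t, y)) shell := fun k =>
    integrableOn_zonal (g := fun z => z) (p := (t, EuclideanSpace.single k 1)) continuousOn_id hf
      (by simp [punctured]) t
  simp only [zonal, ← MeasureTheory.integral_const_mul]
  rw [← MeasureTheory.integral_finsetSum _ fun k _ => (hi k).const_mul (x k)]
  congr 1
  funext y
  simp only [← mul_assoc, ← Finset.sum_mul]
  congr 1
  simp [cosAngle, hx, Fin.sum_univ_three, PiLp.inner_apply]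
  ring

lemma volume_shell_pos : 0 < MeasureTheory.volume.real shell := by
  have h1 : (interior shell).Nonempty := by
    refine ⟨EuclideanSpace.single 0 (3 / 2), mem_interior.2 ⟨{y | 1 < ‖y‖ ∧ ‖y‖ < 2}, ?_, ?_, ?_⟩⟩
    · exact fun y hy => ⟨hy.1.le, hy.2.le⟩
    · exact (isOpen_lt continuous_const continuous_norm).inter
        (isOpen_lt continuous_norm continuous_const)
    · simp
      norm_num
  have h2 : 0 < MeasureTheory.volume shell := MeasureTheory.Measure.measure_pos_of_nonempty_interior _ h1
  exact ENNReal.toReal_pos h2.ne' isCompact_shell.measure_lt_top.ne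

/-- Every solution is the sum of a function in the range of `Δ(Δ + 2)` and of the explicit
solutions built from spherical harmonics of degree at most one. -/
theorem exists_decomposition {Φ : (Fin 4 → ℝ) → ℝ} (hΦ : IsSolution Φ) :
    ∃ w : ℝ × E3 → ℝ, ContDiffOn ℝ ∞ w punctured ∧ IsWave w ∧ ∃ N c : Fin 4 → ℝ,
      ∀ u, Φ (sph u) = angLap (angLap w) (polar u) + 2 * angLap w (polar u) +
        ∑ μ, N μ * zetaHat μ u + ∑ μ, c μ * zeta μ u := by
  obtain ⟨hf, hw⟩ := isWave_lift hΦ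
  have hh := isHom_comp_liftPt Φ
  set f : ℝ × E3 → ℝ := fun p => Φ (liftPt p)
  set v := MeasureTheory.volume.real shell
  have hv : v ≠ 0 := volume_shell_pos.ne'
  have hG := continuousOn_greenKer 1
  have hGc : ContinuousOn (fun z => (2 * v)⁻¹ * greenKer 1 z) (Set.Icc (-1) 1) :=
    continuousOn_const.mul hG
  have hLf := contDiffOn_angLap hf
  have hcid : ContinuousOn (fun z : ℝ => z) (Set.Icc (-1) 1) := continuousOn_id
  have hcone : ContinuousOn (fun _ : ℝ => (1 : ℝ)) (Set.Icc (-1) 1) := continuousOn_const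
  refine ⟨zonal (fun z => (2 * v)⁻¹ * greenKer 1 z) f, contDiffOn_zonal hGc hf, hw.zonal hGc hf, ?_⟩
  -- `zonal_greenKer_one` divided by 2v; the factors 3/v and 1/v are 6/(2v) and 2/(2v).
  have key : ∀ p ∈ punctured, f p = angLap (angLap (zonal (fun z => (2 * v)⁻¹ * greenKer 1 z) f)) p +
      2 * angLap (zonal (fun z => (2 * v)⁻¹ * greenKer 1 z) f) p + 3 / v * zonal (fun z => z) f p +
        1 / v * zonal (fun _ => 1) f p := fun p hp => by
    have h1 := zonal_greenKer_one hf hh hp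
    rw [zonal_add hG (contDiffOn_angLap hLf) (contDiffOn_const.mul hLf) hp,
      zonal_timeFun_mul fun _ => 2] at h1
    rw [angLap_congr (fun q hq => zonal_angLap_comm hGc hf hq) hp, zonal_angLap_comm hGc hLf hp,
      zonal_angLap_comm hGc hf hp, zonal_kernel_const_mul, zonal_kernel_const_mul]
    have h2 : zonal (greenKer 1) (angLap (angLap f)) p = 2 * v * f p - 6 * zonal (fun z => z) f p -
        2 * zonal (fun _ => 1) f p - 2 * zonal (greenKer 1) (angLap f) p := by linarith
    rw [h2]
    field_simp
    ring
  have he : ∀ k : Fin 3, (EuclideanSpace.single k 1 : E3) ≠ 0 := fun k => by simp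
  have m0 := (hw.zonal hcone hf).isMode (contDiffOn_zonal hcone hf) (he 0)
    (fun t => angLap_zonal_one hf (he 0))
  simp only [zero_mul, sub_zero] at m0
  obtain ⟨α, β, h0⟩ := m0.exists_eq_add isMode_sinh isMode_cosh_two (by simp)
  have m1 := fun k => (hw.zonal hcid hf).isMode (contDiffOn_zonal hcid hf) (he k)
    (fun t => angLap_zonal_id hf (he k))
  choose a b h1 using fun k => (m1 k).exists_eq_add isMode_cosh isMode_radial (by norm_num)
  -- The labels 1, 2, 3 of the scalars belong to the third, first and second axis in this order, and
  -- ζ_(0) = −sinh τ accounts for the sign of α.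
  refine ⟨![β / v, 3 / v * b 2, 3 / v * b 0, 3 / v * b 1],
    ![-α / v, 3 / v * a 2, 3 / v * a 0, 3 / v * a 1], fun u => ?_⟩
  have e0 : Φ (sph u) = f (polar u) := by simp only [f, liftPt_polar]
  have e1 : zonal (fun _ => 1) f (polar u) = α * sinh (u 0) + β * (cosh (2 * u 0) / cosh (u 0)) := by
    rw [← h0]
    simp [zonal, polar]
  have e2 : zonal (fun z => z) f (polar u) = ∑ k, (polar u).2 k *
      (a k * cosh (u 0) + b k * (2 * sinh (u 0) + sinh (u 0) / cosh (u 0) ^ 2)) := by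
    have := zonal_id_eq_sum hf (u 0) (norm_polar u)
    simp only [h1] at this
    exact this
  have hc := (cosh_pos (u 0)).ne'
  rw [e0, key _ (polar_mem u), e1, e2]
  simp [Fin.sum_univ_three, Fin.sum_univ_four, zeta, zetaHat, polar, tanh_eq_sinh_div_cosh]
  field_simp
  ring

end LowModes

end UnitHyperboloid

namespace UnitHyperboloid

/-! ### Symmetric products of differentials as ambient tensor fields. -/

section SymmetricForms

open Real

/-- The field of symmetric bilinear forms `C (dF ⊗ dG + dG ⊗ dF)`. -/
noncomputable def symForm (C F G : ℝ × E3 → ℝ) (x : Fin 4 → ℝ) (i j : Fin 4) : ℝ :=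
  C (sphPt x) * (fderiv ℝ (fun z => F (sphPt z)) x (Pi.single i 1) *
    fderiv ℝ (fun z => G (sphPt z)) x (Pi.single j 1) +
    fderiv ℝ (fun z => G (sphPt z)) x (Pi.single i 1) *
    fderiv ℝ (fun z => F (sphPt z)) x (Pi.single j 1))

lemma sum_mul_apply_single (L : (Fin 4 → ℝ) →L[ℝ] ℝ) (v : Fin 4 → ℝ) :
    ∑ i, L (Pi.single i 1) * v i = L v := by
  have hv : v = ∑ i, v i • (Pi.single i 1 : Fin 4 → ℝ) := by
    funext k; simp [Pi.single_apply]
  conv_rhs => rw [hv]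
  simp only [map_sum, map_smul, smul_eq_mul, mul_comm]

lemma fderiv_sphPt_pd_sph {F : ℝ × E3 → ℝ} {u : Fin 3 → ℝ} (hF : DifferentiableAt ℝ F (polar u))
    (a : Fin 3) : fderiv ℝ (fun z => F (sphPt z)) (sph u) (pd a sph u) =
      pd a (fun v => F (polar v)) u := by
  have h1 : DifferentiableAt ℝ (fun z => F (sphPt z)) (sph u) := by
    refine DifferentiableAt.comp (sph u) ?_ (contDiff_sphPt.differentiable (by simp) _)
    rw [sphPt_sph]
    exact hF
  have h2 := (h1.hasFDerivAt.comp u (contDiff_sph.differentiable (by simp) u).hasFDerivAt).fderiv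
  have h3 : (fun z => F (sphPt z)) ∘ sph = fun v => F (polar v) := by
    funext v
    simp only [Function.comp_apply, sphPt_sph]
  rw [h3] at h2
  rw [pd, pd, h2]
  rfl

lemma comps_symForm {C F G : ℝ × E3 → ℝ} {u : Fin 3 → ℝ} (hF : DifferentiableAt ℝ F (polar u))
    (hG : DifferentiableAt ℝ G (polar u)) (a b : Fin 3) :
    comps sph (symForm C F G) u a b = C (polar u) *
      (pd a (fun v => F (polar v)) u * pd b (fun v => G (polar v)) u +
        pd a (fun v => G (polar v)) u * pd b (fun v => F (polar v)) u) := by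
  rw [← fderiv_sphPt_pd_sph hF a, ← fderiv_sphPt_pd_sph hF b, ← fderiv_sphPt_pd_sph hG a,
    ← fderiv_sphPt_pd_sph hG b, ← sphPt_sph]
  set LF := fderiv ℝ (fun z => F (sphPt z)) (sph u)
  set LG := fderiv ℝ (fun z => G (sphPt z)) (sph u)
  rw [← sum_mul_apply_single LF (pd a sph u), ← sum_mul_apply_single LF (pd b sph u),
    ← sum_mul_apply_single LG (pd a sph u), ← sum_mul_apply_single LG (pd b sph u)]
  simp only [comps, symForm, Matrix.of_apply]
  rw [Finset.sum_mul_sum, Finset.sum_mul_sum, ← Finset.sum_add_distrib, Finset.mul_sum]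
  refine Finset.sum_congr rfl fun i _ => ?_
  rw [← Finset.sum_add_distrib, Finset.mul_sum]
  exact Finset.sum_congr rfl fun j _ => by ring

lemma contDiffOn_symForm {C F G : ℝ × E3 → ℝ} {W : Set (Fin 4 → ℝ)} (hW : IsOpen W)
    (hC : ContDiffOn ℝ ∞ (fun x => C (sphPt x)) W) (hF : ContDiffOn ℝ ∞ (fun x => F (sphPt x)) W)
    (hG : ContDiffOn ℝ ∞ (fun x => G (sphPt x)) W) : ContDiffOn ℝ ∞ (symForm C F G) W := by
  rw [contDiffOn_pi]; intro i
  rw [contDiffOn_pi]; intro j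
  have h : ∀ {H : (Fin 4 → ℝ) → ℝ}, ContDiffOn ℝ ∞ H W → ∀ i : Fin 4,
      ContDiffOn ℝ ∞ (fun x => fderiv ℝ H x (Pi.single i 1)) W := fun hH i =>
    (hH.fderiv_of_isOpen hW (by simp)).clm_apply contDiffOn_const
  exact hC.mul (((h hF i).mul (h hG j)).add ((h hG i).mul (h hF j)))

lemma comps_add (X : (Fin 3 → ℝ) → Fin 4 → ℝ) (A B : (Fin 4 → ℝ) → Fin 4 → Fin 4 → ℝ)
    (u : Fin 3 → ℝ) : comps X (fun x => A x + B x) u = comps X A u + comps X B u := by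
  ext a b
  simp [comps, add_mul, Finset.sum_add_distrib]

lemma comps_smul (X : (Fin 3 → ℝ) → Fin 4 → ℝ) (c : ℝ) (A : (Fin 4 → ℝ) → Fin 4 → Fin 4 → ℝ)
    (u : Fin 3 → ℝ) : comps X (fun x => c • A x) u = c • comps X A u := by
  ext a b
  simp [comps, Finset.mul_sum, mul_assoc]

lemma comps_sum (X : (Fin 3 → ℝ) → Fin 4 → ℝ) {ι : Type*} (s : Finset ι)
    (A : ι → (Fin 4 → ℝ) → Fin 4 → Fin 4 → ℝ) (u : Fin 3 → ℝ) :
    comps X (fun x => ∑ k ∈ s, A k x) u = ∑ k ∈ s, comps X (A k) u := by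
  classical
  induction s using Finset.induction_on with
  | empty =>
    ext a b
    simp [comps]
  | insert k s hk ih =>
    simp only [Finset.sum_insert hk]
    rw [comps_add, ih]

end SymmetricForms

/-! ### A globally smooth tensor field that realizes the odd ansatz. -/

section RegularField

open Real

lemma contDiffOn_comp_sphPt {F : ℝ × E3 → ℝ} (hF : ContDiffOn ℝ ∞ F punctured) :
    ContDiffOn ℝ ∞ (fun x => F (sphPt x)) spatial :=
  hF.comp contDiff_sphPt.contDiffOn fun _ hx => sphPt_mem hx

/-- The tensor field whose `τ` components are the dual of the angular derivative of `ψ` and whose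
angular components are the dual of the trace-free angular Hessian of `χ`. -/
noncomputable def oddField (ψ χ : ℝ × E3 → ℝ) (x : Fin 4 → ℝ) : Fin 4 → Fin 4 → ℝ :=
  ∑ k : Fin 3, (symForm (fun q => ang k ψ q - 1 / 2 * dtau (ang k χ) q) (fun q => q.1)
    (fun q => q.2 k) x + symForm (fun _ => 1 / 2) (ang k χ) (fun q => q.2 k) x)

variable {ψ χ : ℝ × E3 → ℝ}

lemma contDiff_coord (k : Fin 3) : ContDiff ℝ ∞ (fun q : ℝ × E3 => q.2 k) :=
  (EuclideanSpace.proj k : E3 →L[ℝ] ℝ).contDiff.comp contDiff_snd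

lemma contDiffOn_oddField (hψ : ContDiffOn ℝ ∞ ψ punctured) (hχ : ContDiffOn ℝ ∞ χ punctured) :
    ContDiffOn ℝ ∞ (oddField ψ χ) spatial := by
  refine ContDiffOn.sum fun k _ => ?_
  have h1 := contDiffOn_ang k hψ
  have h2 := contDiffOn_ang k hχ
  have h3 := contDiffOn_dtau h2
  have hk := contDiffOn_comp_sphPt (contDiff_coord k).contDiffOn
  exact (contDiffOn_symForm isOpen_spatial (contDiffOn_comp_sphPt (h1.sub (contDiffOn_const.mul h3)))
    (contDiffOn_comp_sphPt contDiff_fst.contDiffOn) hk).add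
    (contDiffOn_symForm isOpen_spatial contDiffOn_const (contDiffOn_comp_sphPt h2) hk)

lemma pd_polar_coord (k a : Fin 3) (u : Fin 3 → ℝ) :
    pd a (fun v => (polar v).2 k) u = (polarVec a u).2 k := by
  rw [pd_comp_polar (f := fun q => q.2 k) (contDiff_coord k).contDiffOn]
  have : HasFDerivAt (fun q : ℝ × E3 => q.2 k) ((EuclideanSpace.proj k : E3 →L[ℝ] ℝ).comp
      (ContinuousLinearMap.snd ℝ ℝ E3)) (polar u) :=
    (EuclideanSpace.proj k : E3 →L[ℝ] ℝ).hasFDerivAt.comp _ hasFDerivAt_snd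
  rw [this.fderiv]
  rfl

/-- With rotation derivatives L_k, the sum Σ L_kψ dy_k is the one-form y × ∇ψ, the dual of dψ on the
sphere. Likewise the symmetrized angular part of Σ d(L_kχ) ⊗ dy_k is the dual of the trace-free
Hessian of χ. The term −½ ∂_τ L_kχ cancels the dτ part of d(L_kχ). -/
lemma comps_oddField (hψ : ContDiffOn ℝ ∞ ψ punctured) (hχ : ContDiffOn ℝ ∞ χ punctured)
    {u : Fin 3 → ℝ} (hu : u ∈ sphDom) : comps sph (oddField ψ χ) u =
      oddTensor (fun i v => pd i (fun v => ψ (polar v)) v) (fun v => χ (polar v)) u := by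
  have hs := (sin_pos_of_mem hu).ne'
  have e1 := sin_sq_add_cos_sq (u 1)
  have e2 := sin_sq_add_cos_sq (u 2)
  have hX := (contDiffOn_comp_polar hχ).contDiffOn (s := sphDom)
  have hp := polar_mem u
  have h1 : ∀ k, DifferentiableAt ℝ (ang k χ) (polar u) := fun k =>
    differentiableAt_of_punctured (contDiffOn_ang k hχ) hp
  have h2 : ∀ k, DifferentiableAt ℝ (fun q : ℝ × E3 => q.2 k) (polar u) := fun k =>
    (contDiff_coord k).differentiable (by simp) _
  have h3 : DifferentiableAt ℝ (fun q : ℝ × E3 => q.1) (polar u) := differentiableAt_fst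
  have h4 : ∀ a k, a ≠ 0 → pd a (fun v => ang k χ (polar v)) u =
      pd a (angCoord k fun v => χ (polar v)) u := fun a k _ =>
    pd_congr_on isOpen_sphDom (fun v hv => ang_polar hχ hv k) hu
  have h5 : ∀ k, pd 0 (fun v => ang k χ (polar v)) u = dtau (ang k χ) (polar u) := fun k =>
    pd_zero_comp_polar (contDiffOn_ang k hχ) u
  have h6 : ∀ a, pd a (fun v => (polar v).1) u = if a = 0 then 1 else 0 := fun a => by
    simp only [polar, pd_coord, eq_comm]
  set X := fun v => χ (polar v)
  have diff : ∀ {h : (Fin 3 → ℝ) → ℝ}, ContDiffOn ℝ ∞ h sphDom → DifferentiableAt ℝ h u := fun hh =>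
    (hh.contDiffAt (isOpen_sphDom.mem_nhds hu)).differentiableAt (by simp)
  have d1 := diff (contDiffOn_pd (i := 1) isOpen_sphDom hX)
  have d2 := diff (contDiffOn_pd (i := 2) isOpen_sphDom hX)
  have hc := pd_comm isOpen_sphDom hX hu 2 1
  have g0 : angCoord 0 X =
    fun v => -(sin (v 2) * pd 1 X v) - cos (v 1) / sin (v 1) * cos (v 2) * pd 2 X v := rfl
  have g1 : angCoord 1 X =
    fun v => cos (v 2) * pd 1 X v - cos (v 1) / sin (v 1) * sin (v 2) * pd 2 X v := rfl
  have g2 : angCoord 2 X = pd 2 X := rfl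
  ext a b
  unfold oddField
  rw [comps_sum]
  simp only [comps_add, Fin.sum_univ_three, Matrix.add_apply, comps_symForm h3 (h2 _),
    comps_symForm (h1 _) (h2 _), ang_polar hψ hu, pd_polar_coord, h6, oddTensor]
  fin_cases a <;> fin_cases b <;>
    simp [h5, h4, polarVec, angCoord] <;> try simp only [g0, g1, g2]
  all_goals try simp (disch := first | assumption | fun_prop (disch := assumption))
    [pd_mul, pd_sub, pd_div, pd_sin, pd_cos, pd_neg]
  all_goals try rw [hc]
  all_goals try field_simp
  all_goals grind

end RegularField

end UnitHyperboloid

namespace UnitHyperboloid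

/-! ### Explicit V and χ for solutions in the range of Δ(Δ + 2). -/

section RegularSolutions

open Real

/-- The operator `Δ + 2` on the sphere. -/
noncomputable def angShift (f : ℝ × E3 → ℝ) (p : ℝ × E3) : ℝ := angLap f p + 2 * f p

variable {f g w : ℝ × E3 → ℝ} {p : ℝ × E3}

lemma contDiffOn_angShift (hf : ContDiffOn ℝ ∞ f punctured) :
    ContDiffOn ℝ ∞ (angShift f) punctured :=
  (contDiffOn_angLap hf).add (contDiffOn_const.mul hf)

lemma angShift_congr (h : Set.EqOn f g punctured) (hp : p ∈ punctured) :
    angShift f p = angShift g p := by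
  rw [angShift, angShift, angLap_congr h hp, h hp]

lemma angShift_add (hf : ContDiffOn ℝ ∞ f punctured) (hg : ContDiffOn ℝ ∞ g punctured)
    (hp : p ∈ punctured) : angShift (fun q => f q + g q) p = angShift f p + angShift g p := by
  rw [angShift, angShift, angShift, angLap_add hf hg hp]
  ring

lemma angShift_timeFun_mul {a : ℝ → ℝ} (ha : ContDiff ℝ ∞ a) (hf : ContDiffOn ℝ ∞ f punctured)
    (hp : p ∈ punctured) : angShift (fun q => a q.1 * f q) p = a p.1 * angShift f p := by
  rw [angShift, angShift, angLap_timeFun_mul ha hf hp]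
  ring

lemma dtau_angShift (hf : ContDiffOn ℝ ∞ f punctured) (hp : p ∈ punctured) :
    dtau (angShift f) p = angShift (dtau f) p := by
  have h2 : dtau (fun q => 2 * f q) p = 2 * dtau f p := by
    rw [dtau_timeFun_mul (a := fun _ => 2) (hasDerivAt_const _ _) hf hp]
    ring
  have h1 : dtau (angShift f) p = dtau (angLap f) p + dtau (fun q => 2 * f q) p :=
    dtau_add (contDiffOn_angLap hf) (contDiffOn_const.mul hf) hp
  rw [h1, h2, dtau_angLap hf hp, angShift]

lemma angLap_angShift (hf : ContDiffOn ℝ ∞ f punctured) (hp : p ∈ punctured) :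
    angLap (angShift f) p = angShift (angLap f) p := by
  have h1 : angLap (angShift f) p = angLap (angLap f) p + angLap (fun q => 2 * f q) p :=
    angLap_add (contDiffOn_angLap hf) (contDiffOn_const.mul hf) hp
  rw [h1, angLap_timeFun_mul (a := fun _ => 2) contDiff_const hf hp, angShift]

lemma contDiff_neg_two_tanh : ContDiff ℝ ∞ fun x => -2 * (sinh x / cosh x) :=
  contDiff_const.mul (contDiff_sinh.div contDiff_cosh fun x => (cosh_pos x).ne')

lemma contDiff_inv_cosh_sq : ContDiff ℝ ∞ fun x => (cosh x ^ 2)⁻¹ :=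
  (contDiff_cosh.pow 2).inv fun x => pow_ne_zero _ (cosh_pos x).ne'

lemma angLap_dtau_dtau (hf : ContDiffOn ℝ ∞ f punctured) (hw : IsWave f) (hp : p ∈ punctured) :
    angLap (dtau (dtau f)) p = -2 * (sinh p.1 / cosh p.1) * angLap (dtau f) p +
      (cosh p.1 ^ 2)⁻¹ * angLap (angLap f) p + 3 * angLap f p := by
  have h1 := contDiffOn_dtau hf
  have h2 := contDiffOn_angLap hf
  have s1 := contDiffOn_timeFun_mul contDiff_neg_two_tanh h1
  have s2 := contDiffOn_timeFun_mul contDiff_inv_cosh_sq h2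
  have s3 := contDiffOn_timeFun_mul (contDiff_const (c := (3 : ℝ))) hf
  rw [angLap_congr hw hp, angLap_add (s1.add s2) s3 hp, angLap_add s1 s2 hp,
    angLap_timeFun_mul contDiff_neg_two_tanh h1 hp, angLap_timeFun_mul contDiff_inv_cosh_sq h2 hp,
    angLap_timeFun_mul contDiff_const hf hp]

lemma IsWave.angLap (hf : ContDiffOn ℝ ∞ f punctured) (hw : IsWave f) : IsWave (angLap f) := by
  intro p hp
  rw [dtau_congr (fun r hr => dtau_angLap hf hr) hp, dtau_angLap (contDiffOn_dtau hf) hp,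
    angLap_dtau_dtau hf hw hp, dtau_angLap hf hp]

lemma IsWave.angShift (hf : ContDiffOn ℝ ∞ f punctured) (hw : IsWave f) : IsWave (angShift f) := by
  intro p hp
  rw [dtau_congr (fun r hr => dtau_angShift hf hr) hp, dtau_angShift (contDiffOn_dtau hf) hp,
    UnitHyperboloid.angShift, angLap_dtau_dtau hf hw hp, hw p hp, dtau_angShift hf hp,
    angLap_angShift hf hp, UnitHyperboloid.angShift, UnitHyperboloid.angShift,
    UnitHyperboloid.angShift]
  ring

/-- The solution `c² w - c s ∂_τ w` of `Δ V₀ = c² Δ w - c s ∂_τ Δ w`. -/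
noncomputable def potV₀ (w : ℝ × E3 → ℝ) (p : ℝ × E3) : ℝ :=
  cosh p.1 ^ 2 * w p + -(cosh p.1 * sinh p.1) * dtau w p

/-- The scalar potential of the angular part of the regular tensor. -/
noncomputable def potχ (w : ℝ × E3 → ℝ) (p : ℝ × E3) : ℝ :=
  2 * cosh p.1 ^ 2 * angLap (dtau w) p + 4 * (cosh p.1 * sinh p.1) * potV₀ w p

lemma contDiff_cosh_sq : ContDiff ℝ ∞ fun t => cosh t ^ 2 := contDiff_cosh.pow 2

lemma contDiff_cosh_mul_sinh : ContDiff ℝ ∞ fun t => cosh t * sinh t := contDiff_cosh.mul contDiff_sinh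

lemma contDiffOn_potV₀ (hw : ContDiffOn ℝ ∞ w punctured) : ContDiffOn ℝ ∞ (potV₀ w) punctured :=
  (contDiffOn_timeFun_mul contDiff_cosh_sq hw).add
    (contDiffOn_timeFun_mul contDiff_cosh_mul_sinh.neg (contDiffOn_dtau hw))

lemma contDiffOn_potχ (hw : ContDiffOn ℝ ∞ w punctured) : ContDiffOn ℝ ∞ (potχ w) punctured :=
  (contDiffOn_timeFun_mul (contDiff_const.mul contDiff_cosh_sq)
    (contDiffOn_angLap (contDiffOn_dtau hw))).add
    (contDiffOn_timeFun_mul (contDiff_const.mul contDiff_cosh_mul_sinh) (contDiffOn_potV₀ hw))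

lemma angLap_potV₀ (hw : ContDiffOn ℝ ∞ w punctured) (hp : p ∈ punctured) : angLap (potV₀ w) p =
    cosh p.1 ^ 2 * angLap w p + -(cosh p.1 * sinh p.1) * angLap (dtau w) p := by
  have h1 := contDiffOn_dtau hw
  have := angLap_add (contDiffOn_timeFun_mul contDiff_cosh_sq hw)
    (contDiffOn_timeFun_mul contDiff_cosh_mul_sinh.neg h1) hp
  rwa [angLap_timeFun_mul contDiff_cosh_sq hw hp,
    angLap_timeFun_mul contDiff_cosh_mul_sinh.neg h1 hp] at this

lemma hasDerivAt_cosh_sq (t : ℝ) : HasDerivAt (fun t => cosh t ^ 2) (2 * (cosh t * sinh t)) t :=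
  ((hasDerivAt_cosh t).fun_pow 2).congr_deriv (by simp; ring)

lemma hasDerivAt_cosh_mul_sinh (t : ℝ) :
    HasDerivAt (fun t => cosh t * sinh t) (sinh t ^ 2 + cosh t ^ 2) t :=
  ((hasDerivAt_cosh t).fun_mul (hasDerivAt_sinh t)).congr_deriv (by ring)

/-- The wave equation eliminates the second τ derivative of `w`. Applying Δ + 2 gives the evolution
equation required of V. -/
lemma dtau_potV₀ (hw : ContDiffOn ℝ ∞ w punctured) (hwave : IsWave w) (hp : p ∈ punctured) :
    dtau (potV₀ w) p = -(sinh p.1 / cosh p.1) * (potV₀ w p + angLap w p) := by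
  have h1 := contDiffOn_dtau hw
  have := dtau_add (contDiffOn_timeFun_mul contDiff_cosh_sq hw)
    (contDiffOn_timeFun_mul contDiff_cosh_mul_sinh.neg h1) hp
  rw [dtau_timeFun_mul (hasDerivAt_cosh_sq _) hw hp,
    dtau_timeFun_mul (hasDerivAt_cosh_mul_sinh p.1).fun_neg h1 hp, hwave p hp] at this
  refine this.trans ?_
  have hc := (cosh_pos p.1).ne'
  have hq := cosh_sq p.1
  rw [potV₀]
  field_simp
  grind

lemma dtau_potχ (hw : ContDiffOn ℝ ∞ w punctured) (hwave : IsWave w) (hp : p ∈ punctured) :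
    dtau (potχ w) p = sinh p.1 / cosh p.1 * potχ w p +
      2 * (angShift (angLap w) p + angShift (potV₀ w) p) := by
  have h1 := contDiffOn_dtau hw
  have e1 : dtau (angLap (dtau w)) p = -2 * (sinh p.1 / cosh p.1) * angLap (dtau w) p +
      (cosh p.1 ^ 2)⁻¹ * angLap (angLap w) p + 3 * angLap w p := by
    rw [dtau_angLap h1 hp, angLap_dtau_dtau hw hwave hp]
  have hL := contDiffOn_angLap h1
  have hV := contDiffOn_potV₀ hw
  have := dtau_add (contDiffOn_timeFun_mul (contDiff_const (c := 2) |>.mul contDiff_cosh_sq) hL)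
    (contDiffOn_timeFun_mul (contDiff_const (c := 4) |>.mul contDiff_cosh_mul_sinh) hV) hp
  rw [dtau_timeFun_mul ((hasDerivAt_cosh_sq _).const_mul 2) hL hp,
    dtau_timeFun_mul ((hasDerivAt_cosh_mul_sinh p.1).const_mul 4) hV hp, e1,
    dtau_potV₀ hw hwave hp] at this
  refine this.trans ?_
  have hc := (cosh_pos p.1).ne'
  have hq := cosh_sq p.1
  rw [angShift, angShift, angLap_potV₀ hw hp, potχ, potV₀]
  field_simp
  grind

/-- Solutions in the range of `Δ(Δ + 2)` have a globally smooth potential. -/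
theorem exists_regular_potential (hw : ContDiffOn ℝ ∞ w punctured) (hwave : IsWave w) :
    ∃ P : (Fin 4 → ℝ) → Fin 4 → Fin 4 → ℝ, ContDiffOn ℝ ∞ P spatial ∧ ∀ u ∈ sphDom,
      (∀ a b, comps sph P u a b = comps sph P u b a) ∧ tr (metric sph) (comps sph P) u = 0 ∧
      ∀ a b, hessPlus (metric sph) (fun v => angShift (angLap w) (polar v)) u a b =
        curl (metric sph) (comps sph P) a b u := by
  have hL := contDiffOn_angLap hw
  have h1 := contDiffOn_dtau hw
  have hV₀ := contDiffOn_potV₀ hw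
  have hχ := contDiffOn_potχ hw
  have hΦ := contDiffOn_angShift hL
  have hV := contDiffOn_angShift hV₀
  -- With Φ = (Δ + 2)Δw and V = (Δ + 2)V₀, each elliptic constraint carries the operator to be
  -- inverted as a common factor, so it is solved without inverting anything.
  set Φ := angShift (angLap w) with hΦdef
  set V := angShift (potV₀ w) with hVdef
  have hψ : ContDiffOn ℝ ∞ (fun q => Φ q + 2 * V q) punctured := hΦ.add (contDiffOn_const.mul hV)
  have hLV : ∀ q ∈ punctured, angLap V q = cosh q.1 ^ 2 * Φ q - cosh q.1 * sinh q.1 * dtau Φ q := by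
    intro q hq
    rw [hVdef, angLap_angShift hV₀ hq, angShift_congr (fun r hr => angLap_potV₀ hw hr) hq,
      angShift_add (contDiffOn_timeFun_mul contDiff_cosh_sq hL)
        (contDiffOn_timeFun_mul contDiff_cosh_mul_sinh.neg (contDiffOn_angLap h1)) hq,
      angShift_timeFun_mul contDiff_cosh_sq hL hq,
      angShift_timeFun_mul contDiff_cosh_mul_sinh.neg (contDiffOn_angLap h1) hq, hΦdef,
      dtau_angShift hL hq, angShift_congr (fun r hr => dtau_angLap hw hr) hq]
    ring
  have hDV : ∀ q ∈ punctured, dtau V q = -(sinh q.1 / cosh q.1) * (V q + Φ q) := by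
    intro q hq
    have ht : ContDiff ℝ ∞ fun x => -(sinh x / cosh x) :=
      (contDiff_sinh.div contDiff_cosh fun x => (cosh_pos x).ne').neg
    rw [hVdef, dtau_angShift hV₀ hq, angShift_congr (fun r hr => dtau_potV₀ hw hwave hr) hq,
      angShift_timeFun_mul ht (hV₀.add hL) hq, angShift_add hV₀ hL hq]
  have hLχ : ∀ q ∈ punctured, angShift (potχ w) q =
      4 * (cosh q.1 * sinh q.1) * V q + 2 * cosh q.1 ^ 2 * dtau Φ q := by
    intro q hq
    have := angShift_add (contDiffOn_timeFun_mul (contDiff_const (c := 2) |>.mul contDiff_cosh_sq)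
      (contDiffOn_angLap h1)) (contDiffOn_timeFun_mul (contDiff_const (c := 4) |>.mul
        contDiff_cosh_mul_sinh) hV₀) hq
    rw [angShift_timeFun_mul (contDiff_const.mul contDiff_cosh_sq) (contDiffOn_angLap h1) hq,
      angShift_timeFun_mul (contDiff_const.mul contDiff_cosh_mul_sinh) hV₀ hq] at this
    rw [hΦdef, dtau_angShift hL hq, angShift_congr (fun r hr => dtau_angLap hw hr) hq]
    refine this.trans ?_
    ring
  have hwaveΦ : IsWave Φ := (hwave.angLap hw).angShift hL
  refine ⟨oddField (fun q => Φ q + 2 * V q) (potχ w), contDiffOn_oddField hψ hχ, fun u hu => ?_⟩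
  have hcomps := fun v (hv : v ∈ sphDom) => comps_oddField hψ hχ hv
  have hd0 : ∀ {F : ℝ × E3 → ℝ}, ContDiffOn ℝ ∞ F punctured →
      pd 0 (fun v => F (polar v)) = fun v => dtau F (polar v) := fun hF =>
    funext fun v => pd_zero_comp_polar hF v
  have hpd : ∀ i v, pd i (fun v => Φ (polar v) + 2 * V (polar v)) v =
      pd i (fun v => Φ (polar v)) v + 2 * pd i (fun v => V (polar v)) v := fun i v => by
    have d1 := (contDiffOn_comp_polar hΦ).differentiable (by simp) v
    have d2 := (contDiffOn_comp_polar hV).differentiable (by simp) v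
    rw [pd_add d1 (d2.const_mul 2), pd_const_mul]
  refine ⟨fun a b => ?_, ?_, fun a b => ?_⟩
  · rw [hcomps u hu]
    exact oddTensor_symm _ _ u a b
  · have := tr_oddTensor hu (fun i v => pd i (fun v => Φ (polar v) + 2 * V (polar v)) v)
      (fun v => potχ w (polar v))
    rw [tr, ← hcomps u hu] at this
    exact this
  · have key := hessPlus_eq_curl_oddTensor (Φ := fun v => Φ (polar v)) (V := fun v => V (polar v))
      (χ := fun v => potχ w (polar v)) (contDiffOn_comp_polar hΦ).contDiffOn
      (contDiffOn_comp_polar hV).contDiffOn (contDiffOn_comp_polar hχ).contDiffOn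
      (fun v hv => by
        rw [hd0 hΦ, pd_zero_comp_polar (contDiffOn_dtau hΦ), hwaveΦ _ (polar_mem v),
          sphLap_polar hΦ hv]
        simp only [polar]
        ring)
      (fun v hv => by rw [sphLap_polar hV hv, hLV _ (polar_mem v), pd_zero_comp_polar hΦ]; rfl)
      (fun v hv => by rw [pd_zero_comp_polar hV, hDV _ (polar_mem v)]; rfl)
      (fun v hv => by
        have := hLχ _ (polar_mem v)
        rw [angShift] at this
        rw [sphLap_polar hχ hv, pd_zero_comp_polar hΦ, this]; rfl)
      (fun v hv => by rw [pd_zero_comp_polar hχ, dtau_potχ hw hwave (polar_mem v)]; rfl) hu a b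
    rw [key]
    refine curl_congr ?_ a b
    filter_upwards [isOpen_sphDom.mem_nhds hu] with v hv
    rw [hcomps v hv]
    simp only [hpd]

end RegularSolutions

end UnitHyperboloid

namespace UnitHyperboloid

/-! ### The singular tensors as ambient fields smooth on their patches. -/

section SingularFields

open Real

/-- The coordinate functions `τ, y₁, y₂, y₃` on `ℝ × ℝ³`. -/
noncomputable def coordFun (m : Fin 4) (q : ℝ × E3) : ℝ := ![q.1, q.2 0, q.2 1, q.2 2] m

lemma contDiff_coordFun (m : Fin 4) : ContDiff ℝ ∞ (coordFun m) := by
  unfold coordFun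
  fin_cases m
  · exact contDiff_fst
  · exact contDiff_coord 0
  · exact contDiff_coord 1
  · exact contDiff_coord 2

/-- The pullback by `sphPt` of the tensor field with the components `M` in the basis
`dτ, dy₁, dy₂, dy₃`. -/
noncomputable def pullForm (M : ℝ × E3 → Fin 4 → Fin 4 → ℝ) (x : Fin 4 → ℝ) (i j : Fin 4) : ℝ :=
  ∑ m, ∑ n, M (sphPt x) m n * (fderiv ℝ (fun z => coordFun m (sphPt z)) x (Pi.single i 1) *
    fderiv ℝ (fun z => coordFun n (sphPt z)) x (Pi.single j 1))

lemma contDiffOn_pullForm {M : ℝ × E3 → Fin 4 → Fin 4 → ℝ} {W : Set (Fin 4 → ℝ)}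
    (hM : ContDiffOn ℝ ∞ (fun x => M (sphPt x)) W) : ContDiffOn ℝ ∞ (pullForm M) W := by
  rw [contDiffOn_pi]; intro i
  rw [contDiffOn_pi]; intro j
  have h : ∀ m i : Fin 4, ContDiff ℝ ∞
      (fun x => fderiv ℝ (fun z => coordFun m (sphPt z)) x (Pi.single i 1)) := fun m i =>
    (((contDiff_coordFun m).comp contDiff_sphPt).fderiv_right (m := ∞) (by simp)).clm_apply
      contDiff_const
  have hM' : ∀ m n, ContDiffOn ℝ ∞ (fun x => M (sphPt x) m n) W := fun m n =>
    contDiffOn_pi.1 (contDiffOn_pi.1 hM m) n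
  exact ContDiffOn.sum fun m _ => ContDiffOn.sum fun n _ =>
    (hM' m n).mul ((h m i).contDiffOn.mul (h n j).contDiffOn)

/-- The components of the vectors `polarVec`. -/
noncomputable def polarComp (a : Fin 3) (u : Fin 3 → ℝ) : Fin 4 → ℝ :=
  ![![1, 0, 0, 0], ![0, cos (u 1) * cos (u 2), cos (u 1) * sin (u 2), -sin (u 1)],
    ![0, -(sin (u 1) * sin (u 2)), sin (u 1) * cos (u 2), 0]] a

lemma pd_coordFun_polar (m : Fin 4) (a : Fin 3) (u : Fin 3 → ℝ) :
    pd a (fun v => coordFun m (polar v)) u = polarComp a u m := by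
  fin_cases m
  · change pd a (fun v : Fin 3 → ℝ => v 0) u = _
    rw [pd_coord]
    fin_cases a <;> simp [polarComp]
  · refine (pd_polar_coord 0 a u).trans ?_
    fin_cases a <;> simp [polarComp, polarVec]
  · refine (pd_polar_coord 1 a u).trans ?_
    fin_cases a <;> simp [polarComp, polarVec]
  · refine (pd_polar_coord 2 a u).trans ?_
    fin_cases a <;> simp [polarComp, polarVec]

lemma comps_pullForm (M : ℝ × E3 → Fin 4 → Fin 4 → ℝ) (u : Fin 3 → ℝ) (a b : Fin 3) :
    comps sph (pullForm M) u a b = bil (M (polar u)) (polarComp a u) (polarComp b u) := by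
  have h : ∀ m a, fderiv ℝ (fun z => coordFun m (sphPt z)) (sph u) (pd a sph u) =
      polarComp a u m := fun m a => by
    rw [fderiv_sphPt_pd_sph ((contDiff_coordFun m).differentiable (by simp) _), pd_coordFun_polar]
  rw [bil_apply]
  simp only [← h, ← sphPt_sph, comps, pullForm, Matrix.of_apply,
    ← sum_mul_apply_single _ (pd _ sph u), Finset.sum_mul, Finset.mul_sum]
  refine ((Finset.sum_congr rfl fun i _ => Finset.sum_comm).trans
    (Finset.sum_comm.trans (Finset.sum_congr rfl fun m _ =>
      (Finset.sum_congr rfl fun i _ => Finset.sum_comm).trans Finset.sum_comm))).trans ?_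
  refine Finset.sum_congr rfl fun m _ => Finset.sum_congr rfl fun n _ => ?_
  rw [Finset.sum_comm]
  exact Finset.sum_congr rfl fun j _ => Finset.sum_congr rfl fun i _ => by ring

/-- The symmetrized product of covectors. -/
def symProd (v w : Fin 4 → ℝ) (i j : Fin 4) : ℝ := v i * w j + w i * v j

lemma bil_sub (M N : Fin 4 → Fin 4 → ℝ) (v w : Fin 4 → ℝ) :
    bil (M - N) v w = bil M v w - bil N v w := by
  simp only [bil_apply, Pi.sub_apply, ← Finset.sum_sub_distrib]
  exact Finset.sum_congr rfl fun i _ => Finset.sum_congr rfl fun j _ => by ring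

lemma bil_neg (M : Fin 4 → Fin 4 → ℝ) (v w : Fin 4 → ℝ) : bil (-M) v w = -bil M v w := by
  rw [← zero_sub, bil_sub]
  simp [bil_apply]

lemma bil_symProd (p q v w : Fin 4 → ℝ) : bil (symProd p q) v w =
    (∑ i, p i * v i) * (∑ j, q j * w j) + (∑ i, q i * v i) * ∑ j, p j * w j := by
  rw [bil_apply, Finset.sum_mul_sum, Finset.sum_mul_sum, ← Finset.sum_add_distrib]
  refine Finset.sum_congr rfl fun i _ => ?_
  rw [← Finset.sum_add_distrib]
  exact Finset.sum_congr rfl fun j _ => by rw [symProd]; ring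

/-- The components of the singular tensors in the basis `dτ, dy₁, dy₂, dy₃`, as polynomials in
`S = sinh τ`, `C = cosh τ`, `I = 1 / cosh τ`, the coordinates `X, Y, Z` on the sphere and
`D = 1 / (1 + κ Z)`. -/
noncomputable def singCoef (κ : ℝ) (μ : Fin 4) (S C I X Y Z D : ℝ) : Fin 4 → Fin 4 → ℝ :=
  ![(2 * κ * I * D) • symProd ![1, 0, 0, 0] ![0, -Y, X, 0] +
      (S * D ^ 2) • symProd ![0, 0, 0, -1] ![0, -Y, X, 0],
    (-3 * S * I ^ 2) • symProd ![1, 0, 0, 0] ![0, -Y, X, 0] -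
      ((Z + 2 * κ) * C * D ^ 2) • symProd ![0, 0, 0, -1] ![0, -Y, X, 0],
    (3 * S * I ^ 2) • symProd ![1, 0, 0, 0] ![0, 0, Z, -Y] +
      (2 * (Z + 2 * κ) * C * D ^ 2) •
        (X • symProd ![0, 1, 0, -(κ * X * D)] ![0, 0, 1, -(κ * Y * D)] -
          (Y / 2) • (symProd ![0, 1, 0, -(κ * X * D)] ![0, 1, 0, -(κ * X * D)] -
            symProd ![0, 0, 1, -(κ * Y * D)] ![0, 0, 1, -(κ * Y * D)])) -
      (C * D ^ 2 * X) • symProd ![0, 0, 0, -1] ![0, -Y, X, 0],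
    (3 * S * I ^ 2) • symProd ![1, 0, 0, 0] ![0, -Z, 0, X] -
      (2 * (Z + 2 * κ) * C * D ^ 2) •
        (Y • symProd ![0, 1, 0, -(κ * X * D)] ![0, 0, 1, -(κ * Y * D)] +
          (X / 2) • (symProd ![0, 1, 0, -(κ * X * D)] ![0, 1, 0, -(κ * X * D)] -
            symProd ![0, 0, 1, -(κ * Y * D)] ![0, 0, 1, -(κ * Y * D)])) -
      (C * D ^ 2 * Y) • symProd ![0, 0, 0, -1] ![0, -Y, X, 0]] μ

lemma contDiffOn_singCoef {E : Type*} [NormedAddCommGroup E] [NormedSpace ℝ E] {W : Set E} (κ : ℝ)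
    (μ : Fin 4) {S C I X Y Z D : E → ℝ} (hS : ContDiffOn ℝ ∞ S W) (hC : ContDiffOn ℝ ∞ C W)
    (hI : ContDiffOn ℝ ∞ I W) (hX : ContDiffOn ℝ ∞ X W) (hY : ContDiffOn ℝ ∞ Y W)
    (hZ : ContDiffOn ℝ ∞ Z W) (hD : ContDiffOn ℝ ∞ D W) :
    ContDiffOn ℝ ∞ (fun x => singCoef κ μ (S x) (C x) (I x) (X x) (Y x) (Z x) (D x)) W := by
  have hv : ∀ {a b c d : E → ℝ}, ContDiffOn ℝ ∞ a W → ContDiffOn ℝ ∞ b W → ContDiffOn ℝ ∞ c W →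
      ContDiffOn ℝ ∞ d W → ContDiffOn ℝ ∞ (fun x => ![a x, b x, c x, d x]) W := by
    intro a b c d ha hb hc hd
    rw [contDiffOn_pi]
    intro i
    fin_cases i <;> assumption
  have hsp : ∀ {v w : E → Fin 4 → ℝ}, ContDiffOn ℝ ∞ v W → ContDiffOn ℝ ∞ w W →
      ContDiffOn ℝ ∞ (fun x => symProd (v x) (w x)) W := by
    intro v w h1 h2
    rw [contDiffOn_pi]; intro i
    rw [contDiffOn_pi]; intro j
    have e1 := contDiffOn_pi.1 h1
    have e2 := contDiffOn_pi.1 h2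
    exact ((e1 i).mul (e2 j)).add ((e2 i).mul (e1 j))
  have k0 : ContDiffOn ℝ ∞ (fun _ : E => (0 : ℝ)) W := contDiffOn_const
  have k1 : ContDiffOn ℝ ∞ (fun _ : E => (1 : ℝ)) W := contDiffOn_const
  have k1' : ContDiffOn ℝ ∞ (fun _ : E => (-1 : ℝ)) W := contDiffOn_const
  have vτ := hv k1 k0 k0 k0
  have vη := hv k0 k0 k0 k1'
  have vω := hv k0 hY.neg hX k0
  have vα := hv k0 k1 k0 (ContDiffOn.neg ((contDiffOn_const (c := κ).mul hX).mul hD))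
  have vβ := hv k0 k0 k1 (ContDiffOn.neg ((contDiffOn_const (c := κ).mul hY).mul hD))
  have vY := hv k0 k0 hZ hY.neg
  have vX := hv k0 hZ.neg k0 hX
  unfold singCoef
  have hX2 : ContDiffOn ℝ ∞ (fun x => X x / 2) W := by fun_prop
  have hY2 : ContDiffOn ℝ ∞ (fun x => Y x / 2) W := by fun_prop
  have c1 : ContDiffOn ℝ ∞ (fun x => 2 * κ * I x * D x) W := by fun_prop
  have c2 : ContDiffOn ℝ ∞ (fun x => S x * D x ^ 2) W := by fun_prop
  have c3 : ContDiffOn ℝ ∞ (fun x => -3 * S x * I x ^ 2) W := by fun_prop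
  have c4 : ContDiffOn ℝ ∞ (fun x => (Z x + 2 * κ) * C x * D x ^ 2) W := by fun_prop
  have c5 : ContDiffOn ℝ ∞ (fun x => 3 * S x * I x ^ 2) W := by fun_prop
  have c6 : ContDiffOn ℝ ∞ (fun x => 2 * (Z x + 2 * κ) * C x * D x ^ 2) W := by fun_prop
  have c7 : ContDiffOn ℝ ∞ (fun x => C x * D x ^ 2 * X x) W := by fun_prop
  have c8 : ContDiffOn ℝ ∞ (fun x => C x * D x ^ 2 * Y x) W := by fun_prop
  fin_cases μ
  · exact (c1.smul (hsp vτ vω)).add (c2.smul (hsp vη vω))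
  · exact (c3.smul (hsp vτ vω)).sub (c4.smul (hsp vη vω))
  · exact ((c5.smul (hsp vτ vY)).add (c6.smul ((hX.smul (hsp vα vβ)).sub
      (hY2.smul ((hsp vα vα).sub (hsp vβ vβ)))))).sub (c7.smul (hsp vη vω))
  · exact ((c5.smul (hsp vτ vX)).sub (c6.smul ((hY.smul (hsp vα vβ)).add
      (hX2.smul ((hsp vα vα).sub (hsp vβ vβ)))))).sub (c8.smul (hsp vη vω))

/-- The singular tensor fields, which are smooth where `1 + κ x³ / √(1 + (x⁰)²) ≠ 0`. -/
noncomputable def singField (κ : ℝ) (μ : Fin 4) : (Fin 4 → ℝ) → Fin 4 → Fin 4 → ℝ :=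
  pullForm fun q => singCoef κ μ (sinh q.1) (cosh q.1) (cosh q.1)⁻¹ (q.2 0) (q.2 1) (q.2 2)
    (1 + κ * q.2 2)⁻¹

/-- The domain of the singular tensor fields. -/
def singDom (κ : ℝ) : Set (Fin 4 → ℝ) := {x | 1 + κ * (sphPt x).2 2 ≠ 0}

lemma contDiff_coord_sphPt (k : Fin 3) : ContDiff ℝ ∞ (fun x => (sphPt x).2 k) :=
  (contDiff_coord k).comp contDiff_sphPt

lemma isOpen_singDom (κ : ℝ) : IsOpen (singDom κ) :=
  isOpen_ne_fun (continuous_const.add (continuous_const.mul (contDiff_coord_sphPt 2).continuous))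
    continuous_const

lemma contDiffOn_singField (κ : ℝ) (μ : Fin 4) :
    ContDiffOn ℝ ∞ (singField κ μ) (singDom κ) := by
  have ht : ContDiff ℝ ∞ fun x => (sphPt x).1 := contDiff_fst.comp contDiff_sphPt
  have hC : ContDiff ℝ ∞ fun x => cosh (sphPt x).1 := contDiff_cosh.comp ht
  have hZ := contDiff_coord_sphPt 2
  exact contDiffOn_pullForm (contDiffOn_singCoef κ μ (contDiff_sinh.comp ht).contDiffOn
    hC.contDiffOn (hC.inv fun x => (cosh_pos _).ne').contDiffOn
    (contDiff_coord_sphPt 0).contDiffOn (contDiff_coord_sphPt 1).contDiffOn hZ.contDiffOn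
    ((contDiff_const.add (contDiff_const.mul hZ)).contDiffOn.inv fun x hx => hx))

-- On the sphere the covectors (0, −Y, X, 0) and (0, 0, 0, −1) restrict to sin²θ dφ and sin θ dθ,
-- and D times the covectors with entries −κXD and −κYD are the differentials of the stereographic
-- coordinates XD and YD. The condition κ² = 1 enters through 1/(1 + κ cos θ) = κ(κ − cos θ)/sin²θ.
set_option maxHeartbeats 4000000 in
lemma comps_singField {κ : ℝ} (hκ : κ ^ 2 = 1) (μ : Fin 4) {u : Fin 3 → ℝ} (hu : u ∈ sphDom) :
    comps sph (singField κ μ) u = kSing κ μ u := by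
  have hs := (sin_pos_of_mem hu).ne'
  have hc := (cosh_pos (u 0)).ne'
  have e1 := sin_sq (u 1)
  have e2 := sin_sq (u 2)
  have hD : (1 + κ * cos (u 1))⁻¹ = κ * (κ - cos (u 1)) / sin (u 1) ^ 2 := by
    refine inv_eq_of_mul_eq_one_right ?_
    field_simp
    grind
  have c2 := cos_two_mul (u 1)
  have c3 := cos_three_mul (u 1)
  ext a b
  rw [singField, comps_pullForm]
  fin_cases μ <;> fin_cases a <;> fin_cases b <;>
    simp [singCoef, bil_add, bil_sub, bil_neg, bil_smul, bil_symProd, Fin.sum_univ_four, polarComp, polar,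
      kSing, k0, k1, k2, k3, hD, c2, c3, tanh_eq_sinh_div_cosh]
  all_goals try field_simp
  all_goals grind

lemma sphPt_two_of_mem {x : Fin 4 → ℝ} (hx : x ∈ hyp) :
    (sphPt x).2 2 = x 3 / √(1 + x 0 ^ 2) ∧ x 1 ^ 2 + x 2 ^ 2 + x 3 ^ 2 = √(1 + x 0 ^ 2) ^ 2 := by
  have h : mink x x = 1 := hx
  have h2 : √(1 + x 0 ^ 2) ^ 2 = 1 + x 0 ^ 2 := sq_sqrt (by positivity)
  refine ⟨by simp [sphPt]; ring, ?_⟩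
  rw [h2]
  simp only [mink] at h
  linarith

/-- Where the denominator vanishes, −x³ equals the full radius √(1 + (x⁰)²) of the sphere at that
time, which forces x¹ = x² = 0 and places the point on the string. -/
lemma northPatch_subset : northPatch ⊆ singDom 1 := by
  rintro x ⟨hx, hns⟩ h
  obtain ⟨h1, h2⟩ := sphPt_two_of_mem hx
  have hr : 0 < √(1 + x 0 ^ 2) := sqrt_pos.2 (by positivity)
  rw [h1] at h
  field_simp at h
  have h3 : x 3 = -√(1 + x 0 ^ 2) := by linarith
  rw [← neg_sq √(1 + x 0 ^ 2), ← h3] at h2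
  exact hns ⟨by nlinarith [sq_nonneg (x 1), sq_nonneg (x 2)],
    by nlinarith [sq_nonneg (x 1), sq_nonneg (x 2)], by linarith⟩

lemma southPatch_subset : southPatch ⊆ singDom (-1) := by
  rintro x ⟨hx, hns⟩ h
  obtain ⟨h1, h2⟩ := sphPt_two_of_mem hx
  have hr : 0 < √(1 + x 0 ^ 2) := sqrt_pos.2 (by positivity)
  rw [h1] at h
  field_simp at h
  have h3 : x 3 = √(1 + x 0 ^ 2) := by linarith
  rw [← h3] at h2
  exact hns ⟨by nlinarith [sq_nonneg (x 1), sq_nonneg (x 2)],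
    by nlinarith [sq_nonneg (x 1), sq_nonneg (x 2)], by linarith⟩

end SingularFields

end UnitHyperboloid

namespace UnitHyperboloid

/-! ### Linear superposition of potentials in the chart (τ, θ, φ). -/

section Superposition

/-- The symmetric traceless tensor with the components `T` is a potential at `u` for the scalar
`f`, in the coordinates `(τ, θ, φ)`. -/
structure IsPotentialAt (f : (Fin 3 → ℝ) → ℝ) (T : (Fin 3 → ℝ) → Matrix (Fin 3) (Fin 3) ℝ)
    (u : Fin 3 → ℝ) : Prop where
  contDiff : ContDiff ℝ ∞ f
  differentiableAt : ∀ a b, DifferentiableAt ℝ (fun v => T v a b) u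
  symm : ∀ a b, T u a b = T u b a
  tr_eq : tr (metric sph) T u = 0
  hessPlus_eq : ∀ a b, hessPlus (metric sph) f u a b = curl (metric sph) T a b u

variable {f f' : (Fin 3 → ℝ) → ℝ} {T T' : (Fin 3 → ℝ) → Matrix (Fin 3) (Fin 3) ℝ} {u : Fin 3 → ℝ}
  {g : (Fin 3 → ℝ) → Matrix (Fin 3) (Fin 3) ℝ}

lemma hessPlus_lincomb (hf : ContDiff ℝ ∞ f) (hf' : ContDiff ℝ ∞ f') (c : ℝ) (a b : Fin 3) :
    hessPlus g (fun v => c * f v + f' v) u a b = c * hessPlus g f u a b + hessPlus g f' u a b := by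
  have h1 : ∀ {h : (Fin 3 → ℝ) → ℝ}, ContDiff ℝ ∞ h → Differentiable ℝ h := fun hh =>
    hh.differentiable (by simp)
  have h2 : ∀ {h : (Fin 3 → ℝ) → ℝ}, ContDiff ℝ ∞ h → ∀ i, Differentiable ℝ (pd i h) :=
    fun {h} hh i => ((hh.fderiv_right (m := ∞) (by simp)).clm_apply contDiff_const).differentiable
      (by simp)
  have hp : ∀ i, pd i (fun v => c * f v + f' v) = fun v => c * pd i f v + pd i f' v := fun i => by
    ext v
    rw [pd_add ((h1 hf v).const_mul c) (h1 hf' v), pd_const_mul]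
  simp only [hessPlus, Matrix.of_apply, hess, hp, Fin.sum_univ_three]
  rw [pd_add ((h2 hf b u).const_mul c) (h2 hf' b u), pd_const_mul]
  ring

lemma covD_lincomb (hT : ∀ a b, DifferentiableAt ℝ (fun v => T v a b) u)
    (hT' : ∀ a b, DifferentiableAt ℝ (fun v => T' v a b) u) (k : ℝ) (c a b : Fin 3) :
    covD g (fun v => k • T v + T' v) c a b u = k * covD g T c a b u + covD g T' c a b u := by
  simp only [covD, Fin.sum_univ_three, Matrix.add_apply, Matrix.smul_apply, smul_eq_mul]
  rw [pd_add ((hT a b).const_mul k) (hT' a b), pd_const_mul]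
  ring

lemma curl_lincomb (hT : ∀ a b, DifferentiableAt ℝ (fun v => T v a b) u)
    (hT' : ∀ a b, DifferentiableAt ℝ (fun v => T' v a b) u) (k : ℝ) (a b : Fin 3) :
    curl g (fun v => k • T v + T' v) a b u = k * curl g T a b u + curl g T' a b u := by
  simp only [curl, covD_lincomb hT hT', Finset.mul_sum (a := k), ← Finset.sum_add_distrib]
  exact Finset.sum_congr rfl fun _ _ => Finset.sum_congr rfl fun _ _ => by ring

lemma tr_lincomb (k : ℝ) : tr g (fun v => k • T v + T' v) u = k * tr g T u + tr g T' u := by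
  simp only [tr, Matrix.add_apply, Matrix.smul_apply, smul_eq_mul, Finset.mul_sum (a := k),
    ← Finset.sum_add_distrib]
  exact Finset.sum_congr rfl fun _ _ => Finset.sum_congr rfl fun _ _ => by ring

lemma IsPotentialAt.lincomb (h : IsPotentialAt f T u) (h' : IsPotentialAt f' T' u) (k : ℝ) :
    IsPotentialAt (fun v => k * f v + f' v) (fun v => k • T v + T' v) u where
  contDiff := (contDiff_const.mul h.contDiff).add h'.contDiff
  differentiableAt a b := ((h.differentiableAt a b).const_mul k).add (h'.differentiableAt a b)
  symm a b := by simp [h.symm a b, h'.symm a b]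
  tr_eq := by rw [tr_lincomb, h.tr_eq, h'.tr_eq, mul_zero, add_zero]
  hessPlus_eq a b := by
    rw [hessPlus_lincomb h.contDiff h'.contDiff, curl_lincomb h.differentiableAt
      h'.differentiableAt, h.hessPlus_eq, h'.hessPlus_eq]

/-- Meant for the ζ_(μ), which enter Φ but contribute nothing to P. -/
lemma isPotentialAt_zero (hf : ContDiff ℝ ∞ f) (hf0 : hessPlus (metric sph) f u = 0) :
    IsPotentialAt f (fun _ => 0) u where
  contDiff := hf
  differentiableAt _ _ := differentiableAt_const _
  symm _ _ := rfl
  tr_eq := by simp [tr]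
  hessPlus_eq a b := by
    rw [hf0]
    simp [curl, covD]

lemma IsPotentialAt.add_sum (h' : IsPotentialAt f' T' u) (k : Fin 4 → ℝ)
    {F : Fin 4 → (Fin 3 → ℝ) → ℝ} {S : Fin 4 → (Fin 3 → ℝ) → Matrix (Fin 3) (Fin 3) ℝ}
    (h : ∀ μ, IsPotentialAt (F μ) (S μ) u) :
    IsPotentialAt (fun v => ∑ μ, k μ * F μ v + f' v) (fun v => ∑ μ, k μ • S μ v + T' v) u := by
  convert (h 0).lincomb ((h 1).lincomb ((h 2).lincomb ((h 3).lincomb h' (k 3)) (k 2)) (k 1)) (k 0)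
    using 2 <;> simp only [Fin.sum_univ_four, add_assoc]

lemma contDiff_zeta (μ : Fin 4) : ContDiff ℝ ∞ (zeta μ) := by
  unfold zeta
  fin_cases μ
  · change ContDiff ℝ ∞ fun u : Fin 3 → ℝ => -Real.sinh (u 0)
    fun_prop
  · change ContDiff ℝ ∞ fun u : Fin 3 → ℝ => Real.cosh (u 0) * Real.cos (u 1)
    fun_prop
  · change ContDiff ℝ ∞ fun u : Fin 3 → ℝ => Real.cosh (u 0) * Real.sin (u 1) * Real.cos (u 2)
    fun_prop
  · change ContDiff ℝ ∞ fun u : Fin 3 → ℝ => Real.cosh (u 0) * Real.sin (u 1) * Real.sin (u 2)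
    fun_prop

lemma contDiff_zetaHat (μ : Fin 4) : ContDiff ℝ ∞ (zetaHat μ) := by
  have hc : ∀ u : Fin 3 → ℝ, Real.cosh (u 0) ≠ 0 := fun u => (Real.cosh_pos _).ne'
  have h0 : ContDiff ℝ ∞ fun u : Fin 3 → ℝ => Real.cosh (u 0) := by fun_prop
  have hr : ContDiff ℝ ∞ fun u : Fin 3 → ℝ =>
      2 * Real.sinh (u 0) + Real.tanh (u 0) / Real.cosh (u 0) := by
    simp only [Real.tanh_eq_sinh_div_cosh]
    have h1 : ContDiff ℝ ∞ fun u : Fin 3 → ℝ => Real.sinh (u 0) := by fun_prop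
    exact (contDiff_const.mul h1).add ((h1.div h0 hc).div h0 hc)
  unfold zetaHat
  fin_cases μ
  · have h1 : ContDiff ℝ ∞ fun u : Fin 3 → ℝ => Real.cosh (2 * u 0) := by fun_prop
    exact h1.div h0 hc
  · have h1 : ContDiff ℝ ∞ fun u : Fin 3 → ℝ => Real.cos (u 1) := by fun_prop
    exact hr.mul h1
  · have h1 : ContDiff ℝ ∞ fun u : Fin 3 → ℝ => Real.sin (u 1) * Real.cos (u 2) := by fun_prop
    exact hr.mul h1
  · have h1 : ContDiff ℝ ∞ fun u : Fin 3 → ℝ => Real.sin (u 1) * Real.sin (u 2) := by fun_prop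
    exact hr.mul h1

lemma differentiableAt_comps_sph {A : (Fin 4 → ℝ) → Fin 4 → Fin 4 → ℝ}
    (hA : DifferentiableAt ℝ A (sph u)) (a b : Fin 3) :
    DifferentiableAt ℝ (fun v => comps sph A v a b) u := by
  have hs : DifferentiableAt ℝ sph u := contDiff_sph.differentiable (by simp) u
  have hp : ∀ a i, DifferentiableAt ℝ (fun v => pd a sph v i) u := fun a i =>
    differentiableAt_pi.1 (((contDiff_sph.fderiv_right (m := ∞) (by simp)).clm_apply
      contDiff_const).differentiable (by simp) u) i
  have hAs : ∀ i j, DifferentiableAt ℝ (fun v => A (sph v) i j) u := fun i j =>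
    differentiableAt_pi.1 (differentiableAt_pi.1 (hA.comp u hs) i) j
  change DifferentiableAt ℝ (fun v => ∑ i, ∑ j, A (sph v) i j * pd a sph v i * pd b sph v j) u
  exact DifferentiableAt.fun_sum fun i _ => DifferentiableAt.fun_sum fun j _ =>
    ((hAs i j).mul (hp a i)).mul (hp b j)

lemma tr_congr {h : T u = T' u} : tr g T u = tr g T' u := by
  rw [tr, h, tr]

end Superposition

/-! ### Assembly of the potential of an arbitrary solution. -/

section Potential

lemma isPotentialAt_singField {κ : ℝ} (hκ : κ ^ 2 = 1) (μ : Fin 4) {u : Fin 3 → ℝ}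
    (hu : u ∈ sphDom) (hd : sph u ∈ singDom κ) :
    IsPotentialAt (zetaHat μ) (comps sph (singField κ μ)) u where
  contDiff := contDiff_zetaHat μ
  differentiableAt := differentiableAt_comps_sph
    (((contDiffOn_singField κ μ).contDiffAt ((isOpen_singDom κ).mem_nhds hd)).differentiableAt
      (by simp))
  symm a b := by rw [comps_singField hκ μ hu]; exact (kSing_isSymm κ μ u).apply b a
  tr_eq := (tr_congr (h := comps_singField hκ μ hu)).trans (tr_kSing hu κ μ)
  hessPlus_eq a b := by
    rw [hessPlus_zetaHat hu κ]
    exact (curl_congr (Filter.eventually_of_mem (isOpen_sphDom.mem_nhds hu) fun v hv =>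
      comps_singField hκ μ hv) a b).symm

lemma sph_mem_singDom {κ : ℝ} (hκ : κ ^ 2 = 1) {u : Fin 3 → ℝ} (hu : u ∈ sphDom) :
    sph u ∈ singDom κ := by
  have hs := sin_pos_of_mem hu
  have h : (sphPt (sph u)).2 2 = Real.cos (u 1) := by
    rw [sphPt_sph]
    simp [polar]
  intro h0
  rw [h] at h0
  have := Real.sin_sq_add_cos_sq (u 1)
  have h1 : (κ * Real.cos (u 1)) ^ 2 = 1 := by
    rw [show κ * Real.cos (u 1) = -1 by linarith]; norm_num
  nlinarith

/-- Every solution has a potential that is a superposition of the four singular tensors and of a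
globally smooth tensor. -/
theorem exists_potential {Φ : (Fin 4 → ℝ) → ℝ} (hΦ : IsSolution Φ) :
    ∃ (N : Fin 4 → ℝ) (Preg : (Fin 4 → ℝ) → Fin 4 → Fin 4 → ℝ), ContDiffOn ℝ ∞ Preg hyp ∧
      ∀ κ : ℝ, κ ^ 2 = 1 → ∀ S ⊆ hyp, S ⊆ singDom κ →
        IsPotentialOn S Φ (fun x => (∑ μ, N μ • singField κ μ x) + Preg x) := by
  obtain ⟨w, hw, hwave, N, c, h⟩ := exists_decomposition hΦ
  obtain ⟨P, hP, hpot⟩ := exists_regular_potential hw hwave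
  -- `N` and `P` come from the decomposition of Φ alone and are fixed before κ, so both patches
  -- share them.
  refine ⟨N, P, hP.mono hyp_subset_spatial, fun κ hκ S hS hSd => ?_⟩
  have hsum : (fun v => Φ (sph v)) = fun v => ∑ μ, N μ * zetaHat μ v +
      (∑ μ, c μ * zeta μ v + angShift (angLap w) (polar v)) := by
    ext v
    rw [h v, angShift]
    ring
  -- The zero summands pair each ζ_(μ) with the potential 0, so that Φ and its potential have the
  -- same shape for `IsPotentialAt.add_sum`.
  have hcomps : comps sph (fun x => (∑ μ, N μ • singField κ μ x) + P x) = fun v =>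
      ∑ μ, N μ • comps sph (singField κ μ) v + (∑ μ, c μ • (0 : Matrix (Fin 3) (Fin 3) ℝ) +
        comps sph P v) := by
    ext1 v
    rw [comps_add, comps_sum]
    simp only [comps_smul, smul_zero, Finset.sum_const_zero, zero_add]
  have main : ∀ u ∈ sphDom, IsPotentialAt (fun v => Φ (sph v))
      (comps sph (fun x => (∑ μ, N μ • singField κ μ x) + P x)) u := by
    intro u hu
    obtain ⟨h1, h2, h3⟩ := hpot u hu
    have hreg : IsPotentialAt (fun v => angShift (angLap w) (polar v)) (comps sph P) u :=
      ⟨contDiffOn_comp_polar (contDiffOn_angShift (contDiffOn_angLap hw)),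
        differentiableAt_comps_sph ((hP.contDiffAt (isOpen_spatial.mem_nhds
          (hyp_subset_spatial (isChart_sph.mapsTo u hu)))).differentiableAt (by simp)),
        h1, h2, h3⟩
    rw [hsum, hcomps]
    exact (hreg.add_sum c fun μ => isPotentialAt_zero (contDiff_zeta μ)
      (hessPlus_zeta hu μ)).add_sum N fun μ =>
        isPotentialAt_singField hκ μ hu (sph_mem_singDom hκ hu)
  refine isPotentialOn_of_sph (V := singDom κ ∩ spatial) hS
    ((isOpen_singDom κ).inter isOpen_spatial) (Set.subset_inter hSd (hS.trans hyp_subset_spatial))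
    hΦ.1 ?_ (fun u hu => (main u hu).symm) (fun u hu => (main u hu).tr_eq)
    fun u hu => (main u hu).hessPlus_eq
  refine ContDiffOn.add (ContDiffOn.sum fun μ _ => ?_) (hP.mono Set.inter_subset_right)
  exact ((contDiffOn_singField κ μ).mono Set.inter_subset_left).const_smul (N μ)

end Potential

end UnitHyperboloid

theorem lemma1 :
    -- `T_ab = D_a D_b Φ + h_ab Φ` is symmetric, traceless, curl-free and divergence-free
    (∀ Φ : (Fin 4 → ℝ) → ℝ, IsSolution Φ → ∀ U X, IsChart hyp U X → ∀ u ∈ U,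
      (∀ a b, hessPlus (metric X) (fun v => Φ (X v)) u a b =
        hessPlus (metric X) (fun v => Φ (X v)) u b a) ∧
      tr (metric X) (hessPlus (metric X) (fun v => Φ (X v))) u = 0 ∧
      (∀ a b, curl (metric X) (hessPlus (metric X) (fun v => Φ (X v))) a b u = 0) ∧
      (∀ b, divg (metric X) (hessPlus (metric X) (fun v => Φ (X v))) b u = 0)) ∧
    -- the explicit singular tensors are regular in the north and in the south patch, and give
    -- the singular part of a potential of `T_ab`
    (∃ kN kS : Fin 4 → (Fin 4 → ℝ) → Fin 4 → Fin 4 → ℝ,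
      (∀ μ, ContDiffOn ℝ ∞ (kN μ) northPatch ∧
        ∀ u ∈ sphDom, comps sph (kN μ) u = kSing 1 μ u) ∧
      (∀ μ, ContDiffOn ℝ ∞ (kS μ) southPatch ∧
        ∀ u ∈ sphDom, comps sph (kS μ) u = kSing (-1) μ u) ∧
      ∀ Φ : (Fin 4 → ℝ) → ℝ, IsSolution Φ →
        ∃ (N : Fin 4 → ℝ) (Preg : (Fin 4 → ℝ) → Fin 4 → Fin 4 → ℝ),
          ContDiffOn ℝ ∞ Preg hyp ∧
          IsPotentialOn northPatch Φ (fun x => (∑ μ, N μ • kN μ x) + Preg x) ∧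
          IsPotentialOn southPatch Φ (fun x => (∑ μ, N μ • kS μ x) + Preg x)) ∧
    -- the singular tensors are symmetric, traceless and integrate the equation for `ζ̂_(μ)`
    (∀ κ μ, ∀ u ∈ sphDom,
      (kSing κ μ u).IsSymm ∧
      tr (metric sph) (kSing κ μ) u = 0 ∧
      box (metric sph) (zetaHat μ) u + 3 * zetaHat μ u = 0 ∧
      ∀ a b, hessPlus (metric sph) (zetaHat μ) u a b =
        curl (metric sph) (kSing κ μ) a b u) ∧
    -- the scalars `ζ_(μ)` solve `D_a D_b ζ + h_ab ζ = 0`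
    (∀ μ, ∀ u ∈ sphDom, hessPlus (metric sph) (zeta μ) u = 0) ∧
    -- normalized orthogonality relations
    (∀ μ ν : Fin 4, ∀ τ θ : ℝ, 0 < θ → θ < Real.pi →
      ∫ φ in (0 : ℝ)..(2 * Real.pi),
        ∑ a, deltaK μ ![τ, θ, φ] 2 a * grad (metric sph) (zeta ν) a ![τ, θ, φ] =
      -8 * Real.pi * (if μ = ν then 1 else 0)) := by
  refine ⟨fun Φ hΦ U X hX u hu => hessPlus_props hΦ hX hu, ⟨singField 1, singField (-1),
    fun μ => ⟨(contDiffOn_singField 1 μ).mono northPatch_subset,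
      fun u hu => comps_singField (by norm_num) μ hu⟩,
    fun μ => ⟨(contDiffOn_singField (-1) μ).mono southPatch_subset,
      fun u hu => comps_singField (by norm_num) μ hu⟩, fun Φ hΦ => ?_⟩,
    fun κ μ u hu => ⟨kSing_isSymm κ μ u, tr_kSing hu κ μ, box_zetaHat hu μ,
      hessPlus_zetaHat hu κ μ⟩,
    fun μ u hu => hessPlus_zeta hu μ, fun μ ν τ θ h0 h1 => integral_deltaK_flux h0 h1 μ ν⟩
  obtain ⟨N, P, hP, h⟩ := exists_potential hΦ
  exact ⟨N, P, hP, h 1 (by norm_num) _ (fun x hx => hx.1) northPatch_subset,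
    h (-1) (by norm_num) _ (fun x hx => hx.1) southPatch_subset⟩
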